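/- For $d\ge 1$ let $\omega_d=\pi^{d/2}/\Gamma(1+d/2)$ be the volume of the unit ball of $\mathbb R^d$ and $f_d(r)=\omega_d r^d$ for $r\ge 0$. Let $(p_1,\dots,p_k)$ be a probability vector. *The coloured Palm Poisson process in $\mathbb R^d$* consists of the origin $O$ together with the points of a rate-one Poisson process in $\mathbb R^d$; every point (including $O$) is given colour $i$ with probability $p_i$, independently of all other colours and of the positions. For $R>0$, a *descending path from the origin with distances less than $R$* is a finite sequence $x_0=O,x_1,\dots,x_m$ ($m\ge 0$) of distinct points of this configuration with $R>|x_0-x_1|>|x_1-x_2|>\dots>|x_{m-1}-x_m|$. Let $V_R^{\downarrow}(O)$ be the set of points contained in some such path. *The coloured Poisson-weighted infinite tree (PWIT)* has as vertices the finite words over $\mathbb N$, with root the empty word $\emptyset$; the children of $v$ are the words $vj$, $j\in\mathbb N$. For each $v$ the weights $t(v,vj)$, $j\in\mathbb N$, of the edges from $v$ to its children are the points, in increasing order, of a rate-one Poisson process on $[0,\infty)$, independently for different $v$; every vertex is given colour $i$ with probability $p_i$, independently of all other colours and of the weights. For $T>0$, a *descending path from the root with weights less than $T$* is a finite sequence $v_0=\emptyset,v_1,\dots,v_m$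 ($m\ge 0$) in which each $v_i$ is a child of $v_{i-1}$ and $T>t(v_0,v_1)>t(v_1,v_2)>\dots>t(v_{m-1},v_m)$. Let $\widetilde V_T^{\downarrow}(\emptyset)$ be the set of vertices contained in some such path. **Proposition.** There exist absolute constants $\alpha>0$ and $c$ (not depending on $T$, $d$, $k$ or $(p_i)$) such that the following holds. Let $T\ge 1$, let $d>cT$, and let $R=f_d^{-1}(T)$, that is, $R\ge 0$ and $f_d(R)=T$. For every probability vector $(p_1,\dots,p_k)$, the coloured PWIT and the coloured Palm Poisson process in $\mathbb R^d$ can be defined on a common probability space so that, on an event of probability at least $1-e^{-\alpha T}$, there is a bijection $\phi:V_R^{\downarrow}(O)\to\widetilde V_T^{\downarrow}(\emptyset)$ with the following properties: (i) $x$ and $\phi(x)$ have the same colour for every $x\in V_R^{\downarrow}(O)$; (ii) for all $m\ge 0$ and $x_0,\dots,x_m\in V_R^{\downarrow}(O)$, the sequence $x_0,\dots,x_m$ is a descending path from the origin with distances less than $R$ if and only if $\phi(x_0),\dots,\phi(x_m)$ is a descending path from the root with weights less than $T$; and in that case $t(\phi(x_{i-1}),\phi(x_i))=f_d(|x_i-x_{i-1}|)$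 for $i=1,\dots,m$. -/

import Mathlib

open MeasureTheory ProbabilityTheory
open scoped ENNReal

namespace PWITCoupling

noncomputable section

/-- `N` is a Poisson process on `S` with intensity measure `ν`, regarded as a random counting
measure: the number of points in a set of finite intensity is Poisson distributed, and the numbers
of points in finitely many disjoint such sets are independent. -/
structure IsPoissonProcess {Ω S : Type*} [MeasurableSpace Ω] [MeasurableSpace S]
    (P : Measure Ω) (ν : Measure S) (N : Ω → Measure S) : Prop where
  measurable : Measurable N
  law : ∀ s : Set S, MeasurableSet s → ν s ≠ ∞ →
    P.map (fun ω => N ω s) = (poissonMeasure (ν s).toNNReal).map (fun n : ℕ => (n : ℝ≥0∞))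
  indep : ∀ (m : ℕ) (s : Fin m → Set S), (∀ i, MeasurableSet (s i)) → (∀ i, ν (s i) ≠ ∞) →
    Pairwise (fun i j => Disjoint (s i) (s j)) → iIndepFun (fun i ω => N ω (s i)) P

/-- The counting measure of a sequence of points (with multiplicity). -/
def countingMeasure {S : Type*} [MeasurableSpace S] (x : ℕ → S) : Measure S :=
  Measure.sum fun n => Measure.dirac (x n)

/-- The random variables `c i` are independent, each with distribution `p`. -/
structure IsIID {Ω ι κ : Type*} [MeasurableSpace Ω] [MeasurableSpace κ]
    (P : Measure Ω) (p : PMF κ) (c : ι → Ω → κ) : Prop where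
  measurable : ∀ i, Measurable (c i)
  law : ∀ i, P.map (c i) = p.toMeasure
  indep : iIndepFun c P

/-! ### The Palm version of the coloured Poisson process in Euclidean space -/

/-- The Palm version of the coloured rate one Poisson process in `ℝ^d`: a point `X 0` at the origin
together with the points `X 1, X 2, …` (listed in an arbitrary order) of a rate one Poisson
process; the point `X n` has colour `C n`, and the colours of all points, including that of the
origin, are independent with law `p` and independent of the positions. (The points are almost
surely distinct, since the intensity has no atoms.) -/
structure IsColouredPalmPoisson {Ω κ : Type*} [MeasurableSpace Ω] [MeasurableSpace κ]
    (P : Measure Ω) {d : ℕ} (p : PMF κ) (X : ℕ → Ω → EuclideanSpace ℝ (Fin d))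
    (C : ℕ → Ω → κ) : Prop where
  measurable : ∀ n, Measurable (X n)
  origin : ∀ ω, X 0 ω = 0
  poisson : IsPoissonProcess P volume (fun ω => countingMeasure fun n => X (n + 1) ω)
  colour : IsIID P p C
  indep : IndepFun (fun ω n => C n ω) (fun ω n => X n ω) P

/-- `ω_d`, the volume of the unit ball in `ℝ^d`. -/
def unitBallVolume (d : ℕ) : ℝ := Real.pi ^ ((d : ℝ) / 2) / Real.Gamma (1 + (d : ℝ) / 2)

/-- `f_d(r) = ω_d r^d`. -/
def ballVolume (d : ℕ) (r : ℝ) : ℝ := unitBallVolume d * r ^ d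

/-- `x 0, …, x k` is a descending path from the origin with distances less than `R`, in the
set `S` of points of `ℝ^d`. -/
structure IsDescendingPath {d : ℕ} (S : Set (EuclideanSpace ℝ (Fin d))) (R : ℝ) {k : ℕ}
    (x : Fin (k + 1) → EuclideanSpace ℝ (Fin d)) : Prop where
  start : x 0 = 0
  mem : ∀ i, x i ∈ S
  distinct : Function.Injective x
  lt : ∀ i : Fin k, dist (x i.castSucc) (x i.succ) < R
  descending : StrictAnti fun i : Fin k => dist (x i.castSucc) (x i.succ)

/-- The set of points that lie on some descending path from the origin with distances less than
`R`. -/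
def descendingPoints {d : ℕ} (S : Set (EuclideanSpace ℝ (Fin d))) (R : ℝ) :
    Set (EuclideanSpace ℝ (Fin d)) :=
  {y | ∃ (k : ℕ) (x : Fin (k + 1) → EuclideanSpace ℝ (Fin d)),
    IsDescendingPath S R x ∧ ∃ i, x i = y}

/-! ### The coloured Poisson-weighted infinite tree

The vertices are the finite words over `ℕ`, the root is the empty word, and the children of `v` are
the words `v ++ [j]`. -/

/-- The coloured PWIT: `t v 0 < t v 1 < …` are the weights of the edges from `v` to its children
`v ++ [0], v ++ [1], …`. They are the points, in increasing order, of a rate one Poisson process on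
`[0, ∞)`, these processes are independent for different `v`, and the colours of the vertices are
independent with law `p` and independent of the weights. -/
structure IsColouredPWIT {Ω κ : Type*} [MeasurableSpace Ω] [MeasurableSpace κ]
    (P : Measure Ω) (p : PMF κ) (t : List ℕ → ℕ → Ω → ℝ) (C : List ℕ → Ω → κ) : Prop where
  measurable : ∀ v j, Measurable (t v j)
  increasing : ∀ v, ∀ᵐ ω ∂P, StrictMono fun j => t v j ω
  poisson : ∀ v, IsPoissonProcess P (volume.restrict (Set.Ici (0 : ℝ)))
    (fun ω => countingMeasure fun j => t v j ω)
  indep_weights : iIndepFun (fun v ω j => t v j ω) P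
  colour : IsIID P p C
  indep : IndepFun (fun ω v => C v ω) (fun ω v j => t v j ω) P

/-- `w` is a child of `v`. -/
def IsChild (v w : List ℕ) : Prop := ∃ j, w = v ++ [j]

/-- The weight of the edge from `v` to its child `w` (only used when `w` is a child of `v`). -/
def edgeWeight (t : List ℕ → ℕ → ℝ) (v w : List ℕ) : ℝ := t v (w.getLastD 0)

theorem edgeWeight_child (t : List ℕ → ℕ → ℝ) (v : List ℕ) (j : ℕ) :
    edgeWeight t v (v ++ [j]) = t v j := by
  simp [edgeWeight, List.getLastD_eq_getLast?]

/-- `v 0, …, v k` is a descending path from the root with weights less than `T`, in the tree with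
edge weights `t`. -/
structure IsDescendingTreePath (t : List ℕ → ℕ → ℝ) (T : ℝ) {k : ℕ}
    (v : Fin (k + 1) → List ℕ) : Prop where
  start : v 0 = []
  child : ∀ i : Fin k, IsChild (v i.castSucc) (v i.succ)
  lt : ∀ i : Fin k, edgeWeight t (v i.castSucc) (v i.succ) < T
  descending : StrictAnti fun i : Fin k => edgeWeight t (v i.castSucc) (v i.succ)

/-- The set of vertices that lie on some descending path from the root with weights less than
`T`. -/
def descendingVertices (t : List ℕ → ℕ → ℝ) (T : ℝ) : Set (List ℕ) :=
  {w | ∃ (k : ℕ) (v : Fin (k + 1) → List ℕ), IsDescendingTreePath t T v ∧ ∃ i, v i = w}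

/-! ### Agreement of the two collections of descending paths -/

/-- `φ` is a bijection from the points on descending paths below `R` to the vertices on descending
paths below `T` which preserves colours, and preserves descending paths in both directions with
weights and distances related by `f_d`. Here `x` lists the points, `c n` is the colour of `x n`,
`t` are the edge weights and `c'` the vertex colours of the tree. -/
structure IsAgreement {d : ℕ} {κ : Type*} (R T : ℝ)
    (x : ℕ → EuclideanSpace ℝ (Fin d)) (c : ℕ → κ)
    (t : List ℕ → ℕ → ℝ) (c' : List ℕ → κ)
    (φ : EuclideanSpace ℝ (Fin d) → List ℕ) : Prop where
  bijOn : Set.BijOn φ (descendingPoints (Set.range x) R) (descendingVertices t T)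
  colour : ∀ n, x n ∈ descendingPoints (Set.range x) R → c' (φ (x n)) = c n
  path_iff : ∀ (k : ℕ) (y : Fin (k + 1) → EuclideanSpace ℝ (Fin d)),
    (∀ i, y i ∈ descendingPoints (Set.range x) R) →
      (IsDescendingPath (Set.range x) R y ↔ IsDescendingTreePath t T fun i => φ (y i))
  weight : ∀ (k : ℕ) (y : Fin (k + 1) → EuclideanSpace ℝ (Fin d)),
    IsDescendingPath (Set.range x) R y → ∀ i : Fin k,
      edgeWeight t (φ (y i.castSucc)) (φ (y i.succ)) =
        ballVolume d (dist (y i.castSucc) (y i.succ))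

end

end PWITCoupling

/-! Both objects are built from one family of independent rate-one Poisson processes in ℝ^d, one for
each word, each listed by increasing distance from 0. The map y ↦ f_d(|y|) carries Lebesgue measure
on ℝ^d to Lebesgue measure on [0, ∞) (`map_ballVolume_norm`), so the numbers f_d(|y|) are the
weights of a PWIT (`isColouredPWIT_coupling`). The same points y, read as displacements from parent
to child, embed the tree in ℝ^d with the root at the origin, and the relation between weights and
distances then holds by construction.

The embedded tree as a whole is not a Poisson process, because regions are visited many times. A
Poisson process is extracted by an exploration in which the words are treated in the order of their
codes, parents before children. A descending word searches the ball around its point whose radius is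
the length of the edge leading to it (R for the root). Only those of its children are kept that fall
into the part of the ball not searched before, and a further independent Poisson process fills
whatever is never searched. The part searched on behalf of a word is determined by the processes of
words with smaller codes, so it is independent of the process used in it. Resampling one coordinate
of the product measure at a time shows that the characteristic functional is that of a Poisson
process (`integral_assembled`, `isPoissonProcess_kept`).

The two sets of descending paths agree if the points of descending words are distinct and the ball
of a descending word contains no points of descending words but its children (`IsSeparated`): then
no descending word is discarded, and no path can take a step that the tree does not have
(`exists_isAgreement_configuration`). The expected number of descending words of length n is T^n/n!,
hence e^T in total (`tsum_measure_desc`). In high dimension two balls of radius R whose centres are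
at distance at least ρ meet inside a ball of radius ρ, where ρ² = R² - ρ²/4, that is ρ² = 4R²/5.
Such a ball has volume T(4/5)^{d/2}, exponentially small in d. If every new point avoids the balls
of radius ρ around earlier points and around the relevant midpoints, then separation follows
(`isSeparated_of_avoids`). A first moment bound, with the number of earlier points capped at e^{4T},
shows that this fails with probability exponentially small in T once d > 100T
(`measure_not_isSeparated_le`, `failure_bound`).

The exploration is stopped at a code n so large that a descending word of code at least n is
unlikely. Colours are independent labels of the words and of the terms of the additional process.
Reading them along an injection that depends on the positions only leaves them i.i.d. and
independent of the positions (`isIID_indepFun_reindex`). -/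

namespace PWITCoupling

open Filter Topology

/-! ### Poisson processes and characteristic functionals -/

/-- The point process listed by `x ω 0, x ω 1, …` has the characteristic functional of a Poisson
process with intensity `ν`. -/
def HasPoissonCharFun {Ω S : Type*} [MeasurableSpace Ω] [MeasurableSpace S]
    (P : Measure Ω) (ν : Measure S) (x : Ω → ℕ → S) : Prop :=
  ∀ h : S → ℝ, Measurable h → ν (Function.support h) ≠ ∞ →
    ∫ ω, Complex.exp (((∑' j, h (x ω j) : ℝ) : ℂ) * Complex.I) ∂P =
      Complex.exp (∫ y, (Complex.exp ((h y : ℂ) * Complex.I) - 1) ∂ν)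

theorem countingMeasure_apply {S : Type*} [MeasurableSpace S] (x : ℕ → S) {s : Set S}
    (hs : MeasurableSet s) :
    countingMeasure x s = ∑' j, s.indicator (fun _ => (1 : ℝ≥0∞)) (x j) := by
  rw [countingMeasure, Measure.sum_apply _ hs]
  refine tsum_congr fun j => ?_
  rw [Measure.dirac_apply' _ hs]
  rfl

theorem measurable_countingMeasure {S Ω : Type*} [MeasurableSpace S] [MeasurableSpace Ω]
    {x : ℕ → Ω → S} (hx : ∀ j, Measurable (x j)) :
    Measurable fun ω => countingMeasure fun j => x j ω := by
  refine Measure.measurable_of_measurable_coe _ fun s hs => ?_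
  simp_rw [countingMeasure_apply _ hs]
  exact Measurable.tsum fun j => (measurable_const.indicator hs).comp (hx j)

theorem summable_of_finite_mem {S : Type*} {x : ℕ → S} {s : Set S}
    (hf : {j | x j ∈ s}.Finite) (h : S → ℝ) (hh : ∀ y, y ∉ s → h y = 0) :
    Summable fun j => h (x j) := by
  refine summable_of_hasFiniteSupport (hf.subset fun j hj => ?_)
  by_contra hc
  exact hj (hh _ hc)

theorem countingMeasure_toReal {S : Type*} [MeasurableSpace S] {x : ℕ → S} {s : Set S}
    (hs : MeasurableSet s) (hf : {j | x j ∈ s}.Finite) :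
    countingMeasure x s ≠ ∞ ∧
      (countingMeasure x s).toReal = ∑' j, s.indicator (fun _ => (1 : ℝ)) (x j) := by
  rw [countingMeasure_apply _ hs]
  have h1 : ∀ j, s.indicator (fun _ => (1 : ℝ≥0∞)) (x j) =
      ENNReal.ofReal (s.indicator (fun _ => (1 : ℝ)) (x j)) := by
    intro j
    by_cases h : x j ∈ s <;> simp [h]
  have hsum : Summable fun j => s.indicator (fun _ => (1 : ℝ)) (x j) :=
    summable_of_finite_mem hf _ fun y hy => by simp [hy]
  have hnn : ∀ j, 0 ≤ s.indicator (fun _ => (1 : ℝ)) (x j) := fun j =>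
    Set.indicator_nonneg (fun _ _ => zero_le_one) _
  simp_rw [h1]
  rw [← ENNReal.ofReal_tsum_of_nonneg hnn hsum]
  exact ⟨ENNReal.ofReal_ne_top, ENNReal.toReal_ofReal (tsum_nonneg hnn)⟩

theorem norm_expI_sub_one_le (a : ℝ) : ‖Complex.exp ((a : ℂ) * Complex.I) - 1‖ ≤ 2 := by
  refine (norm_sub_le _ _).trans ?_
  rw [Complex.norm_exp_ofReal_mul_I, norm_one]
  norm_num

theorem measurable_expI {S : Type*} [MeasurableSpace S] {h : S → ℝ} (hh : Measurable h) :
    Measurable fun y => Complex.exp ((h y : ℂ) * Complex.I) := by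
  fun_prop

theorem integrable_expI {S : Type*} [MeasurableSpace S] {P : Measure S} [IsFiniteMeasure P]
    {h : S → ℝ} (hh : Measurable h) :
    Integrable (fun y => Complex.exp ((h y : ℂ) * Complex.I)) P := by
  refine Integrable.of_bound (measurable_expI hh).aestronglyMeasurable 1 (ae_of_all _ fun y => ?_)
  rw [Complex.norm_exp_ofReal_mul_I]

theorem integrable_expI_sub_one {S : Type*} [MeasurableSpace S] {ν : Measure S} {h : S → ℝ}
    (hh : Measurable h) (hν : ν (Function.support h) ≠ ∞) :
    Integrable (fun y => Complex.exp ((h y : ℂ) * Complex.I) - 1) ν := by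
  have hm : MeasurableSet (Function.support h) := measurableSet_support hh
  have : (fun y => Complex.exp ((h y : ℂ) * Complex.I) - 1) =
      (Function.support h).indicator fun y => Complex.exp ((h y : ℂ) * Complex.I) - 1 := by
    ext y
    by_cases hy : h y = 0
    · simp [hy]
    · rw [Set.indicator_of_mem]
      exact hy
  rw [this, integrable_indicator_iff hm]
  refine IntegrableOn.of_bound (lt_top_iff_ne_top.2 hν)
    ((measurable_expI hh).sub_const 1).aestronglyMeasurable 2
    (ae_of_all _ fun y => norm_expI_sub_one_le _)

/-- By disjointness at most one summand in the exponent is nonzero at `y`, which makes e^{ih} - 1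
additive. -/
theorem expI_sum_indicator {S : Type*} {m : ℕ} (s : Fin m → Set S) (θ : Fin m → ℝ)
    (hd : Pairwise fun i j => Disjoint (s i) (s j)) (y : S) :
    Complex.exp (((∑ i, θ i * (s i).indicator (fun _ => (1 : ℝ)) y : ℝ) : ℂ) * Complex.I) - 1 =
      ∑ i, (s i).indicator (fun _ => Complex.exp ((θ i : ℂ) * Complex.I) - 1) y := by
  by_cases h : ∃ i, y ∈ s i
  · obtain ⟨i, hi⟩ := h
    have hne : ∀ j, j ≠ i → y ∉ s j := fun j hj hy => (hd hj).le_bot ⟨hy, hi⟩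
    rw [Finset.sum_eq_single i (fun j _ hj => by simp [hne j hj]) (by simp),
      Finset.sum_eq_single i (fun j _ hj => by simp [hne j hj]) (by simp)]
    simp [hi]
  · push Not at h
    simp [h]

/-- The characteristic functional at the step function with value `θ i` on `s i` is the joint
characteristic function of the counts; it factorises because the sets are disjoint. -/
theorem HasPoissonCharFun.integral_counts {Ω S : Type*} [MeasurableSpace Ω] [MeasurableSpace S]
    {P : Measure Ω} {ν : Measure S} {x : Ω → ℕ → S} (hx : HasPoissonCharFun P ν x)
    (hfin : ∀ s, MeasurableSet s → ν s ≠ ∞ → ∀ᵐ ω ∂P, {j | x ω j ∈ s}.Finite)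
    {m : ℕ} (s : Fin m → Set S) (hs : ∀ i, MeasurableSet (s i)) (hν : ∀ i, ν (s i) ≠ ∞)
    (hd : Pairwise fun i j => Disjoint (s i) (s j)) (θ : Fin m → ℝ) :
    ∫ ω, Complex.exp (((∑ i, θ i * (countingMeasure (x ω) (s i)).toReal : ℝ) : ℂ) * Complex.I) ∂P =
      ∏ i, Complex.exp ((ν (s i)).toReal * (Complex.exp ((θ i : ℂ) * Complex.I) - 1)) := by
  set h : S → ℝ := fun y => ∑ i, θ i * (s i).indicator (fun _ => (1 : ℝ)) y with hh
  have hm : Measurable h := by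
    refine Finset.measurable_sum _ fun i _ => ?_
    exact (measurable_const.indicator (hs i)).const_mul _
  have hsupp : Function.support h ⊆ ⋃ i, s i := by
    intro y hy
    by_contra hc
    simp only [Set.mem_iUnion, not_exists] at hc
    exact hy (by simp [hh, hc])
  have hνs : ν (Function.support h) ≠ ∞ := by
    refine ne_top_of_le_ne_top ?_ (measure_mono hsupp)
    refine ne_top_of_le_ne_top ?_ (measure_iUnion_fintype_le ν s)
    exact ENNReal.sum_ne_top.2 fun i _ => hν i
  have key := hx h hm hνs
  have h1 : ∀ᵐ ω ∂P, ∑' j, h (x ω j) =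
      ∑ i, θ i * (countingMeasure (x ω) (s i)).toReal := by
    filter_upwards [ae_all_iff.2 fun i => hfin (s i) (hs i) (hν i)] with ω hω
    simp_rw [fun i => (countingMeasure_toReal (hs i) (hω i)).2, ← tsum_mul_left, hh]
    rw [Summable.tsum_finsetSum]
    intro i _
    exact (summable_of_finite_mem (hω i) _ fun y hy => by simp [hy]).mul_left _
  have h2 : ∀ᵐ ω ∂P, Complex.exp (((∑ i, θ i * (countingMeasure (x ω) (s i)).toReal : ℝ) : ℂ) *
      Complex.I) = Complex.exp (((∑' j, h (x ω j) : ℝ) : ℂ) * Complex.I) :=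
    h1.mono fun ω hω => by rw [hω]
  rw [integral_congr_ae h2, key, ← Complex.exp_sum]
  congr 1
  simp_rw [hh, expI_sum_indicator s θ hd]
  rw [integral_finsetSum]
  · refine Finset.sum_congr rfl fun i _ => ?_
    rw [integral_indicator_const _ (hs i), Complex.real_smul]
    rfl
  · intro i _
    exact (integrable_indicator_iff (hs i)).2 (integrableOn_const (hν i))

/-- Characteristic functions determine laws, and a joint characteristic function that is a product
gives independence. The counts are treated as real variables, which is harmless since they are
almost surely finite. -/
theorem HasPoissonCharFun.isPoissonProcess {Ω S : Type*} [MeasurableSpace Ω] [MeasurableSpace S]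
    {P : Measure Ω} [IsProbabilityMeasure P] {ν : Measure S} {x : ℕ → Ω → S}
    (hx : HasPoissonCharFun P ν fun ω j => x j ω) (hxm : ∀ j, Measurable (x j))
    (hfin : ∀ s, MeasurableSet s → ν s ≠ ∞ → ∀ᵐ ω ∂P, {j | x j ω ∈ s}.Finite) :
    IsPoissonProcess P ν fun ω => countingMeasure fun j => x j ω := by
  have hNm : Measurable fun ω => countingMeasure fun j => x j ω := measurable_countingMeasure hxm
  have hsm : ∀ s, MeasurableSet s →
      Measurable fun ω => (countingMeasure (fun j => x j ω) s).toReal := fun s hs =>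
    ((Measure.measurable_coe hs).comp hNm).ennreal_toReal
  have hlaw : ∀ s, MeasurableSet s → ν s ≠ ∞ →
      P.map (fun ω => (countingMeasure (fun j => x j ω) s).toReal) =
        (poissonMeasure (ν s).toNNReal).map (Nat.cast : ℕ → ℝ) := by
    intro s hs hν
    have : IsProbabilityMeasure (P.map (fun ω => (countingMeasure (fun j => x j ω) s).toReal)) :=
      Measure.isProbabilityMeasure_map (hsm s hs).aemeasurable
    refine Measure.ext_of_charFun (funext fun θ => ?_)
    rw [charFun_map_cast_poissonMeasure, charFun_apply_real,
      integral_map (hsm s hs).aemeasurable (by fun_prop)]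
    have := hx.integral_counts hfin (fun _ : Fin 1 => s) (fun _ => hs) (fun _ => hν)
      (fun i j hij => (hij (Subsingleton.elim _ _)).elim) (fun _ => θ)
    simp only [Finset.univ_unique, Finset.sum_const, Finset.card_singleton, one_smul,
      Finset.prod_const, pow_one] at this
    convert this using 1
    · congr with ω
      push_cast
      ring_nf
    · rfl
  have hofReal : ∀ s, MeasurableSet s → ν s ≠ ∞ → ∀ᵐ ω ∂P,
      ENNReal.ofReal (countingMeasure (fun j => x j ω) s).toReal =
        countingMeasure (fun j => x j ω) s := by
    intro s hs hν
    filter_upwards [hfin s hs hν] with ω hω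
    exact ENNReal.ofReal_toReal (countingMeasure_toReal hs hω).1
  refine ⟨hNm, fun s hs hν => ?_, fun m s hs hν hd => ?_⟩
  · rw [← Measure.map_congr (hofReal s hs hν)]
    have h2 := congrArg (Measure.map ENNReal.ofReal) (hlaw s hs hν)
    rw [Measure.map_map ENNReal.measurable_ofReal (hsm s hs),
      Measure.map_map ENNReal.measurable_ofReal (by fun_prop)] at h2
    have h3 : (ENNReal.ofReal ∘ Nat.cast : ℕ → ℝ≥0∞) = fun n : ℕ => (n : ℝ≥0∞) :=
      funext fun n => ENNReal.ofReal_natCast n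
    rw [h3] at h2
    exact h2
  · have hind : iIndepFun (fun i ω => (countingMeasure (fun j => x j ω) (s i)).toReal) P := by
      rw [iIndepFun_iff_charFun_pi fun i => (hsm _ (hs i)).aemeasurable]
      intro θ
      rw [charFun_apply, integral_map (by
        refine Measurable.aemeasurable ?_
        exact (WithLp.measurable_toLp 2 _).comp (measurable_pi_lambda _ fun i => hsm _ (hs i)))
        (by fun_prop)]
      simp_rw [hlaw _ (hs _) (hν _), charFun_map_cast_poissonMeasure]
      refine Eq.trans ?_ (hx.integral_counts hfin s hs hν hd (fun i => θ i))
      congr with ω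
    have := hind.comp (fun _ => ENNReal.ofReal) fun _ => ENNReal.measurable_ofReal
    exact this.congr fun i => hofReal (s i) (hs i) (hν i)


/-! ### Moments of the Poisson distribution and of product measures -/

theorem lintegral_poissonMeasure_one (g : ℕ → ℝ≥0∞) :
    ∫⁻ n, g n ∂(poissonMeasure 1) = ∑' n : ℕ, ENNReal.ofReal (Real.exp (-1) / n.factorial) * g n := by
  rw [poissonMeasure, lintegral_sum_measure]
  refine tsum_congr fun n => ?_
  rw [lintegral_smul_measure, lintegral_dirac]
  simp

/-- The identity E[N g(N)] = E[g(N + 1)], from n/n! = 1/(n-1)!. It gives E N = 1 and E N(N - 1) = 1.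
-/
theorem lintegral_poissonMeasure_one_mul (g : ℕ → ℝ≥0∞) :
    ∫⁻ n, n * g n ∂(poissonMeasure 1) = ∫⁻ n, g (n + 1) ∂(poissonMeasure 1) := by
  rw [lintegral_poissonMeasure_one, lintegral_poissonMeasure_one, tsum_eq_zero_add' (by simp)]
  simp only [Nat.factorial_zero, Nat.cast_zero, zero_mul, mul_zero, zero_add]
  refine tsum_congr fun n => ?_
  rw [← mul_assoc]
  congr 1
  rw [← ENNReal.ofReal_natCast, ← ENNReal.ofReal_mul (by positivity)]
  congr 1
  rw [Nat.factorial_succ]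
  push_cast
  field_simp

theorem lintegral_poissonMeasure_one_id : ∫⁻ n, (n : ℝ≥0∞) ∂(poissonMeasure 1) = 1 := by
  have := lintegral_poissonMeasure_one_mul fun _ => 1
  simpa using this

theorem lintegral_poissonMeasure_one_mul_sub :
    ∫⁻ n, (n : ℝ≥0∞) * ((n - 1 : ℕ) : ℝ≥0∞) ∂(poissonMeasure 1) = 1 := by
  have := lintegral_poissonMeasure_one_mul fun n => ((n - 1 : ℕ) : ℝ≥0∞)
  simp only [Nat.add_sub_cancel] at this
  rw [this, lintegral_poissonMeasure_one_id]

theorem tsum_ite_lt (n : ℕ) : ∑' j : ℕ, (if j < n then 1 else 0 : ℝ≥0∞) = n := by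
  rw [tsum_eq_sum (s := Finset.range n) fun j hj => by simpa using hj]
  rw [Finset.sum_congr rfl fun j hj => if_pos (Finset.mem_range.1 hj)]
  simp

theorem tsum_tsum_ite_ne_lt (n : ℕ) :
    ∑' i : ℕ, ∑' j : ℕ, (if i ≠ j ∧ i < n ∧ j < n then 1 else 0 : ℝ≥0∞) = n * ((n - 1 : ℕ) : ℝ≥0∞) := by
  rw [tsum_eq_sum (s := Finset.range n)]
  · have : ∀ i ∈ Finset.range n,
        ∑' j : ℕ, (if i ≠ j ∧ i < n ∧ j < n then 1 else 0 : ℝ≥0∞) = ((n - 1 : ℕ) : ℝ≥0∞) := by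
      intro i hi
      rw [tsum_eq_sum (s := (Finset.range n).erase i)]
      · rw [Finset.sum_congr rfl (g := fun _ => 1), Finset.sum_const, Finset.card_erase_of_mem hi]
        · simp
        · intro j hj
          rw [Finset.mem_erase] at hj
          rw [if_pos ⟨hj.1.symm, Finset.mem_range.1 hi, Finset.mem_range.1 hj.2⟩]
      · intro j hj
        rw [if_neg]
        rintro ⟨h1, h2, h3⟩
        exact hj (Finset.mem_erase.2 ⟨h1.symm, Finset.mem_range.2 h3⟩)
    rw [Finset.sum_congr rfl this]
    simp
  · intro i hi
    simp only [Finset.mem_range] at hi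
    simp [hi]

theorem lintegral_infinitePi_eval {ι : Type*} {X : ι → Type*} [∀ i, MeasurableSpace (X i)]
    (μ : ∀ i, Measure (X i)) [∀ i, IsProbabilityMeasure (μ i)] (i : ι) {g : X i → ℝ≥0∞}
    (hg : Measurable g) : ∫⁻ x, g (x i) ∂Measure.infinitePi μ = ∫⁻ y, g y ∂μ i :=
  (measurePreserving_eval_infinitePi μ i).lintegral_comp hg

theorem lintegral_infinitePi_eval_pair {ι : Type*} {X : ι → Type*} [∀ i, MeasurableSpace (X i)]
    (μ : ∀ i, Measure (X i)) [∀ i, IsProbabilityMeasure (μ i)] {i j : ι} (hij : i ≠ j)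
    {g : X i × X j → ℝ≥0∞} (hg : Measurable g) :
    ∫⁻ x, g (x i, x j) ∂Measure.infinitePi μ = ∫⁻ y, ∫⁻ y', g (y, y') ∂μ j ∂μ i := by
  rw [← lintegral_prod _ hg.aemeasurable, ← Measure.infinitePi_map_eval_prod hij,
    lintegral_map hg (by fun_prop)]

theorem integral_infinitePi_prod {ι : Type*} {X : ι → Type*} [∀ i, MeasurableSpace (X i)]
    (μ : ∀ i, Measure (X i)) [∀ i, IsProbabilityMeasure (μ i)] (s : Finset ι)
    (f : ∀ i, X i → ℂ) (hf : ∀ i, Measurable (f i)) :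
    ∫ x, ∏ i ∈ s, f i (x i) ∂Measure.infinitePi μ = ∏ i ∈ s, ∫ y, f i y ∂μ i := by
  have h1 := integral_restrict_infinitePi (μ := μ) (s := s)
    (f := fun y => ∏ i : s, f i (y i)) (by
      refine Measurable.aestronglyMeasurable ?_
      fun_prop)
  rw [integral_fintype_prod_eq_prod (fun i : s => f i)] at h1
  rw [← Finset.prod_coe_sort s fun i => ∫ y, f i y ∂μ i, ← h1]
  congr with x
  rw [← Finset.prod_coe_sort s fun i => f i (x i)]
  rfl

theorem integral_poissonMeasure_one_pow (z : ℂ) :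
    ∫ n, z ^ n ∂(poissonMeasure 1) = Complex.exp (z - 1) := by
  rw [integral_poissonMeasure, Complex.exp_sub, Complex.exp_eq_exp_ℂ,
    ← (NormedSpace.expSeries_div_hasSum_exp z).tsum_eq, div_eq_mul_inv, ← tsum_mul_right]
  refine tsum_congr fun n => ?_
  rw [← NormedSpace.exp_neg, ← Complex.exp_eq_exp_ℂ]
  simp only [NNReal.coe_one, one_pow, mul_one, Complex.real_smul]
  push_cast
  ring

/-! ### A superposition of independent mixed samples -/

variable {S : Type*} [MeasurableSpace S]

/-- The law of independent Poisson numbers with mean one and of an independent array of independent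
points, the points in row `l` having law `κ l`. -/
noncomputable def arrayLaw (κ : ℕ → Measure S) [∀ l, IsProbabilityMeasure (κ l)] :
    Measure ((ℕ → ℕ) × (ℕ × ℕ → S)) :=
  (Measure.infinitePi fun _ => poissonMeasure 1).prod (Measure.infinitePi fun i : ℕ × ℕ => κ i.1)

instance (κ : ℕ → Measure S) [∀ l, IsProbabilityMeasure (κ l)] :
    IsProbabilityMeasure (arrayLaw κ) := by
  unfold arrayLaw
  infer_instance

variable (κ : ℕ → Measure S) [∀ l, IsProbabilityMeasure (κ l)]

theorem lintegral_arrayLaw_sum {g : S → ℝ≥0∞} (hg : Measurable g) :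
    ∫⁻ p, ∑' i : ℕ × ℕ, (if i.2 < p.1 i.1 then g (p.2 i) else 0) ∂arrayLaw κ =
      ∫⁻ y, g y ∂(Measure.sum κ) := by
  have hm : ∀ i : ℕ × ℕ, Measurable fun p : (ℕ → ℕ) × (ℕ × ℕ → S) =>
      (if i.2 < p.1 i.1 then g (p.2 i) else 0) := fun i =>
    Measurable.ite (measurableSet_lt measurable_const (by fun_prop)) (by fun_prop) measurable_const
  rw [lintegral_tsum fun i => (hm i).aemeasurable, ENNReal.tsum_prod', lintegral_sum_measure]
  refine tsum_congr fun l => ?_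
  have h1 : ∀ j : ℕ, ∫⁻ p, (if j < p.1 l then g (p.2 (l, j)) else 0) ∂arrayLaw κ =
      (∫⁻ n, (if j < n then 1 else 0) ∂(poissonMeasure 1)) * ∫⁻ y, g y ∂(κ l) := by
    intro j
    rw [arrayLaw, lintegral_prod _ (hm (l, j)).aemeasurable]
    have : ∀ N : ℕ → ℕ, ∫⁻ z, (if j < N l then g (z (l, j)) else 0)
        ∂(Measure.infinitePi fun i : ℕ × ℕ => κ i.1) =
        (if j < N l then 1 else 0) * ∫⁻ y, g y ∂(κ l) := by
      intro N
      split_ifs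
      · rw [one_mul]
        exact lintegral_infinitePi_eval (fun i : ℕ × ℕ => κ i.1) (l, j) hg
      · simp
    simp_rw [this]
    have hmj : Measurable fun N : ℕ → ℕ => (if j < N l then 1 else 0 : ℝ≥0∞) :=
      Measurable.ite (measurableSet_lt measurable_const (by fun_prop)) measurable_const
        measurable_const
    rw [lintegral_mul_const _ hmj]
    congr 1
    exact lintegral_infinitePi_eval (fun _ : ℕ => poissonMeasure 1) l
      (g := fun n => if j < n then 1 else 0) measurable_from_nat
  simp_rw [h1]
  rw [ENNReal.tsum_mul_right, ← lintegral_tsum fun j => measurable_from_nat.aemeasurable]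
  simp_rw [tsum_ite_lt]
  rw [lintegral_poissonMeasure_one_id, one_mul]

/-- Every pair of rows contributes the full product κ l ⊗ κ l': two different rows because E N · E
N' = 1, a row with itself because E N(N - 1) = 1. The latter is where the Poisson law of the row
lengths enters. -/
theorem lintegral_arrayLaw_pairs {g : S → S → ℝ≥0∞} (hg : Measurable (Function.uncurry g)) :
    ∫⁻ p, ∑' i : ℕ × ℕ, ∑' j : ℕ × ℕ, (if i ≠ j ∧ i.2 < p.1 i.1 ∧ j.2 < p.1 j.1 then
      g (p.2 i) (p.2 j) else 0) ∂arrayLaw κ =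
      ∫⁻ y, ∫⁻ y', g y y' ∂(Measure.sum κ) ∂(Measure.sum κ) := by
  classical
  have hmN : ∀ i j : ℕ × ℕ, MeasurableSet
      {N : ℕ → ℕ | i ≠ j ∧ i.2 < N i.1 ∧ j.2 < N j.1} := fun i j =>
    (MeasurableSet.const _).inter
      ((measurableSet_lt measurable_const (measurable_pi_apply i.1)).inter
        (measurableSet_lt measurable_const (measurable_pi_apply j.1)))
  have hm : ∀ i j : ℕ × ℕ, Measurable fun p : (ℕ → ℕ) × (ℕ × ℕ → S) =>
      (if i ≠ j ∧ i.2 < p.1 i.1 ∧ j.2 < p.1 j.1 then g (p.2 i) (p.2 j) else 0) := fun i j =>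
    Measurable.ite (measurable_fst (hmN i j))
      (hg.comp (f := fun p : (ℕ → ℕ) × (ℕ × ℕ → S) => (p.2 i, p.2 j)) (by fun_prop))
      measurable_const
  have h1 : ∀ i j : ℕ × ℕ, ∫⁻ p, (if i ≠ j ∧ i.2 < p.1 i.1 ∧ j.2 < p.1 j.1 then
      g (p.2 i) (p.2 j) else 0) ∂arrayLaw κ =
      (∫⁻ N, (if i ≠ j ∧ i.2 < N i.1 ∧ j.2 < N j.1 then 1 else 0)
        ∂(Measure.infinitePi fun _ : ℕ => poissonMeasure 1)) *
        ∫⁻ y, ∫⁻ y', g y y' ∂(κ j.1) ∂(κ i.1) := by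
    intro i j
    rw [arrayLaw, lintegral_prod _ (hm i j).aemeasurable,
      ← lintegral_mul_const _ (Measurable.ite (hmN i j) measurable_const measurable_const)]
    refine lintegral_congr fun N => ?_
    split_ifs with h
    · rw [one_mul]
      exact lintegral_infinitePi_eval_pair (fun i : ℕ × ℕ => κ i.1) h.1 hg
    · simp
  rw [lintegral_tsum fun i => (Measurable.tsum fun j => hm i j).aemeasurable]
  simp_rw [lintegral_tsum fun j => (hm _ j).aemeasurable, h1]
  simp_rw [ENNReal.tsum_prod']
  have h2 : ∀ l l' : ℕ, ∑' i : ℕ, ∑' j : ℕ,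
      ∫⁻ N, (if (l, i) ≠ (l', j) ∧ i < N l ∧ j < N l' then 1 else 0 : ℝ≥0∞)
        ∂(Measure.infinitePi fun _ : ℕ => poissonMeasure 1) = 1 := by
    intro l l'
    have e : ∀ i : ℕ, ∑' j : ℕ,
        ∫⁻ N, (if (l, i) ≠ (l', j) ∧ i < N l ∧ j < N l' then 1 else 0 : ℝ≥0∞)
        ∂(Measure.infinitePi fun _ : ℕ => poissonMeasure 1) =
        ∫⁻ N, ∑' j : ℕ, (if (l, i) ≠ (l', j) ∧ i < N l ∧ j < N l' then 1 else 0 : ℝ≥0∞)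
        ∂(Measure.infinitePi fun _ : ℕ => poissonMeasure 1) := fun i =>
      (lintegral_tsum fun j => (Measurable.ite (hmN (l, i) (l', j)) measurable_const
        measurable_const).aemeasurable).symm
    simp_rw [e]
    rw [← lintegral_tsum fun i => (Measurable.tsum fun j =>
      (Measurable.ite (hmN (l, i) (l', j)) measurable_const measurable_const)).aemeasurable]
    by_cases hl : l = l'
    · subst hl
      have h3 : ∀ (N : ℕ → ℕ) (i j : ℕ),
          (if (l, i) ≠ (l, j) ∧ i < N l ∧ j < N l then 1 else 0 : ℝ≥0∞) =
            if i ≠ j ∧ i < N l ∧ j < N l then 1 else 0 := by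
        intro N i j
        simp
      simp_rw [h3, tsum_tsum_ite_ne_lt]
      rw [lintegral_infinitePi_eval (fun _ : ℕ => poissonMeasure 1) l
        (g := fun n : ℕ => (n : ℝ≥0∞) * ((n - 1 : ℕ) : ℝ≥0∞)) (measurable_from_nat),
        lintegral_poissonMeasure_one_mul_sub]
    · have : ∀ N : ℕ → ℕ, ∑' i : ℕ, ∑' j : ℕ,
          (if (l, i) ≠ (l', j) ∧ i < N l ∧ j < N l' then 1 else 0 : ℝ≥0∞) = N l * N l' := by
        intro N
        rw [← tsum_ite_lt (N l), ← tsum_ite_lt (N l'), ← ENNReal.tsum_mul_right]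
        refine tsum_congr fun i => ?_
        rw [← ENNReal.tsum_mul_left]
        refine tsum_congr fun j => ?_
        by_cases hi : i < N l <;> simp [hl, hi]
      simp_rw [this]
      rw [lintegral_infinitePi_eval_pair (fun _ : ℕ => poissonMeasure 1) hl
        (g := fun q : ℕ × ℕ => (q.1 : ℝ≥0∞) * q.2) (by fun_prop)]
      simp_rw [lintegral_const_mul _ (measurable_from_nat : Measurable fun n : ℕ => (n : ℝ≥0∞)),
        lintegral_poissonMeasure_one_id, mul_one]
      exact lintegral_poissonMeasure_one_id
  have h4 : ∀ l : ℕ, ∑' i : ℕ, ∑' l' : ℕ, ∑' j : ℕ,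
      (∫⁻ N, (if (l, i) ≠ (l', j) ∧ i < N l ∧ j < N l' then 1 else 0 : ℝ≥0∞)
        ∂(Measure.infinitePi fun _ : ℕ => poissonMeasure 1)) *
        ∫⁻ y, ∫⁻ y', g y y' ∂(κ l') ∂(κ l) =
      ∑' l' : ℕ, ∫⁻ y, ∫⁻ y', g y y' ∂(κ l') ∂(κ l) := by
    intro l
    rw [ENNReal.tsum_comm]
    refine tsum_congr fun l' => ?_
    simp_rw [ENNReal.tsum_mul_right]
    rw [h2, one_mul]
  rw [tsum_congr h4, lintegral_sum_measure]
  refine tsum_congr fun l => ?_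
  simp_rw [lintegral_sum_measure]
  exact (lintegral_tsum (f := fun l' y => ∫⁻ y', g y y' ∂(κ l'))
    fun l' => (Measurable.lintegral_prod_right' hg).aemeasurable).symm

/-- The points of an array that are listed, the first `p.1 l` points of row `l`, summed against
`h`. -/
noncomputable def arraySum (h : S → ℝ) (p : (ℕ → ℕ) × (ℕ × ℕ → S)) : ℝ :=
  ∑' i : ℕ × ℕ, if i.2 < p.1 i.1 then h (p.2 i) else 0

theorem ae_finite_arrayLaw {s : Set S} (hs : MeasurableSet s) (hν : Measure.sum κ s ≠ ∞) :
    ∀ᵐ p ∂arrayLaw κ, {i : ℕ × ℕ | i.2 < p.1 i.1 ∧ p.2 i ∈ s}.Finite := by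
  have hg : Measurable (s.indicator fun _ => (1 : ℝ≥0∞)) := measurable_const.indicator hs
  have h1 := lintegral_arrayLaw_sum κ hg
  rw [lintegral_indicator_const hs, one_mul] at h1
  have hm : ∀ i : ℕ × ℕ, Measurable fun p : (ℕ → ℕ) × (ℕ × ℕ → S) =>
      (if i.2 < p.1 i.1 then s.indicator (fun _ => (1 : ℝ≥0∞)) (p.2 i) else 0) := fun i =>
    Measurable.ite (measurableSet_lt measurable_const (by fun_prop)) (by fun_prop) measurable_const
  have h2 := ae_lt_top (Measurable.tsum hm) (h1.trans_ne hν)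
  filter_upwards [h2] with p hp
  have h3 := ENNReal.finite_const_le_of_tsum_ne_top hp.ne one_ne_zero
  refine h3.subset fun i hi => ?_
  simp only [Set.mem_ofPred_eq] at hi ⊢
  rw [if_pos hi.1, Set.indicator_of_mem hi.2]

omit [MeasurableSpace S] in
theorem tendsto_arraySum {h : S → ℝ} {p : (ℕ → ℕ) × (ℕ × ℕ → S)}
    (hf : {i : ℕ × ℕ | i.2 < p.1 i.1 ∧ p.2 i ∈ Function.support h}.Finite) :
    Tendsto (fun L => ∑ l ∈ Finset.range L, ∑ j ∈ Finset.range (p.1 l), h (p.2 (l, j))) atTop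
      (𝓝 (arraySum h p)) := by
  have hsum : Summable fun i : ℕ × ℕ => if i.2 < p.1 i.1 then h (p.2 i) else 0 := by
    refine summable_of_hasFiniteSupport (hf.subset fun i hi => ?_)
    simp only [Function.mem_support, ne_eq, ite_eq_right_iff, Classical.not_imp] at hi
    exact hi
  have h1 := hsum.hasSum.prod_fiberwise (g := fun l => ∑ j ∈ Finset.range (p.1 l), h (p.2 (l, j)))
    (fun l => by
      have : HasSum (fun j => if j < p.1 l then h (p.2 (l, j)) else 0) _ :=
        hasSum_sum_of_ne_finset_zero (s := Finset.range (p.1 l)) (fun j hj => by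
          rw [if_neg]; simpa using hj)
      rwa [Finset.sum_congr rfl fun j hj => if_pos (Finset.mem_range.1 hj)] at this)
  exact h1.tendsto_sum_nat

/-- Given the lengths `N`, the first rows contribute the product of φ_l ^ N_l, where φ_l is the
integral of e^{ih} against `κ l`. The Poisson generating function turns each factor into exp(φ_l -
1), and dominated convergence adds up all the rows. -/
theorem integral_arrayLaw_expI {h : S → ℝ} (hh : Measurable h)
    (hν : Measure.sum κ (Function.support h) ≠ ∞) :
    ∫ p, Complex.exp ((arraySum h p : ℂ) * Complex.I) ∂arrayLaw κ =
      Complex.exp (∫ y, (Complex.exp ((h y : ℂ) * Complex.I) - 1) ∂(Measure.sum κ)) := by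
  classical
  -- `F L` is the sum over the first `L` rows only, so that it is a finite sum for every array.
  set F : ℕ → (ℕ → ℕ) × (ℕ × ℕ → S) → ℝ := fun L p =>
    ∑ l ∈ Finset.range L, ∑ j ∈ Finset.range (p.1 l), h (p.2 (l, j)) with hF
  have hFm : ∀ L, Measurable (F L) := by
    intro L
    refine Finset.measurable_sum _ fun l _ => ?_
    have hm : Measurable fun q : ℕ × (ℕ × ℕ → S) => ∑ j ∈ Finset.range q.1, h (q.2 (l, j)) :=
      measurable_from_prod_countable_right fun n =>
        Finset.measurable_sum (Finset.range n) (f := fun j (z : ℕ × ℕ → S) => h (z (l, j))) fun j _ => by fun_prop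
    exact hm.comp (f := fun p : (ℕ → ℕ) × (ℕ × ℕ → S) => (p.1 l, p.2)) (by fun_prop)
  have hint := integrable_expI_sub_one hh hν
  have hlim1 : Tendsto (fun L => ∫ p, Complex.exp ((F L p : ℂ) * Complex.I) ∂arrayLaw κ) atTop
      (𝓝 (∫ p, Complex.exp ((arraySum h p : ℂ) * Complex.I) ∂arrayLaw κ)) := by
    refine tendsto_integral_of_dominated_convergence (fun _ => 1)
      (fun L => (measurable_expI (hFm L)).aestronglyMeasurable) (integrable_const _)
      (fun L => ae_of_all _ fun p => by rw [Complex.norm_exp_ofReal_mul_I]) ?_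
    filter_upwards [ae_finite_arrayLaw κ (measurableSet_support hh) hν] with p hp
    have hc : Continuous fun a : ℝ => Complex.exp ((a : ℂ) * Complex.I) := by fun_prop
    exact (hc.tendsto _).comp (tendsto_arraySum hp)
  have hlim2 : Tendsto (fun L => Complex.exp (∑ l ∈ Finset.range L,
      ∫ y, (Complex.exp ((h y : ℂ) * Complex.I) - 1) ∂(κ l))) atTop
      (𝓝 (Complex.exp (∫ y, (Complex.exp ((h y : ℂ) * Complex.I) - 1) ∂(Measure.sum κ)))) :=
    (Complex.continuous_exp.tendsto _).comp (hasSum_integral_measure hint).tendsto_sum_nat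
  refine tendsto_nhds_unique hlim1 (hlim2.congr fun L => ?_)
  have hFI : Integrable (fun p => Complex.exp ((F L p : ℂ) * Complex.I)) (arrayLaw κ) :=
    integrable_expI (hFm L)
  rw [arrayLaw, integral_prod _ hFI]
  have hz : ∀ N : ℕ → ℕ, ∫ z, Complex.exp ((F L (N, z) : ℂ) * Complex.I)
      ∂(Measure.infinitePi fun i : ℕ × ℕ => κ i.1) =
      ∏ l ∈ Finset.range L, (∫ y, Complex.exp ((h y : ℂ) * Complex.I) ∂(κ l)) ^ N l := by
    intro N
    have hs : ∀ i : ℕ × ℕ, i ∈ ((Finset.range L).biUnion fun l =>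
        (Finset.range (N l)).image (Prod.mk l)) ↔
        i.1 ∈ Finset.range L ∧ i.2 ∈ Finset.range (N i.1) := by
      rintro ⟨l, j⟩
      simp
    have h1 := integral_infinitePi_prod (fun i : ℕ × ℕ => κ i.1)
      ((Finset.range L).biUnion fun l => (Finset.range (N l)).image (Prod.mk l))
      (fun _ y => Complex.exp ((h y : ℂ) * Complex.I)) (fun _ => measurable_expI hh)
    rw [Finset.prod_finset_product _ (Finset.range L) (fun l => Finset.range (N l)) hs] at h1
    simp only [Finset.prod_const, Finset.card_range] at h1
    rw [← h1]
    congr with z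
    rw [← Complex.exp_sum, ← Finset.sum_mul, Finset.sum_finset_product _ (Finset.range L) (fun l => Finset.range (N l)) hs]
    simp [hF]
  simp_rw [hz]
  rw [integral_infinitePi_prod (fun _ : ℕ => poissonMeasure 1) (Finset.range L)
    (fun l n => (∫ y, Complex.exp ((h y : ℂ) * Complex.I) ∂(κ l)) ^ n)
    (fun _ => measurable_from_nat), Complex.exp_sum]
  refine Finset.prod_congr rfl fun l _ => ?_
  rw [integral_poissonMeasure_one_pow, integral_sub (integrable_expI hh) (integrable_const _)]
  simp


/-! ### Measurable increasing enumerations -/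

/-- The number of elements of `s` at which `τ` is smaller than at `n`. -/
noncomputable def sortRank (s : Set ℕ) (τ : ℕ → ℝ) (n : ℕ) : ℝ≥0∞ :=
  ∑' m, ({m | m ∈ s ∧ τ m < τ n} : Set ℕ).indicator (fun _ => 1) m

/-- The `j`-th element of `s` in the order of increasing `τ`. -/
noncomputable def sortedIdx (s : Set ℕ) (τ : ℕ → ℝ) (j : ℕ) : ℕ :=
  sInf {n | n ∈ s ∧ sortRank s τ n = j}

theorem sortRank_eq_ncard {s : Set ℕ} {τ : ℕ → ℝ} {n : ℕ}
    (h : {m | m ∈ s ∧ τ m < τ n}.Finite) :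
    sortRank s τ n = ({m | m ∈ s ∧ τ m < τ n}.ncard : ℝ≥0∞) := by
  rw [sortRank, ← tsum_subtype, ENNReal.tsum_set_one, ← h.cast_ncard_eq]
  simp

section Sorted

variable {s : Set ℕ} {τ : ℕ → ℝ} (hinf : s.Infinite) (hinj : Set.InjOn τ s)
  (hfin : ∀ n ∈ s, {m | m ∈ s ∧ τ m < τ n}.Finite)

include hfin in
theorem ncard_lt_of_lt {n n' : ℕ} (hn : n ∈ s) (hn' : n' ∈ s) (h : τ n < τ n') :
    {m | m ∈ s ∧ τ m < τ n}.ncard < {m | m ∈ s ∧ τ m < τ n'}.ncard := by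
  refine Set.ncard_lt_ncard ?_ (hfin n' hn')
  refine ⟨fun m hm => ⟨hm.1, hm.2.trans h⟩, fun hc => ?_⟩
  exact lt_irrefl _ (hc (show n ∈ s ∧ τ n < τ n' from ⟨hn, h⟩)).2

include hinj hfin in
theorem injOn_ncard : Set.InjOn (fun n => {m | m ∈ s ∧ τ m < τ n}.ncard) s := by
  intro n hn n' hn' h
  rcases lt_trichotomy (τ n) (τ n') with h1 | h1 | h1
  · exact absurd h (ncard_lt_of_lt hfin hn hn' h1).ne
  · exact hinj hn hn' h1
  · exact absurd h (ncard_lt_of_lt hfin hn' hn h1).ne'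

include hinf hinj hfin in
theorem exists_ncard_eq (j : ℕ) : ∃ n ∈ s, {m | m ∈ s ∧ τ m < τ n}.ncard = j := by
  -- Ranks are injective on `s`, so they cannot be bounded on an infinite set.
  have h1 : ∃ n ∈ s, j < {m | m ∈ s ∧ τ m < τ n}.ncard := by
    by_contra hc
    push Not at hc
    refine hinf (Set.Finite.of_finite_image ((Set.finite_Iic j).subset ?_)
      (injOn_ncard hinj hfin))
    rintro _ ⟨n, hn, rfl⟩
    exact hc n hn
  obtain ⟨n, hn, hj⟩ := h1
  -- Elements below `n` have smaller ranks, and there are exactly as many of them as available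
  -- ranks, so every smaller rank occurs.
  have h2 : (fun n => {m | m ∈ s ∧ τ m < τ n}.ncard) '' {m | m ∈ s ∧ τ m < τ n} =
      Set.Iio ({m | m ∈ s ∧ τ m < τ n}.ncard) := by
    refine Set.eq_of_subset_of_ncard_le ?_ ?_ (Set.finite_Iio _)
    · rintro _ ⟨m, hm, rfl⟩
      exact ncard_lt_of_lt hfin hm.1 hn hm.2
    · rw [((injOn_ncard hinj hfin).mono fun m hm => hm.1).ncard_image]
      simp [Set.ncard_eq_toFinset_card']
  have h3 : j ∈ Set.Iio ({m | m ∈ s ∧ τ m < τ n}.ncard) := hj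
  rw [← h2] at h3
  obtain ⟨m, hm, rfl⟩ := h3
  exact ⟨m, hm.1, rfl⟩

include hinf hinj hfin in
theorem sortedIdx_spec (j : ℕ) : sortedIdx s τ j ∈ s ∧
    {m | m ∈ s ∧ τ m < τ (sortedIdx s τ j)}.ncard = j := by
  obtain ⟨n, hn, hj⟩ := exists_ncard_eq hinf hinj hfin j
  have hne : {n | n ∈ s ∧ sortRank s τ n = j}.Nonempty :=
    ⟨n, hn, by rw [sortRank_eq_ncard (hfin n hn), hj]⟩
  have h := Nat.sInf_mem hne
  refine ⟨h.1, ?_⟩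
  have h2 := h.2
  rw [sortRank_eq_ncard (hfin _ h.1)] at h2
  exact_mod_cast h2

include hinf hinj hfin in
theorem strictMono_sortedIdx : StrictMono fun j => τ (sortedIdx s τ j) := by
  intro j j' hjj
  have h := sortedIdx_spec hinf hinj hfin j
  have h' := sortedIdx_spec hinf hinj hfin j'
  rcases lt_trichotomy (τ (sortedIdx s τ j)) (τ (sortedIdx s τ j')) with h1 | h1 | h1
  · exact h1
  · rw [h1, h'.2] at h
    omega
  · have := ncard_lt_of_lt hfin h'.1 h.1 h1
    omega

include hinf hinj hfin in
theorem bijective_sortedIdx :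
    Function.Bijective fun j => (⟨sortedIdx s τ j, (sortedIdx_spec hinf hinj hfin j).1⟩ : s) := by
  constructor
  · intro j j' h
    exact (strictMono_sortedIdx hinf hinj hfin).injective (congrArg τ (Subtype.mk.inj h))
  · rintro ⟨n, hn⟩
    refine ⟨{m | m ∈ s ∧ τ m < τ n}.ncard, Subtype.ext ?_⟩
    have h := sortedIdx_spec hinf hinj hfin {m | m ∈ s ∧ τ m < τ n}.ncard
    exact injOn_ncard hinj hfin h.1 hn h.2

include hinf hinj hfin in
theorem tsum_sortedIdx {A : Type*} [AddCommMonoid A] [TopologicalSpace A] (F : ℕ → A) :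
    ∑' j, F (sortedIdx s τ j) = ∑' n, s.indicator F n := by
  rw [← tsum_subtype]
  exact (Equiv.ofBijective _ (bijective_sortedIdx hinf hinj hfin)).tsum_eq fun n : s => F n

end Sorted

theorem measurable_sInf_nat {Ω : Type*} [MeasurableSpace Ω] {B : ℕ → Set Ω}
    (hB : ∀ n, MeasurableSet (B n)) : Measurable fun ω => sInf {n | ω ∈ B n} := by
  refine measurable_to_countable' fun m => ?_
  -- The second part of the union is due to the convention that the infimum of the empty set is 0.
  have : (fun ω => sInf {n | ω ∈ B n}) ⁻¹' {m} =
      (B m ∩ ⋂ k, ⋂ (_ : k < m), (B k)ᶜ) ∪ ({_ω | m = 0} ∩ ⋂ k, (B k)ᶜ) := by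
    ext ω
    simp only [Set.mem_preimage, Set.mem_singleton_iff, Set.mem_union, Set.mem_inter_iff,
      Set.mem_iInter, Set.mem_compl_iff, Set.mem_ofPred_eq]
    constructor
    · intro h
      by_cases hne : {n | ω ∈ B n}.Nonempty
      · refine Or.inl ⟨h ▸ Nat.sInf_mem hne, fun k hk hc => ?_⟩
        rw [← h] at hk
        exact Nat.notMem_of_lt_sInf hk hc
      · rw [Set.not_nonempty_iff_eq_empty] at hne
        refine Or.inr ⟨?_, fun k hk => ?_⟩
        · rw [← h, hne, Nat.sInf_empty]
        · have : k ∈ {n | ω ∈ B n} := hk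
          rw [hne] at this
          exact this
    · rintro (⟨h1, h2⟩ | ⟨rfl, h2⟩)
      · refine le_antisymm (Nat.sInf_le h1) (le_csInf ⟨m, h1⟩ fun k hk => ?_)
        by_contra hc
        exact h2 k (not_le.1 hc) hk
      · have : {n | ω ∈ B n} = ∅ := Set.eq_empty_of_forall_notMem h2
        rw [this, Nat.sInf_empty]
  rw [this]
  exact ((hB m).inter (MeasurableSet.iInter fun k => MeasurableSet.iInter fun _ => (hB k).compl)).union
    ((MeasurableSet.const _).inter (MeasurableSet.iInter fun k => (hB k).compl))

theorem measurable_sortedIdx {Ω : Type*} [MeasurableSpace Ω] {s : Ω → Set ℕ} {τ : Ω → ℕ → ℝ}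
    (hs : ∀ n, MeasurableSet {ω | n ∈ s ω}) (hτ : ∀ n, Measurable fun ω => τ ω n) (j : ℕ) :
    Measurable fun ω => sortedIdx (s ω) (τ ω) j := by
  have hr : ∀ n, Measurable fun ω => sortRank (s ω) (τ ω) n := by
    intro n
    refine Measurable.tsum fun m => ?_
    have : (fun ω => ({m | m ∈ s ω ∧ τ ω m < τ ω n} : Set ℕ).indicator (fun _ => (1 : ℝ≥0∞)) m) =
        ({ω | m ∈ s ω ∧ τ ω m < τ ω n} : Set Ω).indicator fun _ => 1 := rfl
    rw [this]
    exact measurable_const.indicator ((hs m).inter (measurableSet_lt (hτ m) (hτ n)))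
  exact measurable_sInf_nat fun n => (hs n).inter ((hr n) (measurableSet_singleton _))

/-! ### Poisson processes listed in increasing order -/

/-- `Q` is the law of the sequence of points, in the order of increasing `τ`, of a Poisson process
with intensity `ν`. -/
structure IsSortedPoissonLaw {S : Type*} [MeasurableSpace S] (ν : Measure S) (τ : S → ℝ)
    (Q : Measure (ℕ → S)) : Prop where
  isProbabilityMeasure : IsProbabilityMeasure Q
  charFun : HasPoissonCharFun Q ν fun η j => η j
  intensity : ∀ g : S → ℝ≥0∞, Measurable g → ∫⁻ η, ∑' j, g (η j) ∂Q = ∫⁻ y, g y ∂ν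
  pairs : ∀ g : S → S → ℝ≥0∞, Measurable (Function.uncurry g) →
    ∫⁻ η, ∑' i, ∑' j, (if i ≠ j then g (η i) (η j) else 0) ∂Q = ∫⁻ y, ∫⁻ y', g y y' ∂ν ∂ν
  strictMono : ∀ᵐ η ∂Q, StrictMono fun j => τ (η j)

/-! ### Existence of the law of a sorted Poisson process -/

section Existence

variable {S : Type*} [MeasurableSpace S] (κ : ℕ → Measure S) [∀ l, IsProbabilityMeasure (κ l)]

theorem ae_infinite_arrayLaw :
    ∀ᵐ p ∂arrayLaw κ, {i : ℕ × ℕ | i.2 < p.1 i.1}.Infinite := by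
  have h0 : ∀ L : ℕ, (Measure.infinitePi fun _ : ℕ => poissonMeasure 1)
      {N | ∀ l, L ≤ l → N l = 0} = 0 := by
    intro L
    -- `K` consecutive rows are all empty with probability e^{-K}.
    have h1 : ∀ K : ℕ, (Measure.infinitePi fun _ : ℕ => poissonMeasure 1)
        {N | ∀ l, L ≤ l → N l = 0} ≤ (ENNReal.ofReal (Real.exp (-1))) ^ K := by
      intro K
      have h2 := Measure.infinitePi_pi (fun _ : ℕ => poissonMeasure 1)
        (s := Finset.Ico L (L + K)) (t := fun _ => {0}) (fun _ _ => measurableSet_singleton _)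
      simp only [poissonMeasure_singleton, Finset.prod_const, Nat.card_Ico] at h2
      refine (measure_mono fun N hN => ?_).trans (h2.le.trans ?_)
      · intro l hl
        exact hN l (Finset.mem_Ico.1 hl).1
      · simp
    refine le_antisymm (ge_of_tendsto' (ENNReal.tendsto_pow_atTop_nhds_zero_of_lt_one ?_) h1)
      (zero_le)
    rw [ENNReal.ofReal_lt_one]
    exact Real.exp_lt_one_iff.2 (by norm_num)
  have h3 : ∀ᵐ N ∂(Measure.infinitePi fun _ : ℕ => poissonMeasure 1),
      ∀ L, ∃ l, L ≤ l ∧ N l ≠ 0 := by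
    rw [ae_all_iff]
    intro L
    rw [ae_iff]
    simpa using h0 L
  have h4 : ∀ᵐ p ∂arrayLaw κ, ∀ L, ∃ l, L ≤ l ∧ p.1 l ≠ 0 :=
    Measure.quasiMeasurePreserving_fst.ae h3
  filter_upwards [h4] with p hp hfin
  obtain ⟨B, hB⟩ := (hfin.image Prod.fst).bddAbove
  obtain ⟨l, hl, hN⟩ := hp (B + 1)
  have := hB ⟨(l, 0), Nat.pos_of_ne_zero hN, rfl⟩
  simp only at this
  omega

variable {κ} {τ : S → ℝ}

/-- The codes of the listed points of an array. -/
def arrayCodes (p : (ℕ → ℕ) × (ℕ × ℕ → S)) : Set ℕ :=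
  {n | (Nat.unpair n).2 < p.1 (Nat.unpair n).1}

/-- The listed points of an array in the order of increasing `τ`. -/
noncomputable def arraySorted (τ : S → ℝ) (p : (ℕ → ℕ) × (ℕ × ℕ → S)) (j : ℕ) : S :=
  p.2 (Nat.unpair (sortedIdx (arrayCodes p) (fun n => τ (p.2 (Nat.unpair n))) j))

theorem measurable_arraySorted (hτ : Measurable τ) :
    Measurable (arraySorted τ : (ℕ → ℕ) × (ℕ × ℕ → S) → ℕ → S) := by
  refine measurable_pi_lambda _ fun j => ?_
  have h1 : Measurable fun p : (ℕ → ℕ) × (ℕ × ℕ → S) =>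
      sortedIdx (arrayCodes p) (fun n => τ (p.2 (Nat.unpair n))) j :=
    measurable_sortedIdx (s := arrayCodes) (τ := fun p n => τ (p.2 (Nat.unpair n)))
      (fun n => measurableSet_lt measurable_const ((measurable_pi_apply _).comp measurable_fst))
      (fun n => by fun_prop) j
  have h2 : Measurable fun q : ℕ × (ℕ × ℕ → S) => q.2 (Nat.unpair q.1) :=
    measurable_from_prod_countable_right fun n => measurable_pi_apply (Nat.unpair n)
  exact h2.comp (h1.prodMk measurable_snd)

/-- An array whose listed points can be sorted. -/
structure IsSortable (τ : S → ℝ) (p : (ℕ → ℕ) × (ℕ × ℕ → S)) : Prop where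
  infinite : (arrayCodes p).Infinite
  injOn : Set.InjOn (fun n => τ (p.2 (Nat.unpair n))) (arrayCodes p)
  finite : ∀ n ∈ arrayCodes p,
    {m | m ∈ arrayCodes p ∧ τ (p.2 (Nat.unpair m)) < τ (p.2 (Nat.unpair n))}.Finite

omit [MeasurableSpace S] in
theorem IsSortable.tsum {p : (ℕ → ℕ) × (ℕ × ℕ → S)} (hp : IsSortable τ p) {A : Type*}
    [AddCommMonoid A] [TopologicalSpace A] (F : S → A) :
    ∑' j, F (arraySorted τ p j) = ∑' i : ℕ × ℕ, if i.2 < p.1 i.1 then F (p.2 i) else 0 := by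
  rw [← Nat.pairEquiv.symm.tsum_eq]
  refine (tsum_sortedIdx hp.infinite hp.injOn hp.finite
    fun n => F (p.2 (Nat.unpair n))).trans (tsum_congr fun n => ?_)
  simp only [Set.indicator_apply, arrayCodes, Set.mem_ofPred_eq]
  rfl

omit [MeasurableSpace S] in
theorem IsSortable.tsum_pairs {p : (ℕ → ℕ) × (ℕ × ℕ → S)} (hp : IsSortable τ p)
    (g : S → S → ℝ≥0∞) :
    ∑' i, ∑' j, (if i ≠ j then g (arraySorted τ p i) (arraySorted τ p j) else 0) =
      ∑' i : ℕ × ℕ, ∑' j : ℕ × ℕ, (if i ≠ j ∧ i.2 < p.1 i.1 ∧ j.2 < p.1 j.1 then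
        g (p.2 i) (p.2 j) else 0) := by
  have hinj : Function.Injective (sortedIdx (arrayCodes p) fun n => τ (p.2 (Nat.unpair n))) :=
    fun a b h => (strictMono_sortedIdx hp.infinite hp.injOn hp.finite).injective
      (congrArg (fun n => τ (p.2 (Nat.unpair n))) h)
  rw [← Nat.pairEquiv.symm.tsum_eq]
  simp_rw [← Nat.pairEquiv.symm.tsum_eq (fun j : ℕ × ℕ => ite (_ ≠ j ∧ _ ∧ _) _ _)]
  have h1 : ∀ i : ℕ, ∑' j, (if i ≠ j then g (arraySorted τ p i) (arraySorted τ p j) else 0) =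
      ∑' n, (arrayCodes p).indicator (fun n =>
        if sortedIdx (arrayCodes p) (fun n => τ (p.2 (Nat.unpair n))) i ≠ n then
          g (arraySorted τ p i) (p.2 (Nat.unpair n)) else 0) n := by
    intro i
    rw [← tsum_sortedIdx hp.infinite hp.injOn hp.finite]
    refine tsum_congr fun j => ?_
    by_cases hij : i = j
    · simp [hij]
    · rw [if_pos hij, if_pos (hinj.ne hij)]
      rfl
  simp_rw [h1]
  have h2 := tsum_sortedIdx hp.infinite hp.injOn hp.finite (fun m =>
    ∑' n, (arrayCodes p).indicator (fun n => if m ≠ n then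
          g (p.2 (Nat.unpair m)) (p.2 (Nat.unpair n)) else 0) n)
  refine h2.trans (tsum_congr fun m => ?_)
  by_cases hm : m ∈ arrayCodes p
  · rw [Set.indicator_of_mem hm]
    refine tsum_congr fun n => ?_
    have hm' : (Nat.unpair m).2 < p.1 (Nat.unpair m).1 := hm
    have hmn : (Nat.pairEquiv.symm m ≠ Nat.pairEquiv.symm n) ↔ m ≠ n :=
      Nat.pairEquiv.symm.injective.ne_iff
    simp only [Set.indicator_apply, arrayCodes, Set.mem_ofPred_eq, hmn]
    simp only [Nat.pairEquiv_symm_apply, hm', true_and]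
    by_cases hn : (Nat.unpair n).2 < p.1 (Nat.unpair n).1 <;> simp [hn]
  · rw [Set.indicator_of_notMem hm]
    have hm' : ¬ (Nat.unpair m).2 < p.1 (Nat.unpair m).1 := hm
    simp [hm']

/-- The shells τ ∈ [l, l + 1) have intensity one, so the process is the superposition of independent
Poisson(1) samples from them. It can be sorted because almost surely there are infinitely many
points, finitely many below each level, and no ties. -/
theorem exists_isSortedPoissonLaw {ν : Measure S} (hτ : Measurable τ)
    (hν : ν.map τ = volume.restrict (Set.Ici 0)) : ∃ Q, IsSortedPoissonLaw ν τ Q := by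
  have hval : ∀ A : Set ℝ, MeasurableSet A → ν (τ ⁻¹' A) = volume (A ∩ Set.Ici 0) := by
    intro A hA
    rw [← Measure.map_apply hτ hA, hν, Measure.restrict_apply hA]
  set B : ℕ → Set S := fun l => τ ⁻¹' Set.Ico (l : ℝ) (l + 1) with hB
  have hBm : ∀ l, MeasurableSet (B l) := fun l => hτ measurableSet_Ico
  set κ : ℕ → Measure S := fun l => ν.restrict (B l) with hκ
  have hprob : ∀ l, IsProbabilityMeasure (κ l) := by
    intro l
    constructor
    have hsub : Set.Ico (l : ℝ) (l + 1) ⊆ Set.Ici 0 := fun x hx => (Nat.cast_nonneg l).trans hx.1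
    rw [hκ, Measure.restrict_apply_univ, hB, hval _ measurableSet_Ico,
      Set.inter_eq_left.2 hsub, Real.volume_Ico]
    simp
  have hsum : Measure.sum κ = ν := by
    have hd : Pairwise (Function.onFun Disjoint B) := by
      intro l l' hne
      refine Disjoint.preimage _ ?_
      rw [Set.disjoint_left]
      rintro x ⟨h1, h2⟩ ⟨h3, h4⟩
      have h5 : (l : ℝ) < l' + 1 := h1.trans_lt h4
      have h6 : (l' : ℝ) < l + 1 := h3.trans_lt h2
      norm_cast at h5 h6
      omega
    rw [hκ, ← Measure.restrict_iUnion hd hBm, Measure.restrict_eq_self_of_ae_mem]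
    have h1 : ν (τ ⁻¹' Set.Iio 0) = 0 := by
      rw [hval _ measurableSet_Iio, Set.inter_comm, Set.Ici_inter_Iio, Set.Ico_self, measure_empty]
    filter_upwards [measure_eq_zero_iff_ae_notMem.1 h1] with y hy
    have hy' : 0 ≤ τ y := not_lt.1 hy
    exact Set.mem_iUnion.2 ⟨⌊τ y⌋₊, Nat.floor_le hy', Nat.lt_floor_add_one _⟩
  have hsort : ∀ᵐ p ∂arrayLaw κ, IsSortable τ p := by
    have h1 := ae_infinite_arrayLaw κ
    have h2 : ∀ᵐ p ∂arrayLaw κ, ∀ K : ℕ,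
        {i : ℕ × ℕ | i.2 < p.1 i.1 ∧ p.2 i ∈ τ ⁻¹' Set.Iio (K : ℝ)}.Finite := by
      rw [ae_all_iff]
      intro K
      refine ae_finite_arrayLaw κ (hτ measurableSet_Iio) ?_
      rw [hsum, hval _ measurableSet_Iio, Set.inter_comm, Set.Ici_inter_Iio, Real.volume_Ico]
      exact ENNReal.ofReal_ne_top
    have hg : Measurable (Function.uncurry fun y y' : S =>
        (if τ y = τ y' then 1 else 0 : ℝ≥0∞)) :=
      Measurable.ite (measurableSet_eq_fun (hτ.comp measurable_fst) (hτ.comp measurable_snd))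
        measurable_const measurable_const
    -- The expected number of ordered pairs of listed points with equal τ vanishes, because the
    -- image of `ν` under τ has no atoms.
    have h3 := lintegral_arrayLaw_pairs κ hg
    have h4 : ∀ y, ∫⁻ y', (if τ y = τ y' then 1 else 0 : ℝ≥0∞) ∂ν = 0 := by
      intro y
      have : (fun y' => (if τ y = τ y' then 1 else 0 : ℝ≥0∞)) =
          (τ ⁻¹' {τ y}).indicator fun _ => 1 := by
        ext y'
        by_cases h : τ y = τ y'
        · rw [if_pos h, Set.indicator_of_mem (show y' ∈ τ ⁻¹' {τ y} from h.symm)]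
        · rw [if_neg h, Set.indicator_of_notMem fun h' : y' ∈ τ ⁻¹' {τ y} => h (Eq.symm h')]
      rw [this, lintegral_indicator_const (hτ (measurableSet_singleton _)),
        hval _ (measurableSet_singleton _), measure_mono_null Set.inter_subset_left
          (Real.volume_singleton)]
      simp
    simp_rw [hsum, h4] at h3
    rw [lintegral_zero] at h3
    have hmN : ∀ i j : ℕ × ℕ, Measurable fun p : (ℕ → ℕ) × (ℕ × ℕ → S) =>
        (if i ≠ j ∧ i.2 < p.1 i.1 ∧ j.2 < p.1 j.1 then
          (if τ (p.2 i) = τ (p.2 j) then 1 else 0 : ℝ≥0∞) else 0) := by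
      intro i j
      have hi : MeasurableSet {p : (ℕ → ℕ) × (ℕ × ℕ → S) | i.2 < p.1 i.1} :=
        measurableSet_lt measurable_const (by fun_prop)
      have hj : MeasurableSet {p : (ℕ → ℕ) × (ℕ × ℕ → S) | j.2 < p.1 j.1} :=
        measurableSet_lt measurable_const (by fun_prop)
      exact Measurable.ite ((MeasurableSet.const _).inter (hi.inter hj))
        (hg.comp (f := fun p : (ℕ → ℕ) × (ℕ × ℕ → S) => (p.2 i, p.2 j)) (by fun_prop))
        measurable_const
    rw [lintegral_eq_zero_iff (Measurable.tsum fun i => Measurable.tsum fun j => hmN i j)] at h3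
    filter_upwards [h1, h2, h3] with p hp1 hp2 hp3
    have hcode : ∀ s : Set (ℕ × ℕ), (Nat.unpair ⁻¹' s).Finite ↔ s.Finite := fun s =>
      ⟨fun h => (h.image _).subset fun i hi =>
          ⟨Nat.pairEquiv i, show Nat.unpair (Nat.pair i.1 i.2) ∈ s by rwa [Nat.unpair_pair], Nat.pairEquiv.symm_apply_apply i⟩,
        fun h => h.preimage Nat.pairEquiv.symm.injective.injOn⟩
    refine ⟨fun hc => hp1 ((hcode _).1 hc), fun n hn m hm hnm => ?_, fun n hn => ?_⟩
    · by_contra hne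
      have := ENNReal.tsum_eq_zero.1 (ENNReal.tsum_eq_zero.1 hp3 (Nat.unpair n)) (Nat.unpair m)
      rw [if_pos ⟨fun h => hne (Nat.pairEquiv.symm.injective h), hn, hm⟩, if_pos hnm] at this
      exact one_ne_zero this
    · obtain ⟨K, hK⟩ := exists_nat_gt (τ (p.2 (Nat.unpair n)))
      refine ((hcode _).2 (hp2 K)).subset fun m hm => ?_
      exact ⟨hm.1, hm.2.trans hK⟩
  have hms := measurable_arraySorted (S := S) hτ
  refine ⟨(arrayLaw κ).map (arraySorted τ), ⟨Measure.isProbabilityMeasure_map hms.aemeasurable,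
    fun h hh hs => ?_, fun g hg => ?_, fun g hg => ?_, ?_⟩⟩
  · rw [integral_map hms.aemeasurable (by
      refine (measurable_expI ?_).aestronglyMeasurable
      exact Measurable.tsum fun j => by fun_prop), ← hsum, ← integral_arrayLaw_expI κ hh (hsum ▸ hs)]
    refine integral_congr_ae (hsort.mono fun p hp => ?_)
    simp only [hp.tsum h]
    rfl
  · rw [lintegral_map (Measurable.tsum fun j => by fun_prop) hms, ← hsum,
      ← lintegral_arrayLaw_sum κ hg]
    exact lintegral_congr_ae (hsort.mono fun p hp => hp.tsum g)
  · rw [lintegral_map (Measurable.tsum fun i => Measurable.tsum fun j => by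
      split_ifs
      · exact hg.comp (f := fun η : ℕ → S => (η i, η j)) (by fun_prop)
      · exact measurable_const) hms, ← hsum, ← lintegral_arrayLaw_pairs κ hg]
    exact lintegral_congr_ae (hsort.mono fun p hp => hp.tsum_pairs g)
  · have hmeas : MeasurableSet {η : ℕ → S | StrictMono fun j => τ (η j)} := by
      have : {η : ℕ → S | StrictMono fun j => τ (η j)} =
          ⋂ j : ℕ, {η | τ (η j) < τ (η (j + 1))} := by
        ext η
        simp only [Set.mem_ofPred_eq, Set.mem_iInter]
        exact ⟨fun h j => h (Nat.lt_succ_self j), fun h => strictMono_nat_of_lt_succ h⟩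
      rw [this]
      exact MeasurableSet.iInter fun j => measurableSet_lt (by fun_prop) (by fun_prop)
    rw [ae_map_iff hms.aemeasurable hmeas]
    exact hsort.mono fun p hp => strictMono_sortedIdx hp.infinite hp.injOn hp.finite

end Existence


/-! ### Resampling one coordinate of a product measure -/

section Resampling

variable {ι : Type*} [DecidableEq ι] {X : ι → Type*} [∀ i, MeasurableSpace (X i)]

theorem measurable_update_prod (u : ι) :
    Measurable fun q : (∀ i, X i) × X u => Function.update q.1 u q.2 := by
  refine measurable_pi_lambda _ fun i => ?_
  by_cases h : i = u
  · subst h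
    simpa using measurable_snd
  · simp only [Function.update_of_ne h]
    fun_prop

variable (μ : ∀ i, Measure (X i)) [∀ i, IsProbabilityMeasure (μ i)]

/-- This replaces conditioning on all coordinates but one: a functional may be averaged over a fresh
copy of coordinate `u` while the other coordinates are held fixed. -/
theorem map_update_infinitePi (u : ι) :
    ((Measure.infinitePi μ).prod (μ u)).map (fun q => Function.update q.1 u q.2) =
      Measure.infinitePi μ := by
  refine Measure.eq_infinitePi μ fun s t ht => ?_
  rw [Measure.map_apply (measurable_update_prod u)
    (MeasurableSet.pi s.countable_toSet fun i _ => ht i)]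
  by_cases hu : u ∈ s
  · have : (fun q : (∀ i, X i) × X u => Function.update q.1 u q.2) ⁻¹' (Set.pi s t) =
        (Set.pi (s.erase u) t) ×ˢ t u := by
      ext ⟨x, y⟩
      simp only [Set.mem_preimage, Set.mem_pi, Finset.mem_coe, Set.mem_prod, Finset.mem_erase]
      constructor
      · intro h
        refine ⟨fun i hi => ?_, ?_⟩
        · have := h i hi.2
          rwa [Function.update_of_ne hi.1] at this
        · have := h u hu
          rwa [Function.update_self] at this
      · rintro ⟨h1, h2⟩ i hi
        by_cases hiu : i = u
        · subst hiu
          rwa [Function.update_self]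
        · rw [Function.update_of_ne hiu]
          exact h1 i ⟨hiu, hi⟩
    rw [this, Measure.prod_prod, Measure.infinitePi_pi _ fun i _ => ht i,
      Finset.prod_erase_mul _ _ hu]
  · have : (fun q : (∀ i, X i) × X u => Function.update q.1 u q.2) ⁻¹' (Set.pi s t) =
        (Set.pi s t) ×ˢ Set.univ := by
      ext ⟨x, y⟩
      simp only [Set.mem_preimage, Set.mem_pi, Finset.mem_coe, Set.mem_prod, Set.mem_univ, and_true]
      refine forall₂_congr fun i hi => ?_
      rw [Function.update_of_ne fun h : i = u => hu (h ▸ hi)]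
    rw [this, Measure.prod_prod, Measure.infinitePi_pi _ fun i _ => ht i]
    simp

theorem lintegral_infinitePi_update (u : ι) {F : (∀ i, X i) → ℝ≥0∞} (hF : Measurable F) :
    ∫⁻ ω, F ω ∂Measure.infinitePi μ =
      ∫⁻ ω, ∫⁻ ξ, F (Function.update ω u ξ) ∂μ u ∂Measure.infinitePi μ := by
  conv_lhs => rw [← map_update_infinitePi μ u]
  rw [lintegral_map hF (measurable_update_prod u)]
  exact lintegral_prod _ (hF.comp (measurable_update_prod u)).aemeasurable

theorem integral_infinitePi_update (u : ι) {F : (∀ i, X i) → ℂ} (hF : Measurable F)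
    (hb : ∀ ω, ‖F ω‖ ≤ 1) :
    ∫ ω, F ω ∂Measure.infinitePi μ =
      ∫ ω, ∫ ξ, F (Function.update ω u ξ) ∂μ u ∂Measure.infinitePi μ := by
  conv_lhs => rw [← map_update_infinitePi μ u]
  rw [integral_map (measurable_update_prod u).aemeasurable hF.aestronglyMeasurable]
  exact integral_prod _ (Integrable.of_bound
    (hF.comp (measurable_update_prod u)).aestronglyMeasurable 1 (ae_of_all _ fun q => hb _))

end Resampling

/-! ### The exploration of the embedded tree

The child `j` of the word `u` is `j :: u`. The point of a child is displaced from the point of its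
parent by the `j`-th point of the sequence attached to the parent. -/

/-- Exploring in the order of codes therefore treats parents before children. -/
theorem encode_lt_encode_cons (j : ℕ) (u : List ℕ) :
    Encodable.encode u < Encodable.encode (j :: u) := by
  rw [Encodable.encode_list_cons]
  exact Nat.lt_succ_of_le (Nat.right_le_pair _ _)

/-- The words with code less than `n`. -/
def wordsBefore (n : ℕ) : Finset (List ℕ) :=
  (Finset.range n).image (Denumerable.ofNat (List ℕ))

theorem mem_wordsBefore {n : ℕ} {u : List ℕ} : u ∈ wordsBefore n ↔ Encodable.encode u < n := by
  simp only [wordsBefore, Finset.mem_image, Finset.mem_range]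
  constructor
  · rintro ⟨m, hm, rfl⟩
    rwa [Denumerable.encode_ofNat]
  · intro h
    exact ⟨_, h, Denumerable.ofNat_encode u⟩

theorem wordsBefore_succ (n : ℕ) :
    wordsBefore (n + 1) = insert (Denumerable.ofNat (List ℕ) n) (wordsBefore n) := by
  rw [wordsBefore, Finset.range_add_one, Finset.image_insert]
  rfl

section Exploration

variable {E : Type*} [NormedAddCommGroup E]

/-- The point of a word. -/
def pos (ω : List ℕ → ℕ → E) : List ℕ → E
  | [] => 0
  | j :: u => pos ω u + ω u j

/-- The radius around the point of a word within which its children are found. -/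
noncomputable def rad (R : ℝ) (ω : List ℕ → ℕ → E) : List ℕ → ℝ
  | [] => R
  | j :: u => ‖ω u j‖

/-- The word lies on a descending path. -/
def Desc (R : ℝ) (ω : List ℕ → ℕ → E) : List ℕ → Prop
  | [] => True
  | j :: u => Desc R ω u ∧ ‖ω u j‖ < rad R ω u

/-- The ball searched for the children of `u`; empty if `u` does not lie on a descending path. -/
def expl (R : ℝ) (ω : List ℕ → ℕ → E) (u : List ℕ) : Set E :=
  {y | Desc R ω u ∧ ‖y - pos ω u‖ < rad R ω u}

/-- The region searched on behalf of the words with code less than `n`. -/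
def explBefore (R : ℝ) (ω : List ℕ → ℕ → E) (n : ℕ) : Set E :=
  {y | ∃ u ∈ wordsBefore n, y ∈ expl R ω u}

/-- The part of the ball of `u` that has not been searched before. -/
def fresh (R : ℝ) (ω : List ℕ → ℕ → E) (u : List ℕ) : Set E :=
  expl R ω u \ explBefore R ω (Encodable.encode u)

theorem explBefore_encode_succ (R : ℝ) (ω : List ℕ → ℕ → E) (u : List ℕ) :
    explBefore R ω (Encodable.encode u + 1) =
      explBefore R ω (Encodable.encode u) ∪ fresh R ω u := by
  ext y
  simp only [explBefore, wordsBefore_succ, Denumerable.ofNat_encode, Finset.mem_insert, fresh,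
    Set.mem_union, Set.mem_ofPred_eq, Set.mem_sdiff, exists_eq_or_imp]
  by_cases hy : ∃ a ∈ wordsBefore (Encodable.encode u), y ∈ expl R ω a
  · simp [hy]
  · simp [hy]

theorem disjoint_explBefore_fresh (R : ℝ) (ω : List ℕ → ℕ → E) (u : List ℕ) :
    Disjoint (explBefore R ω (Encodable.encode u)) (fresh R ω u) :=
  Set.disjoint_sdiff_right

/-! ### Dependence of the exploration on earlier coordinates only -/

section Locality

variable {R : ℝ} {ω ω' : List ℕ → ℕ → E} {n : ℕ}
  (h : ∀ v, Encodable.encode v < n → ω v = ω' v)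

include h

/-- The point of a word uses only the sequences of its proper ancestors, whose codes are strictly
smaller than its own. So it is unaffected by its own sequence, which allows equality in `hu`. -/
theorem pos_congr : ∀ {u : List ℕ}, Encodable.encode u ≤ n → pos ω u = pos ω' u
  | [], _ => rfl
  | j :: u, hu => by
    have h1 := (encode_lt_encode_cons j u).trans_le hu
    rw [pos, pos, pos_congr h1.le, h u h1]

theorem rad_congr : ∀ {u : List ℕ}, Encodable.encode u ≤ n → rad R ω u = rad R ω' u
  | [], _ => rfl
  | j :: u, hu => by
    have h1 := (encode_lt_encode_cons j u).trans_le hu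
    rw [rad, rad, h u h1]

theorem desc_congr : ∀ {u : List ℕ}, Encodable.encode u ≤ n → (Desc R ω u ↔ Desc R ω' u)
  | [], _ => Iff.rfl
  | j :: u, hu => by
    have h1 := (encode_lt_encode_cons j u).trans_le hu
    rw [Desc, Desc, desc_congr h1.le, h u h1, rad_congr h h1.le]

theorem expl_congr {u : List ℕ} (hu : Encodable.encode u ≤ n) : expl R ω u = expl R ω' u := by
  ext y
  rw [expl, expl, Set.mem_ofPred_eq, Set.mem_ofPred_eq, pos_congr h hu, rad_congr h hu,
    desc_congr h hu]

/-- The bound `n + 1` is admissible since even the ball of the word with code `n` is determined by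
the coordinates with codes less than `n`. Hence resampling this word does not move the region
explored up to and including it. -/
theorem explBefore_congr {m : ℕ} (hm : m ≤ n + 1) : explBefore R ω m = explBefore R ω' m := by
  ext y
  simp only [explBefore, Set.mem_ofPred_eq]
  refine exists_congr fun u => and_congr_right fun hu => ?_
  rw [mem_wordsBefore] at hu
  rw [expl_congr h (by omega)]

theorem fresh_congr {u : List ℕ} (hu : Encodable.encode u ≤ n) : fresh R ω u = fresh R ω' u := by
  rw [fresh, fresh, expl_congr h hu, explBefore_congr h (by omega)]

end Locality

omit [NormedAddCommGroup E] in
theorem update_agree (ω : List ℕ → ℕ → E) (u : List ℕ) (ξ : ℕ → E) :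
    ∀ v, Encodable.encode v < Encodable.encode u → Function.update ω u ξ v = ω v := fun v hv =>
  Function.update_of_ne (fun h => by rw [h] at hv; exact lt_irrefl _ hv) _ _

section Measurability

variable [MeasurableSpace E] [BorelSpace E] [SecondCountableTopology E] (R : ℝ)

theorem measurable_pos : ∀ u : List ℕ, Measurable fun ω : List ℕ → ℕ → E => pos ω u
  | [] => measurable_const
  | j :: u => by
    have h := measurable_pos u
    simp only [pos]
    fun_prop

omit [SecondCountableTopology E] in
theorem measurable_rad : ∀ u : List ℕ, Measurable fun ω : List ℕ → ℕ → E => rad R ω u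
  | [] => measurable_const
  | j :: u => by
    simp only [rad]
    fun_prop

omit [SecondCountableTopology E] in
theorem measurableSet_desc : ∀ u : List ℕ, MeasurableSet {ω : List ℕ → ℕ → E | Desc R ω u}
  | [] => MeasurableSet.const _
  | j :: u => by
    have h1 : Measurable fun ω : List ℕ → ℕ → E => ‖ω u j‖ := by fun_prop
    exact (measurableSet_desc u).inter (measurableSet_lt h1 (measurable_rad R u))

theorem measurableSet_expl (u : List ℕ) :
    MeasurableSet {q : (List ℕ → ℕ → E) × E | q.2 ∈ expl R q.1 u} := by
  have h1 : Measurable fun q : (List ℕ → ℕ → E) × E => ‖q.2 - pos q.1 u‖ :=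
    (measurable_snd.sub ((measurable_pos u).comp measurable_fst)).norm
  have h2 : Measurable fun q : (List ℕ → ℕ → E) × E => rad R q.1 u :=
    (measurable_rad R u).comp measurable_fst
  exact (measurable_fst (measurableSet_desc R u)).inter (measurableSet_lt h1 h2)

theorem measurableSet_explBefore (n : ℕ) :
    MeasurableSet {q : (List ℕ → ℕ → E) × E | q.2 ∈ explBefore R q.1 n} := by
  have : {q : (List ℕ → ℕ → E) × E | q.2 ∈ explBefore R q.1 n} =
      ⋃ u ∈ wordsBefore n, {q | q.2 ∈ expl R q.1 u} := by
    ext q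
    simp [explBefore]
  rw [this]
  exact Finset.measurableSet_biUnion _ fun u _ => measurableSet_expl R u

theorem measurableSet_fresh (u : List ℕ) :
    MeasurableSet {q : (List ℕ → ℕ → E) × E | q.2 ∈ fresh R q.1 u} :=
  (measurableSet_expl R u).diff (measurableSet_explBefore R _)

theorem measurableSet_explBefore_section (ω : List ℕ → ℕ → E) (n : ℕ) :
    MeasurableSet (explBefore R ω n) :=
  (measurable_prodMk_left (x := ω)) (measurableSet_explBefore R n)

theorem measurableSet_fresh_section (ω : List ℕ → ℕ → E) (u : List ℕ) :
    MeasurableSet (fresh R ω u) :=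
  (measurable_prodMk_left (x := ω)) (measurableSet_fresh R u)

end Measurability

end Exploration


/-! ### Assembling a Poisson process along the exploration -/

theorem expI_indicator_sub_one {S : Type*} (B : Set S) (h : S → ℝ) (y : S) :
    Complex.exp (((B.indicator h y : ℝ) : ℂ) * Complex.I) - 1 =
      B.indicator (fun y => Complex.exp ((h y : ℂ) * Complex.I) - 1) y := by
  by_cases hy : y ∈ B <;> simp [hy]

theorem HasPoissonCharFun.integral_indicator {Ω S : Type*} [MeasurableSpace Ω] [MeasurableSpace S]
    {P : Measure Ω} {ν : Measure S} {x : Ω → ℕ → S} (hx : HasPoissonCharFun P ν x)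
    {B : Set S} (hB : MeasurableSet B) {h : S → ℝ} (hh : Measurable h)
    (hν : ν (Function.support h) ≠ ∞) :
    ∫ ω, Complex.exp (((∑' j, B.indicator h (x ω j) : ℝ) : ℂ) * Complex.I) ∂P =
      Complex.exp (∫ y in B, (Complex.exp ((h y : ℂ) * Complex.I) - 1) ∂ν) := by
  rw [hx _ (hh.indicator hB) (measure_ne_top_of_subset (by simp [Set.support_indicator]) hν)]
  simp_rw [expI_indicator_sub_one]
  rw [MeasureTheory.integral_indicator hB]

/-- The children of a word form a translate of a Poisson process, and the translation invariant
intensity does not see the shift. -/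
theorem HasPoissonCharFun.integral_indicator_add {Ω S : Type*} [MeasurableSpace Ω]
    [MeasurableSpace S] [AddGroup S] [MeasurableAdd S] {P : Measure Ω} {ν : Measure S}
    [ν.IsAddLeftInvariant] {x : Ω → ℕ → S} (hx : HasPoissonCharFun P ν x) (a : S)
    {B : Set S} (hB : MeasurableSet B) {h : S → ℝ} (hh : Measurable h)
    (hν : ν (Function.support h) ≠ ∞) :
    ∫ ω, Complex.exp (((∑' j, B.indicator h (a + x ω j) : ℝ) : ℂ) * Complex.I) ∂P =
      Complex.exp (∫ y in B, (Complex.exp ((h y : ℂ) * Complex.I) - 1) ∂ν) := by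
  have hs : ν (Function.support fun y => B.indicator h (a + y)) ≠ ∞ := by
    have : (Function.support fun y => B.indicator h (a + y)) ⊆
        (fun y => a + y) ⁻¹' Function.support h := by
      intro y hy
      simp only [Function.mem_support, ne_eq, Set.indicator_apply_eq_zero, Classical.not_imp] at hy
      exact hy.2
    refine measure_ne_top_of_subset this ?_
    rwa [measure_preimage_add]
  rw [hx (fun y => B.indicator h (a + y)) ((hh.indicator hB).comp (measurable_const_add a)) hs]
  simp_rw [expI_indicator_sub_one]
  rw [integral_add_left_eq_self (μ := ν)
    (fun y => B.indicator (fun y => Complex.exp ((h y : ℂ) * Complex.I) - 1) y) a,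
    MeasureTheory.integral_indicator hB]

section Assembly

variable {E : Type*} [NormedAddCommGroup E] [MeasurableSpace E] [BorelSpace E]
  [SecondCountableTopology E] {ν : Measure E} [ν.IsAddLeftInvariant]
  {τ : E → ℝ} {Q : Measure (ℕ → E)} [IsProbabilityMeasure Q]

/-- The sum of `h` over the points found first when exploring the word `u`. -/
noncomputable def freshSum (R : ℝ) (h : E → ℝ) (ω : List ℕ → ℕ → E) (u : List ℕ) : ℝ :=
  ∑' j, (fresh R ω u).indicator h (pos ω (j :: u))

/-- The sum of `h` over the terms of `η` outside of the region explored before `n`. -/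
noncomputable def outerSum (R : ℝ) (h : E → ℝ) (n : ℕ) (ω : List ℕ → ℕ → E) (η : ℕ → E) : ℝ :=
  ∑' j, (explBefore R ω n)ᶜ.indicator h (η j)

theorem measurable_freshSum (R : ℝ) {h : E → ℝ} (hh : Measurable h) (u : List ℕ) :
    Measurable fun ω => freshSum R h ω u := by
  refine Measurable.tsum fun j => ?_
  have h1 : Measurable fun ω : List ℕ → ℕ → E => (ω, pos ω (j :: u)) :=
    measurable_id.prodMk (measurable_pos _)
  exact ((hh.comp (measurable_pos (j :: u))).indicator (h1 (measurableSet_fresh R u)))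

theorem measurable_outerSum (R : ℝ) {h : E → ℝ} (hh : Measurable h) (n : ℕ) :
    Measurable fun q : (List ℕ → ℕ → E) × (ℕ → E) => outerSum R h n q.1 q.2 := by
  refine Measurable.tsum fun j => ?_
  have h1 : Measurable fun q : (List ℕ → ℕ → E) × (ℕ → E) => (q.1, q.2 j) := by fun_prop
  have h2 : Measurable fun q : (List ℕ → ℕ → E) × (ℕ → E) => h (q.2 j) := by fun_prop
  exact h2.indicator (h1 (measurableSet_explBefore R n).compl)

omit [ν.IsAddLeftInvariant] [IsProbabilityMeasure Q] in
theorem integral_assembled_fixed (hQ : IsSortedPoissonLaw ν τ Q) (R : ℝ) {h : E → ℝ}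
    (hh : Measurable h) (hν : ν (Function.support h) ≠ ∞) (n : ℕ) (ω : List ℕ → ℕ → E) :
    ∫ η, Complex.exp (((∑ u ∈ wordsBefore n, freshSum R h ω u + outerSum R h n ω η : ℝ) : ℂ) *
      Complex.I) ∂Q =
    Complex.exp (((∑ u ∈ wordsBefore n, freshSum R h ω u : ℝ) : ℂ) * Complex.I) *
      Complex.exp (∫ y in (explBefore R ω n)ᶜ, (Complex.exp ((h y : ℂ) * Complex.I) - 1) ∂ν) := by
  simp_rw [Complex.ofReal_add, add_mul, Complex.exp_add]
  rw [integral_const_mul]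
  congr 1
  exact hQ.charFun.integral_indicator (measurableSet_explBefore_section R ω n).compl hh hν

theorem measurable_assembled (R : ℝ) {h : E → ℝ} (hh : Measurable h) (n : ℕ) :
    Measurable fun q : (List ℕ → ℕ → E) × (ℕ → E) =>
      ∑ u ∈ wordsBefore n, freshSum R h q.1 u + outerSum R h n q.1 q.2 :=
  (Finset.measurable_sum _ fun u _ => (measurable_freshSum R hh u).comp measurable_fst).add
    (measurable_outerSum R hh n)

/-- The value does not depend on `n`: exploring one more word replaces the additional process on the
fresh part of its ball by the children of that word. These form an independent Poisson process of
the same intensity, and the fresh part does not depend on them. -/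
theorem integral_assembled (hQ : IsSortedPoissonLaw ν τ Q) (R : ℝ) {h : E → ℝ}
    (hh : Measurable h) (hν : ν (Function.support h) ≠ ∞) (n : ℕ) :
    ∫ ω, ∫ η, Complex.exp (((∑ u ∈ wordsBefore n, freshSum R h ω u + outerSum R h n ω η : ℝ) : ℂ) *
      Complex.I) ∂Q ∂(Measure.infinitePi fun _ : List ℕ => Q) =
    Complex.exp (∫ y, (Complex.exp ((h y : ℂ) * Complex.I) - 1) ∂ν) := by
  induction n with
  | zero =>
    simp_rw [integral_assembled_fixed hQ R hh hν]
    simp [wordsBefore, explBefore]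
  | succ n ih =>
    rw [← ih]
    set u := Denumerable.ofNat (List ℕ) n with hu
    have hun : Encodable.encode u = n := Denumerable.encode_ofNat n
    have hm : Measurable fun ω : List ℕ → ℕ → E => ∫ η, Complex.exp
        (((∑ u ∈ wordsBefore (n + 1), freshSum R h ω u + outerSum R h (n + 1) ω η : ℝ) : ℂ) *
          Complex.I) ∂Q :=
      ((measurable_expI (measurable_assembled R hh (n + 1))).stronglyMeasurable.integral_prod_right'
        (ν := Q)).measurable
    -- The word `u` with code `n` is the one explored in this step; its sequence is averaged
    -- separately.
    rw [integral_infinitePi_update (fun _ : List ℕ => Q) u hm fun ω => ?_]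
    swap
    · refine (norm_integral_le_of_norm_le_const (C := 1) (ae_of_all _ fun η => ?_)).trans ?_
      · rw [Complex.norm_exp_ofReal_mul_I]
      · simp
    refine integral_congr_ae (ae_of_all _ fun ω => ?_)
    simp only
    simp_rw [integral_assembled_fixed hQ R hh hν]
    have hagree := fun ξ : ℕ → E => update_agree ω u ξ
    rw [hun] at hagree
    have h1 : ∀ ξ : ℕ → E, ∀ v ∈ wordsBefore n,
        freshSum R h (Function.update ω u ξ) v = freshSum R h ω v := by
      intro ξ v hv
      rw [mem_wordsBefore] at hv
      refine tsum_congr fun j => ?_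
      rw [fresh_congr (hagree ξ) hv.le, pos, pos, pos_congr (hagree ξ) hv.le, hagree ξ v hv]
    have h2 : ∀ ξ : ℕ → E, freshSum R h (Function.update ω u ξ) u =
        ∑' j, (fresh R ω u).indicator h (pos ω u + ξ j) := by
      intro ξ
      refine tsum_congr fun j => ?_
      rw [fresh_congr (hagree ξ) hun.le, pos, pos_congr (hagree ξ) hun.le, Function.update_self]
    have hnot : u ∉ wordsBefore n := by
      rw [mem_wordsBefore, hun]
      exact lt_irrefl n
    have h3 : ∀ ξ : ℕ → E, ∑ v ∈ wordsBefore (n + 1), freshSum R h (Function.update ω u ξ) v =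
        (∑' j, (fresh R ω u).indicator h (pos ω u + ξ j)) + ∑ v ∈ wordsBefore n, freshSum R h ω v := by
      intro ξ
      rw [wordsBefore_succ, Finset.sum_insert hnot, h2, Finset.sum_congr rfl (h1 ξ)]
    -- Only the contribution of the children of `u` depends on the resampled sequence `ξ`;
    -- everything else is a constant factor.
    simp_rw [h3, explBefore_congr (hagree _) le_rfl, Complex.ofReal_add, add_mul, Complex.exp_add]
    rw [integral_mul_const, integral_mul_const, hQ.charFun.integral_indicator_add (pos ω u)
      (measurableSet_fresh_section R ω u) hh hν, mul_comm (Complex.exp (∫ y in fresh R ω u, _ ∂ν)),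
      mul_assoc, ← Complex.exp_add]
    congr 2
    have hint := integrable_expI_sub_one hh hν
    -- The fresh part of `u` and the complement of the region explored up to `u` partition the
    -- complement of the region explored before `u`, so the two exponents add up to the one for `n`.
    have hdis : Disjoint (fresh R ω u) (explBefore R ω (n + 1))ᶜ := by
      have := explBefore_encode_succ R ω u
      rw [hun] at this
      rw [this, Set.disjoint_compl_right_iff_subset]
      exact Set.subset_union_right
    rw [← setIntegral_union hdis (measurableSet_explBefore_section R ω (n + 1)).compl
      hint.integrableOn hint.integrableOn]
    congr 2
    have h4 := explBefore_encode_succ R ω u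
    have h5 := disjoint_explBefore_fresh R ω u
    rw [hun] at h4 h5
    rw [h4]
    ext y
    have h6 : y ∈ explBefore R ω n → y ∉ fresh R ω u := fun ha hb => h5.le_bot ⟨ha, hb⟩
    simp only [Set.mem_union, Set.mem_compl_iff]
    tauto

/-- The assembled process: a child `(u, j)` is kept if it is found first when exploring `u`, and
a term of `η` is kept if it lies outside of the explored region. -/
def IsKept (R : ℝ) (n : ℕ) (q : (List ℕ → ℕ → E) × (ℕ → E)) : (List ℕ × ℕ) ⊕ ℕ → Prop
  | .inl i => i.1 ∈ wordsBefore n ∧ pos q.1 (i.2 :: i.1) ∈ fresh R q.1 i.1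
  | .inr j => q.2 j ∉ explBefore R q.1 n

/-- The position of a candidate point of the assembled process. -/
def candidate (q : (List ℕ → ℕ → E) × (ℕ → E)) : (List ℕ × ℕ) ⊕ ℕ → E
  | .inl i => pos q.1 (i.2 :: i.1)
  | .inr j => q.2 j

/-- The codes of the candidates that are kept. -/
def keptCodes (R : ℝ) (n : ℕ) (q : (List ℕ → ℕ → E) × (ℕ → E)) : Set ℕ :=
  {k | IsKept R n q (Denumerable.ofNat _ k)}

/-- The `j`-th candidate that is kept. -/
noncomputable def keptIdx (R : ℝ) (n : ℕ) (q : (List ℕ → ℕ → E) × (ℕ → E)) (j : ℕ) :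
    (List ℕ × ℕ) ⊕ ℕ :=
  Denumerable.ofNat _ (sortedIdx (keptCodes R n q) (fun k => (k : ℝ)) j)

theorem measurableSet_isKept (R : ℝ) (n : ℕ) (i : (List ℕ × ℕ) ⊕ ℕ) :
    MeasurableSet {q : (List ℕ → ℕ → E) × (ℕ → E) | IsKept R n q i} := by
  rcases i with ⟨u, j⟩ | j
  · have h1 : Measurable fun q : (List ℕ → ℕ → E) × (ℕ → E) => (q.1, pos q.1 (j :: u)) :=
      measurable_fst.prodMk ((measurable_pos (j :: u)).comp measurable_fst)
    exact (MeasurableSet.const _).inter (h1 (measurableSet_fresh R u))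
  · have h1 : Measurable fun q : (List ℕ → ℕ → E) × (ℕ → E) => (q.1, q.2 j) := by fun_prop
    exact h1 (measurableSet_explBefore R n).compl

theorem measurable_candidate (i : (List ℕ × ℕ) ⊕ ℕ) :
    Measurable fun q : (List ℕ → ℕ → E) × (ℕ → E) => candidate q i := by
  rcases i with ⟨u, j⟩ | j
  · exact (measurable_pos _).comp measurable_fst
  · simp only [candidate]
    fun_prop

theorem measurable_keptIdx (R : ℝ) (n j : ℕ) :
    Measurable[_, ⊤] fun q : (List ℕ → ℕ → E) × (ℕ → E) => keptIdx R n q j := by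
  have h1 : Measurable fun q : (List ℕ → ℕ → E) × (ℕ → E) =>
      sortedIdx (keptCodes R n q) (fun k => (k : ℝ)) j :=
    measurable_sortedIdx (s := keptCodes R n) (τ := fun _ k => (k : ℝ))
      (fun k => measurableSet_isKept R n _) (fun k => measurable_const) j
  exact (measurable_from_nat (f := Denumerable.ofNat ((List ℕ × ℕ) ⊕ ℕ))).comp h1

theorem measurable_keptPoint (R : ℝ) (n j : ℕ) :
    Measurable fun q : (List ℕ → ℕ → E) × (ℕ → E) => candidate q (keptIdx R n q j) := by
  have h1 : Measurable fun q : (List ℕ → ℕ → E) × (ℕ → E) =>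
      sortedIdx (keptCodes R n q) (fun k => (k : ℝ)) j :=
    measurable_sortedIdx (s := keptCodes R n) (τ := fun _ k => (k : ℝ))
      (fun k => measurableSet_isKept R n _) (fun k => measurable_const) j
  have h2 : Measurable fun p : ℕ × ((List ℕ → ℕ → E) × (ℕ → E)) =>
      candidate p.2 (Denumerable.ofNat ((List ℕ × ℕ) ⊕ ℕ) p.1) :=
    measurable_from_prod_countable_right fun k =>
      measurable_candidate (Denumerable.ofNat ((List ℕ × ℕ) ⊕ ℕ) k)
  exact h2.comp (h1.prodMk measurable_id)

section Kept

omit [MeasurableSpace E] [BorelSpace E] [SecondCountableTopology E]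

variable {R : ℝ} {n : ℕ} {q : (List ℕ → ℕ → E) × (ℕ → E)} (hinf : (keptCodes R n q).Infinite)

theorem finite_lt_keptCodes (k : ℕ) : {m | m ∈ keptCodes R n q ∧ (m : ℝ) < (k : ℝ)}.Finite :=
  (Set.finite_Iio k).subset fun m hm => by exact_mod_cast hm.2

include hinf

theorem isKept_keptIdx (j : ℕ) : IsKept R n q (keptIdx R n q j) :=
  (sortedIdx_spec hinf Nat.cast_injective.injOn (fun k _ => finite_lt_keptCodes k) j).1

theorem keptIdx_injective : Function.Injective (keptIdx R n q) := by
  intro a b h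
  have h1 : sortedIdx (keptCodes R n q) (fun k => (k : ℝ)) a =
      sortedIdx (keptCodes R n q) (fun k => (k : ℝ)) b := by
    have := congrArg Encodable.encode h
    simpa only [keptIdx, Denumerable.encode_ofNat] using this
  exact (strictMono_sortedIdx hinf Nat.cast_injective.injOn
    (fun k _ => finite_lt_keptCodes k)).injective (congrArg (fun k : ℕ => (k : ℝ)) h1)

theorem exists_keptIdx_eq {i : (List ℕ × ℕ) ⊕ ℕ} (hi : IsKept R n q i) :
    ∃ j, keptIdx R n q j = i := by
  have hmem : Encodable.encode i ∈ keptCodes R n q := by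
    rw [keptCodes, Set.mem_ofPred_eq, Denumerable.ofNat_encode]
    exact hi
  obtain ⟨j, hj⟩ := (bijective_sortedIdx hinf Nat.cast_injective.injOn
    (fun k _ => finite_lt_keptCodes k)).2 ⟨_, hmem⟩
  refine ⟨j, ?_⟩
  have h1 : sortedIdx (keptCodes R n q) (fun k => (k : ℝ)) j = Encodable.encode i :=
    congrArg Subtype.val hj
  rw [keptIdx, h1, Denumerable.ofNat_encode]

theorem tsum_keptIdx (h : E → ℝ)
    (hf : {i | IsKept R n q i ∧ h (candidate q i) ≠ 0}.Finite) :
    ∑' j, h (candidate q (keptIdx R n q j)) =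
      ∑ u ∈ wordsBefore n, freshSum R h q.1 u + outerSum R h n q.1 q.2 := by
  classical
  obtain ⟨F, hF⟩ : ∃ F : (List ℕ × ℕ) ⊕ ℕ → ℝ,
      ∀ i, F i = if IsKept R n q i then h (candidate q i) else 0 := ⟨_, fun _ => rfl⟩
  have hsum : Summable F := by
    refine summable_of_hasFiniteSupport (hf.subset fun i hi => ?_)
    simpa [hF] using hi
  have h0 : ∀ k, (keptCodes R n q).indicator
      (fun k => h (candidate q (Denumerable.ofNat ((List ℕ × ℕ) ⊕ ℕ) k))) k =
      F (Denumerable.ofNat ((List ℕ × ℕ) ⊕ ℕ) k) := by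
    intro k
    by_cases hk : IsKept R n q (Denumerable.ofNat ((List ℕ × ℕ) ⊕ ℕ) k)
    · rw [Set.indicator_of_mem (show k ∈ keptCodes R n q from hk)]
      rw [hF, if_pos hk]
    · rw [Set.indicator_of_notMem (show k ∉ keptCodes R n q from hk)]
      rw [hF, if_neg hk]
  have h2 : ∑' j, h (candidate q (keptIdx R n q j)) = ∑' i, F i := by
    simp only [keptIdx]
    rw [tsum_sortedIdx hinf Nat.cast_injective.injOn (fun k _ => finite_lt_keptCodes k)
      (fun k => h (candidate q (Denumerable.ofNat ((List ℕ × ℕ) ⊕ ℕ) k))), tsum_congr h0]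
    exact (Denumerable.eqv ((List ℕ × ℕ) ⊕ ℕ)).symm.tsum_eq F
  have hl : Summable fun i => F (Sum.inl i) := hsum.comp_injective Sum.inl_injective
  have hr : Summable fun i => F (Sum.inr i) := hsum.comp_injective Sum.inr_injective
  have h3 : ∑' i : List ℕ × ℕ, F (Sum.inl i) = ∑' u, ∑' j, F (Sum.inl (u, j)) := hl.tsum_prod
  rw [h2, Summable.tsum_sum hl hr, h3]
  congr 1
  · rw [tsum_eq_sum (s := wordsBefore n)]
    · refine Finset.sum_congr rfl fun u hu => tsum_congr fun j => ?_
      simp only [hF, IsKept, hu, true_and, candidate, Set.indicator_apply]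
    · intro u hu
      simp [hF, IsKept, hu]
  · refine tsum_congr fun j => ?_
    rw [hF]
    by_cases hj : q.2 j ∈ explBefore R q.1 n <;> simp [IsKept, candidate, hj]

end Kept

end Assembly


/-! ### First and second moment formulas for the children of a word -/

section Campbell

variable {E : Type*} [MeasurableSpace E] {ν : Measure E} {τ : E → ℝ}
  {Q : Measure (ℕ → E)} [IsProbabilityMeasure Q]

/-- Campbell's formula for the sequence of `u`, with the other coordinates frozen. The integrand may
depend on them, but by `hu` not on the sequence of `u` itself. -/
theorem lintegral_tsum_children (hQ : IsSortedPoissonLaw ν τ Q) (u : List ℕ)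
    {H : (List ℕ → ℕ → E) → E → ℝ≥0∞} (hH : Measurable (Function.uncurry H))
    (hu : ∀ ω ξ, H (Function.update ω u ξ) = H ω) :
    ∫⁻ ω, ∑' j, H ω (ω u j) ∂(Measure.infinitePi fun _ : List ℕ => Q) =
      ∫⁻ ω, ∫⁻ y, H ω y ∂ν ∂(Measure.infinitePi fun _ : List ℕ => Q) := by
  have hm : Measurable fun ω : List ℕ → ℕ → E => ∑' j, H ω (ω u j) :=
    Measurable.tsum fun j => hH.comp (f := fun ω : List ℕ → ℕ → E => (ω, ω u j)) (by fun_prop)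
  rw [lintegral_infinitePi_update (fun _ : List ℕ => Q) u hm]
  refine lintegral_congr fun ω => ?_
  simp_rw [hu, Function.update_self]
  exact hQ.intensity (H ω) (hH.comp measurable_prodMk_left)

/-- The analogue for the second factorial moment: ordered pairs of distinct children of `u` have
intensity ν ⊗ ν. -/
theorem lintegral_tsum_siblings (hQ : IsSortedPoissonLaw ν τ Q) (u : List ℕ)
    {H : (List ℕ → ℕ → E) → E → E → ℝ≥0∞}
    (hH : Measurable fun p : (List ℕ → ℕ → E) × E × E => H p.1 p.2.1 p.2.2)
    (hu : ∀ ω ξ, H (Function.update ω u ξ) = H ω) :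
    ∫⁻ ω, ∑' i, ∑' j, (if i ≠ j then H ω (ω u i) (ω u j) else 0)
        ∂(Measure.infinitePi fun _ : List ℕ => Q) =
      ∫⁻ ω, ∫⁻ y, ∫⁻ y', H ω y y' ∂ν ∂ν ∂(Measure.infinitePi fun _ : List ℕ => Q) := by
  have hm : Measurable fun ω : List ℕ → ℕ → E =>
      ∑' i, ∑' j, (if i ≠ j then H ω (ω u i) (ω u j) else 0) := by
    refine Measurable.tsum fun i => Measurable.tsum fun j => ?_
    split_ifs
    · exact hH.comp (f := fun ω : List ℕ → ℕ → E => (ω, ω u i, ω u j)) (by fun_prop)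
    · exact measurable_const
  rw [lintegral_infinitePi_update (fun _ : List ℕ => Q) u hm]
  refine lintegral_congr fun ω => ?_
  simp_rw [hu, Function.update_self]
  exact hQ.pairs (H ω) (hH.comp (f := fun p : E × E => (ω, p)) measurable_prodMk_left)

omit [MeasurableSpace E] in
theorem finite_mem_of_tsum_indicator_ne_top {x : ℕ → E} {s : Set E}
    (h : ∑' j, s.indicator (fun _ => (1 : ℝ≥0∞)) (x j) ≠ ∞) : {j | x j ∈ s}.Finite := by
  refine (ENNReal.finite_const_le_of_tsum_ne_top h one_ne_zero).subset fun j hj => ?_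
  have hj' : x j ∈ s := hj
  rw [Set.mem_ofPred_eq, Set.indicator_of_mem hj']

omit [IsProbabilityMeasure Q] in
theorem IsSortedPoissonLaw.ae_finite (hQ : IsSortedPoissonLaw ν τ Q) {s : Set E}
    (hs : MeasurableSet s) (hν : ν s ≠ ∞) : ∀ᵐ η ∂Q, {j | η j ∈ s}.Finite := by
  have hg : Measurable (s.indicator fun _ => (1 : ℝ≥0∞)) := measurable_const.indicator hs
  have h1 := hQ.intensity _ hg
  rw [lintegral_indicator_const hs, one_mul] at h1
  have h2 := ae_lt_top (Measurable.tsum fun j => by fun_prop) (h1.trans_ne hν)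
  exact h2.mono fun η hη => finite_mem_of_tsum_indicator_ne_top hη.ne

theorem IsSortedPoissonLaw.isPoissonProcess (hQ : IsSortedPoissonLaw ν τ Q) :
    IsPoissonProcess Q ν (fun η => countingMeasure η) :=
  HasPoissonCharFun.isPoissonProcess (Ω := ℕ → E) (x := fun j η => η j) hQ.charFun
    measurable_pi_apply fun _ hs hν => hQ.ae_finite hs hν

end Campbell

/-! ### Transport of Poisson processes -/

theorem IsPoissonProcess.comp {Ω Ω' S : Type*} [MeasurableSpace Ω] [MeasurableSpace Ω']
    [MeasurableSpace S] {P : Measure Ω} {P' : Measure Ω'} {ν : Measure S} {N : Ω' → Measure S}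
    (hN : IsPoissonProcess P' ν N) {f : Ω → Ω'} (hf : MeasurePreserving f P P') :
    IsPoissonProcess P ν fun ω => N (f ω) := by
  have hm : ∀ s, MeasurableSet s → Measurable fun ω' => N ω' s := fun s hs =>
    (Measure.measurable_coe hs).comp hN.measurable
  refine ⟨hN.measurable.comp hf.measurable, fun s hs hν => ?_, fun m s hs hν hd => ?_⟩
  · rw [← hN.law s hs hν, ← hf.map_eq, Measure.map_map (hm s hs) hf.measurable]
    rfl
  · have h := hN.indep m s hs hν hd
    rw [iIndepFun_iff_measure_inter_preimage_eq_mul] at h ⊢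
    intro A sets hsets
    have h1 := h A hsets
    have h2 : ∀ i ∈ A, MeasurableSet ((fun ω' => N ω' (s i)) ⁻¹' sets i) := fun i hi =>
      hm _ (hs i) (hsets i hi)
    rw [← hf.measure_preimage (Finset.measurableSet_biInter A h2).nullMeasurableSet,
      Finset.prod_congr rfl fun i hi => (hf.measure_preimage (h2 i hi).nullMeasurableSet).symm] at h1
    rw [Set.preimage_iInter₂] at h1
    exact h1

theorem IsPoissonProcess.map {Ω S S' : Type*} [MeasurableSpace Ω]
    [MeasurableSpace S] [MeasurableSpace S'] {P : Measure Ω} {ν : Measure S} {x : ℕ → Ω → S}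
    (hN : IsPoissonProcess P ν fun ω => countingMeasure fun j => x j ω)
    (hx : ∀ j, Measurable (x j)) {g : S → S'} (hg : Measurable g) :
    IsPoissonProcess P (ν.map g) fun ω => countingMeasure fun j => g (x j ω) := by
  have h1 : ∀ s, MeasurableSet s → ∀ ω, countingMeasure (fun j => g (x j ω)) s =
      countingMeasure (fun j => x j ω) (g ⁻¹' s) := by
    intro s hs ω
    rw [countingMeasure_apply _ hs, countingMeasure_apply _ (hg hs)]
    rfl
  refine ⟨measurable_countingMeasure fun j => hg.comp (hx j), fun s hs hν => ?_,
    fun m s hs hν hd => ?_⟩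
  · rw [Measure.map_apply hg hs] at hν ⊢
    simp_rw [h1 s hs]
    exact hN.law _ (hg hs) hν
  · simp_rw [fun i => h1 (s i) (hs i)]
    refine hN.indep m _ (fun i => hg (hs i)) (fun i => ?_) fun i j hij => (hd hij).preimage g
    rw [← Measure.map_apply hg (hs i)]
    exact hν i

/-! ### The assembled configuration as a Poisson process -/

section Assembled

variable {E : Type*} [NormedAddCommGroup E] [MeasurableSpace E] [BorelSpace E]
  [SecondCountableTopology E] [ProperSpace E] {ν : Measure E} [ν.IsAddLeftInvariant]
  [IsFiniteMeasureOnCompacts ν]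
  {τ : E → ℝ} {Q : Measure (ℕ → E)} [IsProbabilityMeasure Q]

omit [MeasurableSpace E] [BorelSpace E] [SecondCountableTopology E] [ProperSpace E] in
theorem expl_subset_ball (R : ℝ) (ω : List ℕ → ℕ → E) (u : List ℕ) :
    expl R ω u ⊆ Metric.ball (pos ω u) (rad R ω u) := fun y hy => by
  rw [Metric.mem_ball, dist_eq_norm]
  exact hy.2

omit [SecondCountableTopology E] [BorelSpace E] [ν.IsAddLeftInvariant] in
theorem measure_explBefore_ne_top (R : ℝ) (ω : List ℕ → ℕ → E) (n : ℕ) :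
    ν (explBefore R ω n) ≠ ∞ := by
  have h : explBefore R ω n ⊆ ⋃ u ∈ wordsBefore n, Metric.ball (pos ω u) (rad R ω u) := by
    rintro y ⟨u, hu, hy⟩
    exact Set.mem_biUnion hu (expl_subset_ball R ω u hy)
  refine measure_ne_top_of_subset h ?_
  exact ((measure_biUnion_lt_top (wordsBefore n).finite_toSet
    fun u _ => measure_ball_lt_top)).ne

-- By translation invariance the expected number of children in `s` is `ν s`, wherever the parent
-- is.
omit [ProperSpace E] [IsFiniteMeasureOnCompacts ν] in
theorem ae_finite_children (hQ : IsSortedPoissonLaw ν τ Q) (u : List ℕ) {s : Set E}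
    (hs : MeasurableSet s) (hν : ν s ≠ ∞) :
    ∀ᵐ ω ∂(Measure.infinitePi fun _ : List ℕ => Q), {j | pos ω (j :: u) ∈ s}.Finite := by
  have h1 := lintegral_tsum_children hQ u
    (H := fun ω y => s.indicator (fun _ => (1 : ℝ≥0∞)) (pos ω u + y)) (by
      exact (measurable_const.indicator hs).comp
        (((measurable_pos u).comp measurable_fst).add measurable_snd))
    (fun ω ξ => by rw [pos_congr (update_agree ω u ξ) le_rfl])
  have h2 : ∀ ω : List ℕ → ℕ → E,
      ∫⁻ y, s.indicator (fun _ => (1 : ℝ≥0∞)) (pos ω u + y) ∂ν = ν s := by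
    intro ω
    rw [lintegral_add_left_eq_self (μ := ν) (s.indicator fun _ => (1 : ℝ≥0∞)) (pos ω u),
      lintegral_indicator_const hs, one_mul]
  simp_rw [h2] at h1
  rw [lintegral_const, measure_univ, mul_one] at h1
  have h3 := ae_lt_top (Measurable.tsum fun j => by
    exact (measurable_const.indicator hs).comp ((measurable_pos (j :: u)))) (h1.trans_ne hν)
  exact h3.mono fun ω hω => finite_mem_of_tsum_indicator_ne_top hω.ne

omit [ProperSpace E] [IsFiniteMeasureOnCompacts ν] in
theorem ae_finite_kept (hQ : IsSortedPoissonLaw ν τ Q) (R : ℝ) (n : ℕ) {s : Set E}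
    (hs : MeasurableSet s) (hν : ν s ≠ ∞) :
    ∀ᵐ q ∂((Measure.infinitePi fun _ : List ℕ => Q).prod Q),
      {i | IsKept R n q i ∧ candidate q i ∈ s}.Finite := by
  have h1 : ∀ᵐ q ∂((Measure.infinitePi fun _ : List ℕ => Q).prod Q),
      ∀ u ∈ wordsBefore n, {j | pos q.1 (j :: u) ∈ s}.Finite := by
    rw [Finset.eventually_all]
    exact fun u _ => Measure.quasiMeasurePreserving_fst.ae (ae_finite_children hQ u hs hν)
  have h2 : ∀ᵐ q ∂((Measure.infinitePi fun _ : List ℕ => Q).prod Q), {j | q.2 j ∈ s}.Finite :=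
    Measure.quasiMeasurePreserving_snd.ae (hQ.ae_finite hs hν)
  filter_upwards [h1, h2] with q hq1 hq2
  have h3 : ((⋃ u ∈ wordsBefore n, (fun j => Sum.inl (u, j)) '' {j | pos q.1 (j :: u) ∈ s}) ∪
      (Sum.inr '' {j | q.2 j ∈ s}) : Set ((List ℕ × ℕ) ⊕ ℕ)).Finite :=
    (Set.Finite.biUnion (wordsBefore n).finite_toSet fun u hu => (hq1 u hu).image _).union
      (hq2.image _)
  refine h3.subset ?_
  rintro (⟨u, j⟩ | j) ⟨hk, hi⟩
  · exact Or.inl (Set.mem_biUnion hk.1 ⟨j, hi, rfl⟩)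
  · exact Or.inr ⟨j, hi, rfl⟩

-- The explored region is contained in finitely many balls and so has finite intensity. Almost
-- surely it swallows only finitely many terms of the additional sequence, and the others are kept.
omit [ν.IsAddLeftInvariant] in
theorem ae_infinite_keptCodes (hQ : IsSortedPoissonLaw ν τ Q) (R : ℝ) (n : ℕ) :
    ∀ᵐ q ∂((Measure.infinitePi fun _ : List ℕ => Q).prod Q), (keptCodes R n q).Infinite := by
  have hm : MeasurableSet {q : (List ℕ → ℕ → E) × (ℕ → E) |
      ∑' j, (explBefore R q.1 n).indicator (fun _ => (1 : ℝ≥0∞)) (q.2 j) ≠ ∞} := by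
    have : Measurable fun q : (List ℕ → ℕ → E) × (ℕ → E) =>
        ∑' j, (explBefore R q.1 n).indicator (fun _ => (1 : ℝ≥0∞)) (q.2 j) := by
      refine Measurable.tsum fun j => ?_
      have h1 : Measurable fun q : (List ℕ → ℕ → E) × (ℕ → E) => (q.1, q.2 j) := by fun_prop
      exact Measurable.indicator (measurable_const (a := (1 : ℝ≥0∞)))
        (h1 (measurableSet_explBefore R n))
    exact (this (measurableSet_singleton ∞)).compl
  have h1 : ∀ᵐ q ∂((Measure.infinitePi fun _ : List ℕ => Q).prod Q),
      ∑' j, (explBefore R q.1 n).indicator (fun _ => (1 : ℝ≥0∞)) (q.2 j) ≠ ∞ := by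
    rw [Measure.ae_prod_iff_ae_ae hm]
    refine ae_of_all _ fun ω => ?_
    have hs := measurableSet_explBefore_section R ω n
    have hg : Measurable ((explBefore R ω n).indicator fun _ => (1 : ℝ≥0∞)) :=
      measurable_const.indicator hs
    have h1 := hQ.intensity _ hg
    rw [lintegral_indicator_const hs, one_mul] at h1
    have h2 := ae_lt_top (Measurable.tsum fun j => by fun_prop)
      (h1.trans_ne (measure_explBefore_ne_top R ω n))
    exact h2.mono fun η hη => hη.ne
  filter_upwards [h1] with q hq
  have h2 := (finite_mem_of_tsum_indicator_ne_top hq).infinite_compl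
  have h3 := h2.image (f := fun j => Encodable.encode (Sum.inr j : (List ℕ × ℕ) ⊕ ℕ))
    (fun a _ b _ hab => Sum.inr_injective (Encodable.encode_injective hab))
  refine h3.mono ?_
  rintro _ ⟨j, hj, rfl⟩
  rw [keptCodes, Set.mem_ofPred_eq, Denumerable.ofNat_encode]
  exact hj

/-- The assembled process is a Poisson process. -/
theorem isPoissonProcess_kept (hQ : IsSortedPoissonLaw ν τ Q) (R : ℝ) (n : ℕ) :
    IsPoissonProcess ((Measure.infinitePi fun _ : List ℕ => Q).prod Q) ν
      fun q => countingMeasure fun j => candidate q (keptIdx R n q j) := by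
  have hinf := ae_infinite_keptCodes hQ R n
  refine HasPoissonCharFun.isPoissonProcess (x := fun j q => candidate q (keptIdx R n q j))
    (fun h hh hν => ?_) (fun j => measurable_keptPoint R n j) fun s hs hν => ?_
  · rw [← integral_assembled hQ R hh hν n]
    have h1 := integral_prod (μ := Measure.infinitePi fun _ : List ℕ => Q) (ν := Q) _
      (integrable_expI (measurable_assembled R hh n))
    rw [← h1]
    refine integral_congr_ae ?_
    filter_upwards [hinf, ae_finite_kept hQ R n (measurableSet_support hh) hν] with q hq1 hq2
    rw [tsum_keptIdx hq1 h hq2]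
  · filter_upwards [hinf, ae_finite_kept hQ R n hs hν] with q hq1 hq2
    refine Set.Finite.of_finite_image (f := keptIdx R n q) (hq2.subset ?_)
      (keptIdx_injective hq1).injOn
    rintro _ ⟨j, hj, rfl⟩
    exact ⟨isKept_keptIdx hq1 j, hj⟩

end Assembled


/-! ### The expected number of descending words -/

theorem tsum_list (F : List ℕ → ℝ≥0∞) : ∑' w, F w = F [] + ∑' u, ∑' j, F (j :: u) := by
  have e : Function.Injective fun p : List ℕ × ℕ => p.2 :: p.1 := fun p q h => by
    obtain ⟨h1, h2⟩ := List.cons.inj h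
    exact Prod.ext h2 h1
  have h1 : ∑' w, F w = F [] + ∑' w, Set.indicator (Set.range fun p : List ℕ × ℕ => p.2 :: p.1) F w := by
    rw [ENNReal.summable.tsum_eq_add_tsum_ite' [] (f := F)]
    congr 1
    refine tsum_congr fun w => ?_
    rcases w with _ | ⟨j, u⟩
    · simp
    · have hmem : j :: u ∈ Set.range fun p : List ℕ × ℕ => p.2 :: p.1 := ⟨(u, j), rfl⟩
      rw [Set.indicator_of_mem hmem]
      simp
  rw [h1, ← tsum_subtype, tsum_range _ e, ENNReal.tsum_prod']

section FirstMoment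

variable {E : Type*} [NormedAddCommGroup E] [MeasurableSpace E] [BorelSpace E] {ν : Measure E}
  {f : ℝ → ℝ} (hf : StrictMonoOn f (Set.Ici 0)) (hfm : Measurable f)
  (hf0 : f 0 = 0) (hν : ν.map (fun y => f ‖y‖) = volume.restrict (Set.Ici 0))

-- In the variable s = f(‖y‖), which is distributed as Lebesgue measure on [0, ∞), this is the
-- integral of s^k/k! from 0 to f(r).
include hf hfm hf0 hν in
theorem lintegral_ball_pow {r : ℝ} (hr : 0 ≤ r) (k : ℕ) :
    ∫⁻ y, (if ‖y‖ < r then ENNReal.ofReal (f ‖y‖ ^ k / k.factorial) else 0) ∂ν =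
      ENNReal.ofReal (f r ^ (k + 1) / (k + 1).factorial) := by
  have h0 : 0 ≤ f r := hf0 ▸ hf.monotoneOn (Set.mem_Ici.2 le_rfl) hr hr
  have hg : Measurable fun s : ℝ => (if s < f r then ENNReal.ofReal (s ^ k / k.factorial) else 0) :=
    Measurable.ite (measurableSet_lt measurable_id measurable_const) (by fun_prop) measurable_const
  have h1 : ∀ y : E, (if ‖y‖ < r then ENNReal.ofReal (f ‖y‖ ^ k / k.factorial) else 0) =
      (fun s : ℝ => (if s < f r then ENNReal.ofReal (s ^ k / k.factorial) else 0)) (f ‖y‖) := by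
    intro y
    have : f ‖y‖ < f r ↔ ‖y‖ < r := hf.lt_iff_lt (norm_nonneg y) hr
    simp only [this]
  simp_rw [h1]
  have h3 : Measurable fun y : E => f ‖y‖ := hfm.comp measurable_norm
  have h4 := lintegral_map (μ := ν) hg h3
  rw [← h4, hν]
  have h2 : (fun s : ℝ => (if s < f r then ENNReal.ofReal (s ^ k / k.factorial) else 0)) =
      (Set.Iio (f r)).indicator fun s => ENNReal.ofReal (s ^ k / k.factorial) := by
    ext s
    simp [Set.indicator_apply]
  rw [h2, lintegral_indicator measurableSet_Iio, Measure.restrict_restrict measurableSet_Iio,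
    Set.inter_comm, Set.Ici_inter_Iio, ← ofReal_integral_eq_lintegral_ofReal]
  · rw [integral_Ico_eq_integral_Ioc, ← intervalIntegral.integral_of_le h0]
    congr 1
    rw [intervalIntegral.integral_div, integral_pow, Nat.factorial_succ]
    push_cast
    rw [zero_pow (Nat.succ_ne_zero k), sub_zero, div_div]
  · have : Continuous fun s : ℝ => s ^ k / k.factorial := by fun_prop
    exact (this.integrableOn_Icc (a := 0) (b := f r)).mono_set Set.Ico_subset_Icc_self
  · refine (ae_restrict_iff' measurableSet_Ico).2 (ae_of_all _ fun s hs => ?_)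
    exact div_nonneg (pow_nonneg hs.1 _) (Nat.cast_nonneg _)

omit [MeasurableSpace E] [BorelSpace E] in
theorem rad_nonneg {R : ℝ} (hR : 0 ≤ R) (ω : List ℕ → ℕ → E) : ∀ u, 0 ≤ rad R ω u
  | [] => hR
  | _ :: _ => norm_nonneg _

omit [MeasurableSpace E] [BorelSpace E] in
theorem rad_le_of_desc {R : ℝ} {ω : List ℕ → ℕ → E} : ∀ {u}, Desc R ω u → rad R ω u ≤ R
  | [], _ => le_rfl
  | _ :: _, h => h.2.le.trans (rad_le_of_desc h.1)

open Classical in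
/-- The expected sum, over the descending words `u` of length `n`, of `s ^ k / k!`, where `s` is the
volume of the ball of `u`. -/
noncomputable def levelMoment (Q : Measure (ℕ → E)) [IsProbabilityMeasure Q] (R : ℝ) (f : ℝ → ℝ)
    (n k : ℕ) : ℝ≥0∞ :=
  ∑' u : List ℕ, if u.length = n then
    ∫⁻ ω, (if Desc R ω u then ENNReal.ofReal (f (rad R ω u) ^ k / k.factorial) else 0)
      ∂(Measure.infinitePi fun _ : List ℕ => Q) else 0

variable {Q : Measure (ℕ → E)} [IsProbabilityMeasure Q] {τ : E → ℝ}
  (hQ : IsSortedPoissonLaw ν τ Q) {R : ℝ} (hR : 0 ≤ R)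

omit [BorelSpace E] in
theorem levelMoment_zero (k : ℕ) :
    levelMoment Q R f 0 k = ENNReal.ofReal (f R ^ k / k.factorial) := by
  rw [levelMoment, tsum_eq_single []]
  · simp [Desc, rad]
  · intro u hu
    rw [if_neg]
    simpa using hu

-- Summing over the last letter with Campbell's formula integrates s^k/k! over the ball of the
-- parent, which raises the exponent by one and lowers the length by one.
include hf hfm hf0 hν hQ hR in
theorem levelMoment_succ (n k : ℕ) :
    levelMoment Q R f (n + 1) k = levelMoment Q R f n (k + 1) := by
  classical
  rw [levelMoment, tsum_list, levelMoment]
  simp only [List.length_nil, List.length_cons, Nat.add_right_cancel_iff]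
  rw [if_neg (by omega), zero_add]
  refine tsum_congr fun u => ?_
  by_cases hu : u.length = n
  · simp only [hu, if_true]
    set H : (List ℕ → ℕ → E) → E → ℝ≥0∞ := fun ω y => if Desc R ω u then
      (if ‖y‖ < rad R ω u then ENNReal.ofReal (f ‖y‖ ^ k / k.factorial) else 0) else 0 with hH
    have hHm : Measurable (Function.uncurry H) := by
      refine Measurable.ite (measurable_fst (measurableSet_desc R u)) (Measurable.ite
        (measurableSet_lt measurable_snd.norm ((measurable_rad R u).comp measurable_fst)) ?_
        measurable_const) measurable_const
      have : Measurable fun q : (List ℕ → ℕ → E) × E => f ‖q.2‖ := hfm.comp measurable_snd.norm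
      exact ENNReal.measurable_ofReal.comp ((this.pow_const k).div_const _)
    have h1 := lintegral_tsum_children hQ u hHm fun ω ξ => by
      funext y
      simp only [hH, desc_congr (update_agree ω u ξ) le_rfl, rad_congr (update_agree ω u ξ) le_rfl]
    have h2 : ∀ (j : ℕ) (ω : List ℕ → ℕ → E),
        (if Desc R ω (j :: u) then ENNReal.ofReal (f (rad R ω (j :: u)) ^ k / k.factorial) else 0) =
        H ω (ω u j) := by
      intro j ω
      by_cases h : Desc R ω (j :: u)
      · rw [if_pos h]
        simp only [hH]
        rw [if_pos h.1, if_pos h.2, rad]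
      · rw [if_neg h]
        simp only [hH]
        by_cases h' : Desc R ω u
        · rw [if_pos h', if_neg fun h'' => h ⟨h', h''⟩]
        · rw [if_neg h']
    simp_rw [h2]
    have h3 : ∀ j, Measurable fun ω : List ℕ → ℕ → E => H ω (ω u j) := fun j =>
      hHm.comp (f := fun ω : List ℕ → ℕ → E => (ω, ω u j)) (by fun_prop)
    rw [← lintegral_tsum fun j => (h3 j).aemeasurable, h1]
    refine lintegral_congr fun ω => ?_
    by_cases hd : Desc R ω u
    · simp only [hH, hd, if_true]
      exact lintegral_ball_pow hf hfm hf0 hν (rad_nonneg hR ω u) k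
    · simp [hH, hd]
  · simp [hu]

include hf hfm hf0 hν hQ hR in
theorem levelMoment_eq (n k : ℕ) :
    levelMoment Q R f n k = ENNReal.ofReal (f R ^ (n + k) / (n + k).factorial) := by
  induction n generalizing k with
  | zero => rw [levelMoment_zero, zero_add]
  | succ n ih =>
    rw [levelMoment_succ hf hfm hf0 hν hQ hR, ih]
    rw [show n + (k + 1) = n + 1 + k by omega]

-- Level `n` contributes f(R)^n/n!, the case k = 0 of `levelMoment_eq`; the sum over `n` is the
-- exponential series.
include hf hfm hf0 hν hQ hR in
theorem tsum_measure_desc :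
    ∑' u, (Measure.infinitePi fun _ : List ℕ => Q) {ω | Desc R ω u} =
      ENNReal.ofReal (Real.exp (f R)) := by
  classical
  have h0 : 0 ≤ f R := hf0 ▸ hf.monotoneOn (Set.mem_Ici.2 le_rfl) hR hR
  have h1 : ∀ u : List ℕ, (Measure.infinitePi fun _ : List ℕ => Q) {ω | Desc R ω u} =
      ∑' n : ℕ, if u.length = n then ∫⁻ ω, (if Desc R ω u then
        ENNReal.ofReal (f (rad R ω u) ^ 0 / (0 : ℕ).factorial) else 0)
        ∂(Measure.infinitePi fun _ : List ℕ => Q) else 0 := by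
    intro u
    rw [tsum_eq_single u.length fun n hn => if_neg hn.symm, if_pos rfl,
      ← lintegral_indicator_one (measurableSet_desc R u)]
    refine lintegral_congr fun ω => ?_
    by_cases h : Desc R ω u <;> simp [h]
  simp_rw [h1]
  rw [ENNReal.tsum_comm]
  have h2 : ∀ n : ℕ, (∑' u : List ℕ, if u.length = n then ∫⁻ ω, (if Desc R ω u then
        ENNReal.ofReal (f (rad R ω u) ^ 0 / (0 : ℕ).factorial) else 0)
        ∂(Measure.infinitePi fun _ : List ℕ => Q) else 0) =
      ENNReal.ofReal (f R ^ n / n.factorial) := fun n =>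
    levelMoment_eq hf hfm hf0 hν hQ hR n 0
  simp_rw [h2]
  have h3 : HasSum (fun n : ℕ => f R ^ n / n.factorial) (Real.exp (f R)) := by
    rw [Real.exp_eq_exp_ℝ]
    exact NormedSpace.expSeries_div_hasSum_exp (f R)
  rw [← ENNReal.ofReal_tsum_of_nonneg (fun n => by positivity) h3.summable, h3.tsum_eq]

end FirstMoment


/-! ### Separation of the points of descending words -/

section Geometry

variable {E : Type*} [NormedAddCommGroup E] [InnerProductSpace ℝ E]

/-- The intersection of two balls of radius `R` whose centres have distance at least `ρ` lies in the
ball of radius `ρ` around the midpoint, where `ρ² = 4R²/5`. -/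
theorem norm_sub_midpoint_lt {R ρ : ℝ} (hρ : 0 ≤ ρ) (hρR : ρ ^ 2 = 4 / 5 * R ^ 2) {y a : E}
    (h1 : ‖y‖ < R) (h2 : ‖y - a‖ < R) (ha : ρ ≤ ‖a‖) : ‖y - (1 / 2 : ℝ) • a‖ < ρ := by
  have h := parallelogram_law_with_norm ℝ (y - (1 / 2 : ℝ) • a) ((1 / 2 : ℝ) • a)
  have e1 : y - (1 / 2 : ℝ) • a + (1 / 2 : ℝ) • a = y := by abel
  have e2 : y - (1 / 2 : ℝ) • a - (1 / 2 : ℝ) • a = y - a := by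
    rw [sub_sub, ← add_smul]
    norm_num
  rw [e1, e2, norm_smul] at h
  norm_num at h
  have h3 : ‖y‖ ^ 2 < R ^ 2 := by gcongr
  have h4 : ‖y - a‖ ^ 2 < R ^ 2 := by gcongr
  have h5 : ρ ^ 2 ≤ ‖a‖ ^ 2 := by gcongr
  norm_num
  refine lt_of_pow_lt_pow_left₀ 2 hρ ?_
  nlinarith

/-- The word `v` descends and has been found before `u` is explored. -/
def Known (R : ℝ) (ω : List ℕ → ℕ → E) (u v : List ℕ) : Prop :=
  Desc R ω v ∧ (v = [] ∨ Encodable.encode v.tail < Encodable.encode u)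

/-- Points of distinct descending words are distinct, and only children lie in the ball of a
descending word. -/
def IsSeparated (R : ℝ) (ω : List ℕ → ℕ → E) : Prop :=
  ∀ v w, Desc R ω v → Desc R ω w → v ≠ w →
    pos ω v ≠ pos ω w ∧ (‖pos ω w - pos ω v‖ < rad R ω v → ∃ j, w = j :: v)

/-- Comparing the codes of the parents tells which of two words is found later. If the codes are
equal the words are siblings, found at the same time. -/
theorem words_trichotomy {v w : List ℕ} (h : v ≠ w) :
    (∃ u j, w = j :: u ∧ (v = [] ∨ Encodable.encode v.tail < Encodable.encode u)) ∨
    (∃ u j, v = j :: u ∧ (w = [] ∨ Encodable.encode w.tail < Encodable.encode u)) ∨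
    ∃ u i j, i ≠ j ∧ v = i :: u ∧ w = j :: u := by
  rcases v with _ | ⟨i, v⟩
  · rcases w with _ | ⟨j, w⟩
    · exact absurd rfl h
    · exact Or.inl ⟨w, j, rfl, Or.inl rfl⟩
  · rcases w with _ | ⟨j, w⟩
    · exact Or.inr (Or.inl ⟨v, i, rfl, Or.inl rfl⟩)
    · rcases lt_trichotomy (Encodable.encode v) (Encodable.encode w) with h1 | h1 | h1
      · exact Or.inl ⟨w, j, rfl, Or.inr h1⟩
      · have h2 := Encodable.encode_injective h1
        subst h2
        refine Or.inr (Or.inr ⟨v, i, j, fun hij => h (by rw [hij]), rfl, rfl⟩)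
      · exact Or.inr (Or.inl ⟨v, i, rfl, Or.inr h1⟩)

omit [InnerProductSpace ℝ E] in
theorem known_self {R : ℝ} {ω : List ℕ → ℕ → E} {u : List ℕ} (hu : Desc R ω u) :
    Known R ω u u := by
  refine ⟨hu, ?_⟩
  rcases u with _ | ⟨j, u⟩
  · exact Or.inl rfl
  · exact Or.inr (encode_lt_encode_cons j u)

/-- A child of `u` lies within `R` of `u`. Were it also within `R` of another word found earlier,
whose distance from `u` is at least `ρ` by the first part of `hA`, it would lie within `ρ` of their
midpoint, which the second part excludes. Siblings are treated in the same way by `hB`. So points at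
distance less than `R` belong to a parent and its child. -/
theorem isSeparated_of_avoids {R ρ : ℝ} (hρ : 0 < ρ) (hρR : ρ ^ 2 = 4 / 5 * R ^ 2) (hle : ρ ≤ R)
    {ω : List ℕ → ℕ → E}
    (hA : ∀ u j v, Desc R ω (j :: u) → Known R ω u v →
      ρ ≤ ‖ω u j - (pos ω v - pos ω u)‖ ∧ ρ ≤ ‖ω u j - (1 / 2 : ℝ) • (pos ω v - pos ω u)‖)
    (hB : ∀ u i j, i ≠ j → Desc R ω (i :: u) → Desc R ω (j :: u) →
      ρ ≤ ‖ω u j - (1 / 2 : ℝ) • ω u i‖) : IsSeparated R ω := by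
  have hsmall : ∀ {u j}, Desc R ω (j :: u) → ‖ω u j‖ < R := fun h =>
    h.2.trans_le (rad_le_of_desc h.1)
  have hsib : ∀ u i j, i ≠ j → Desc R ω (i :: u) → Desc R ω (j :: u) →
      R ≤ ‖pos ω (j :: u) - pos ω (i :: u)‖ := by
    intro u i j hij hi hj
    -- The parent `u` is itself among the words known when `u` is explored.
    have h1 : ρ ≤ ‖ω u i‖ := by
      have := (hA u i u hi (known_self hi.1)).1
      rwa [sub_self, sub_zero] at this
    rw [pos, pos, add_sub_add_left_eq_sub]
    by_contra hc
    exact (norm_sub_midpoint_lt hρ.le hρR (hsmall hj) (not_le.1 hc) h1).not_ge (hB u i j hij hi hj)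
  have hknown : ∀ u j v, Desc R ω (j :: u) → Known R ω u v →
      ρ ≤ ‖pos ω (j :: u) - pos ω v‖ := by
    intro u j v hj hv
    have := (hA u j v hj hv).1
    have e : pos ω (j :: u) - pos ω v = ω u j - (pos ω v - pos ω u) := by
      rw [pos]
      abel
    rwa [e]
  have hfar : ∀ v w, Desc R ω v → Desc R ω w → v ≠ w → ρ ≤ ‖pos ω w - pos ω v‖ := by
    intro v w hv hw hne
    rcases words_trichotomy hne with ⟨u, j, rfl, h⟩ | ⟨u, j, rfl, h⟩ | ⟨u, i, j, hij, rfl, rfl⟩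
    · exact hknown u j v hw ⟨hv, h⟩
    · rw [norm_sub_rev]
      exact hknown u j w hv ⟨hw, h⟩
    · exact hle.trans (hsib u i j hij hv hw)
  have hknown2 : ∀ u j v, Desc R ω (j :: u) → Known R ω u v → v ≠ u →
      R ≤ ‖pos ω (j :: u) - pos ω v‖ := by
    intro u j v hj hv hne
    by_contra hc
    have h1 : ‖ω u j - (pos ω v - pos ω u)‖ < R := by
      have e : ω u j - (pos ω v - pos ω u) = pos ω (j :: u) - pos ω v := by
        rw [pos]
        abel
      rw [e]
      exact not_le.1 hc
    exact (norm_sub_midpoint_lt hρ.le hρR (hsmall hj) h1 (hfar u v hj.1 hv.1 hne.symm)).not_ge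
      (hA u j v hj hv).2
  intro v w hv hw hne
  refine ⟨fun h => ?_, fun hlt => ?_⟩
  · have := hfar v w hv hw hne
    rw [h, sub_self, norm_zero] at this
    exact hρ.not_ge this
  · have hlt' := hlt.trans_le (rad_le_of_desc hv)
    rcases words_trichotomy hne with ⟨u, j, rfl, h⟩ | ⟨u, j, rfl, h⟩ | ⟨u, i, j, hij, rfl, rfl⟩
    · by_cases hvu : v = u
      · exact ⟨j, by rw [hvu]⟩
      · exact absurd hlt' (hknown2 u j v hw ⟨hv, h⟩ hvu).not_gt
    · exfalso
      -- The parent of `v` lies at distance exactly the radius of `v`, hence not in the open ball.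
      by_cases hwu : w = u
      · subst hwu
        rw [pos, sub_add_cancel_left, norm_neg, rad] at hlt
        exact lt_irrefl _ hlt
      · rw [norm_sub_rev] at hlt'
        exact (hknown2 u j w hv ⟨hw, h⟩ hwu).not_gt hlt'
    · exact absurd hlt' (hsib u i j hij hv hw).not_gt

-- A known word may have a larger code than `u`, but the code of its parent is smaller, and the
-- sequences of the parent and of its ancestors determine whether the word descends and where it
-- lies.
omit [InnerProductSpace ℝ E] in
theorem known_congr {R : ℝ} {ω ω' : List ℕ → ℕ → E} {u v : List ℕ}
    (h : ∀ w, Encodable.encode w < Encodable.encode u → ω w = ω' w) :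
    Known R ω u v ↔ Known R ω' u v := by
  refine and_congr_left fun hv => ?_
  rcases v with _ | ⟨i, v⟩
  · rfl
  · simp only [List.tail_cons, reduceCtorEq, false_or] at hv
    rw [Desc, Desc, desc_congr h hv.le, rad_congr h hv.le, h v hv]

omit [InnerProductSpace ℝ E] in
theorem pos_congr_of_known {R : ℝ} {ω ω' : List ℕ → ℕ → E} {u v : List ℕ}
    (h : ∀ w, Encodable.encode w < Encodable.encode u → ω w = ω' w) (hv : Known R ω u v) :
    pos ω v = pos ω' v := by
  rcases v with _ | ⟨i, v⟩
  · rfl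
  · have hv' := hv.2
    simp only [List.tail_cons, reduceCtorEq, false_or] at hv'
    rw [pos, pos, pos_congr h hv'.le, h v hv']

end Geometry

/-! ### Probability that the descending words fail to be separated -/

section BadEvents

variable {E : Type*} [NormedAddCommGroup E] [InnerProductSpace ℝ E] [MeasurableSpace E]
  [BorelSpace E] [SecondCountableTopology E] {ν : Measure E} {τ : E → ℝ}
  {Q : Measure (ℕ → E)} [IsProbabilityMeasure Q]

open Classical in
/-- The number of words found before `u` is explored. -/
noncomputable def knownCount (R : ℝ) (ω : List ℕ → ℕ → E) (u : List ℕ) : ℝ≥0∞ :=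
  ∑' v, if Known R ω u v then 1 else 0

open Classical in
/-- The number of descending words. -/
noncomputable def descCount (R : ℝ) (ω : List ℕ → ℕ → E) : ℝ≥0∞ :=
  ∑' v, if Desc R ω v then 1 else 0

open Classical in
/-- The number of known words to which a child of `u` with displacement `y` comes too close, counted
only if not too many words are known. -/
noncomputable def clashCount (R ρ : ℝ) (M : ℝ≥0∞) (u : List ℕ) (ω : List ℕ → ℕ → E) (y : E) :
    ℝ≥0∞ :=
  if Desc R ω u ∧ knownCount R ω u ≤ M then
    ∑' v, if Known R ω u v then
      (if ‖y - (pos ω v - pos ω u)‖ < ρ then 1 else 0) +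
        (if ‖y - (1 / 2 : ℝ) • (pos ω v - pos ω u)‖ < ρ then 1 else 0) else 0
  else 0

open Classical in
/-- The indicator that two children of `u` with displacements `y`, `y'` come too close. -/
noncomputable def siblingClash (R ρ : ℝ) (u : List ℕ) (ω : List ℕ → ℕ → E) (y y' : E) : ℝ≥0∞ :=
  if Desc R ω u ∧ ‖y‖ < R ∧ ‖y' - (1 / 2 : ℝ) • y‖ < ρ then 1 else 0


omit [MeasurableSpace E] [BorelSpace E] [SecondCountableTopology E] [InnerProductSpace ℝ E] in
theorem knownCount_le_descCount (R : ℝ) (ω : List ℕ → ℕ → E) (u : List ℕ) :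
    knownCount R ω u ≤ descCount R ω := by
  refine ENNReal.tsum_le_tsum fun v => ?_
  by_cases h : Known R ω u v
  · rw [if_pos h, if_pos h.1]
  · rw [if_neg h]
    exact zero_le

omit [InnerProductSpace ℝ E] [SecondCountableTopology E] in
theorem measurableSet_known (R : ℝ) (u v : List ℕ) :
    MeasurableSet {ω : List ℕ → ℕ → E | Known R ω u v} :=
  (measurableSet_desc R v).inter (MeasurableSet.const _)

omit [InnerProductSpace ℝ E] [SecondCountableTopology E] in
theorem measurable_knownCount (R : ℝ) (u : List ℕ) :
    Measurable fun ω : List ℕ → ℕ → E => knownCount R ω u :=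
  Measurable.tsum fun v => Measurable.ite (measurableSet_known R u v) measurable_const
    measurable_const

theorem measurable_clashCount (R ρ : ℝ) (M : ℝ≥0∞) (u : List ℕ) :
    Measurable (Function.uncurry (clashCount (E := E) R ρ M u)) := by
  refine Measurable.ite (measurable_fst ((measurableSet_desc R u).inter
    (measurableSet_le (measurable_knownCount R u) measurable_const)))
    (Measurable.tsum fun v => ?_) measurable_const
  have h : Measurable fun q : (List ℕ → ℕ → E) × E => pos q.1 v - pos q.1 u :=
    ((measurable_pos v).comp measurable_fst).sub ((measurable_pos u).comp measurable_fst)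
  refine Measurable.ite (measurable_fst (measurableSet_known R u v)) (Measurable.add ?_ ?_)
    measurable_const
  · exact Measurable.ite (measurableSet_lt (measurable_snd.sub h).norm measurable_const)
      measurable_const measurable_const
  · exact Measurable.ite (measurableSet_lt (measurable_snd.sub (h.const_smul (1 / 2 : ℝ))).norm
      measurable_const) measurable_const measurable_const

-- This is why the cap in `clashCount` is on the number of known words: unlike the number of all
-- descending words, it does not depend on the sequence of `u`, as Campbell's formula requires.
omit [MeasurableSpace E] [BorelSpace E] [SecondCountableTopology E] in
theorem clashCount_update (R ρ : ℝ) (M : ℝ≥0∞) (u : List ℕ) (ω : List ℕ → ℕ → E) (ξ : ℕ → E) :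
    clashCount R ρ M u (Function.update ω u ξ) = clashCount R ρ M u ω := by
  have h := update_agree ω u ξ
  have hk : knownCount R (Function.update ω u ξ) u = knownCount R ω u := by
    classical
    exact tsum_congr fun v => if_congr (known_congr h) rfl rfl
  funext y
  classical
  refine if_congr (and_congr (desc_congr h le_rfl) (by rw [hk])) (tsum_congr fun v => ?_) rfl
  by_cases hv : Known R (Function.update ω u ξ) u v
  · rw [if_pos hv, if_pos ((known_congr h).1 hv), pos_congr_of_known h hv, pos_congr h le_rfl]
  · rw [if_neg hv, if_neg fun hv' => hv ((known_congr h).2 hv')]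

variable {ρ : ℝ} {ε : ℝ≥0∞} (hε : ∀ x, ν (Metric.ball x ρ) ≤ ε)

omit [InnerProductSpace ℝ E] [SecondCountableTopology E] in
include hε in
theorem lintegral_near_le (x : E) : ∫⁻ y, (if ‖y - x‖ < ρ then 1 else 0) ∂ν ≤ ε := by
  refine le_trans (le_of_eq ?_) (hε x)
  rw [← lintegral_indicator_one measurableSet_ball]
  refine lintegral_congr fun y => ?_
  by_cases hy : ‖y - x‖ < ρ
  · rw [if_pos hy, Set.indicator_of_mem (by rwa [Metric.mem_ball, dist_eq_norm]), Pi.one_apply]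
  · rw [if_neg hy, Set.indicator_of_notMem (by rwa [Metric.mem_ball, dist_eq_norm])]

-- Each of at most `M` known words forbids two balls of radius `ρ`, around its point and around the
-- midpoint, each of measure at most `ε`.
omit [SecondCountableTopology E] in
include hε in
open Classical in
theorem lintegral_clashCount_le (R : ℝ) (M : ℝ≥0∞) (u : List ℕ) (ω : List ℕ → ℕ → E) :
    ∫⁻ y, clashCount R ρ M u ω y ∂ν ≤ if Desc R ω u then M * (2 * ε) else 0 := by
  have hnear : ∀ x : E, Measurable fun y : E => if ‖y - x‖ < ρ then (1 : ℝ≥0∞) else 0 := fun x =>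
    Measurable.ite (by
      have : {y : E | ‖y - x‖ < ρ} = Metric.ball x ρ := by ext y; simp [dist_eq_norm]
      rw [this]
      exact measurableSet_ball) measurable_const measurable_const
  by_cases h : Desc R ω u ∧ knownCount R ω u ≤ M
  · simp only [clashCount]
    rw [if_pos h.1]
    simp only [h, and_self, if_true]
    rw [lintegral_tsum fun v => by
      by_cases hv : Known R ω u v
      · simp only [hv, if_true]
        exact ((hnear _).add (hnear _)).aemeasurable
      · simp only [hv, if_false]
        exact aemeasurable_const]
    calc _ ≤ ∑' v, (if Known R ω u v then 1 else 0) * (2 * ε) := by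
          refine ENNReal.tsum_le_tsum fun v => ?_
          by_cases hv : Known R ω u v
          · simp only [hv, if_true]
            rw [lintegral_add_left (hnear _), one_mul, two_mul]
            exact add_le_add (lintegral_near_le hε _) (lintegral_near_le hε _)
          · simp [hv]
      _ = knownCount R ω u * (2 * ε) := ENNReal.tsum_mul_right
      _ ≤ M * (2 * ε) := by gcongr; exact h.2
  · simp only [clashCount, h, if_false, lintegral_zero]
    exact zero_le

theorem measurable_siblingClash (R ρ : ℝ) (u : List ℕ) :
    Measurable fun p : (List ℕ → ℕ → E) × E × E => siblingClash R ρ u p.1 p.2.1 p.2.2 := by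
  refine Measurable.ite ((measurable_fst (measurableSet_desc R u)).inter
    (MeasurableSet.inter ?_ ?_)) measurable_const measurable_const
  · exact measurableSet_lt measurable_snd.fst.norm measurable_const
  · exact measurableSet_lt (measurable_snd.snd.sub
      (measurable_snd.fst.const_smul (1 / 2 : ℝ))).norm measurable_const

omit [MeasurableSpace E] [BorelSpace E] [SecondCountableTopology E] in
theorem siblingClash_update (R ρ : ℝ) (u : List ℕ) (ω : List ℕ → ℕ → E) (ξ : ℕ → E) :
    siblingClash R ρ u (Function.update ω u ξ) = siblingClash R ρ u ω := by
  funext y y'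
  classical
  exact if_congr (and_congr_left' (desc_congr (update_agree ω u ξ) le_rfl)) rfl rfl

-- The first sibling ranges over the ball of radius `R`; given it, the second is confined to a ball
-- of radius `ρ`.
omit [SecondCountableTopology E] in
include hε in
open Classical in
theorem lintegral_siblingClash_le (R : ℝ) (u : List ℕ) (ω : List ℕ → ℕ → E) :
    ∫⁻ y, ∫⁻ y', siblingClash R ρ u ω y y' ∂ν ∂ν ≤
      if Desc R ω u then ε * ν (Metric.ball 0 R) else 0 := by
  by_cases h : Desc R ω u
  · rw [if_pos h]
    calc _ ≤ ∫⁻ y, (Metric.ball (0 : E) R).indicator (fun _ => ε) y ∂ν := by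
          refine lintegral_mono fun y => ?_
          by_cases hy : ‖y‖ < R
          · rw [Set.indicator_of_mem (by simpa using hy)]
            simp only [siblingClash, h, hy, true_and]
            exact lintegral_near_le hε _
          · simp [siblingClash, hy]
      _ = _ := by
          rw [lintegral_indicator measurableSet_ball, setLIntegral_const]
  · simp [siblingClash, h]

variable (hQ : IsSortedPoissonLaw ν τ Q)

omit [InnerProductSpace ℝ E] [SecondCountableTopology E] [IsProbabilityMeasure Q] in
open Classical in
theorem tsum_lintegral_desc (R : ℝ) (a : ℝ≥0∞) :
    ∑' u, ∫⁻ ω, (if Desc R ω u then a else 0) ∂(Measure.infinitePi fun _ : List ℕ => Q) =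
      a * ∑' u, (Measure.infinitePi fun _ : List ℕ => Q) {ω | Desc R ω u} := by
  rw [← ENNReal.tsum_mul_left]
  refine tsum_congr fun u => ?_
  rw [← lintegral_indicator_const (measurableSet_desc R u)]
  refine lintegral_congr fun ω => ?_
  simp only [Set.indicator_apply, Set.mem_ofPred_eq]

-- Three uses of Markov's inequality: at least `M` descending words, a clash with a known word while
-- at most `M` words are known, a clash of two siblings. Each expectation is a constant times the
-- expected number of descending words. The set on the left need not be measurable, since only
-- monotonicity and subadditivity are applied to it.
include hε hQ in
theorem measure_not_isSeparated_le {R : ℝ} (hρ : 0 < ρ) (hρR : ρ ^ 2 = 4 / 5 * R ^ 2) (hle : ρ ≤ R)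
    {M : ℝ≥0∞} (hM : M ≠ 0) (hM' : M ≠ ∞) :
    (Measure.infinitePi fun _ : List ℕ => Q) {ω | ¬ IsSeparated R ω} ≤
      (M⁻¹ + M * (2 * ε) + ε * ν (Metric.ball 0 R)) *
        ∑' u, (Measure.infinitePi fun _ : List ℕ => Q) {ω | Desc R ω u} := by
  classical
  set μ := Measure.infinitePi fun _ : List ℕ => Q
  set A : (List ℕ → ℕ → E) → ℝ≥0∞ := fun ω => ∑' u, ∑' j, clashCount R ρ M u ω (ω u j) with hA
  set B : (List ℕ → ℕ → E) → ℝ≥0∞ := fun ω => ∑' u, ∑' i, ∑' j,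
    if i ≠ j then siblingClash R ρ u ω (ω u i) (ω u j) else 0 with hB
  have hDm : Measurable fun ω : List ℕ → ℕ → E => descCount R ω :=
    Measurable.tsum fun v => Measurable.ite (measurableSet_desc R v) measurable_const
      measurable_const
  have hAm : ∀ u, Measurable fun ω : List ℕ → ℕ → E => ∑' j, clashCount R ρ M u ω (ω u j) :=
    fun u => Measurable.tsum fun j => (measurable_clashCount R ρ M u).comp
      (f := fun ω : List ℕ → ℕ → E => (ω, ω u j)) (by fun_prop)
  have hBm : ∀ u, Measurable fun ω : List ℕ → ℕ → E => ∑' i, ∑' j,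
      if i ≠ j then siblingClash R ρ u ω (ω u i) (ω u j) else 0 := by
    refine fun u => Measurable.tsum fun i => Measurable.tsum fun j => ?_
    split_ifs
    · exact (measurable_siblingClash R ρ u).comp
        (f := fun ω : List ℕ → ℕ → E => (ω, ω u i, ω u j)) (by fun_prop)
    · exact measurable_const
  have hDint : ∫⁻ ω, descCount R ω ∂μ = ∑' u, μ {ω | Desc R ω u} := by
    rw [← one_mul (∑' u, μ {ω | Desc R ω u}), ← tsum_lintegral_desc R 1]
    exact lintegral_tsum fun v => (Measurable.ite (measurableSet_desc R v) measurable_const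
      measurable_const).aemeasurable
  have hAint : ∫⁻ ω, A ω ∂μ ≤ M * (2 * ε) * ∑' u, μ {ω | Desc R ω u} := by
    rw [hA, lintegral_tsum fun u => (hAm u).aemeasurable, ← tsum_lintegral_desc R (M * (2 * ε))]
    refine ENNReal.tsum_le_tsum fun u => ?_
    rw [lintegral_tsum_children hQ u (measurable_clashCount R ρ M u) (clashCount_update R ρ M u)]
    exact lintegral_mono fun ω => lintegral_clashCount_le hε R M u ω
  have hBint : ∫⁻ ω, B ω ∂μ ≤ ε * ν (Metric.ball 0 R) * ∑' u, μ {ω | Desc R ω u} := by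
    rw [hB, lintegral_tsum fun u => (hBm u).aemeasurable,
      ← tsum_lintegral_desc R (ε * ν (Metric.ball 0 R))]
    refine ENNReal.tsum_le_tsum fun u => ?_
    rw [lintegral_tsum_siblings hQ u (measurable_siblingClash R ρ u) (siblingClash_update R ρ u)]
    exact lintegral_mono fun ω => lintegral_siblingClash_le hε R u ω
  -- `A` and `B` count clashes. When they are less than 1 there are none, and the cap in `A` is
  -- inactive because there are fewer than `M` descending words.
  have hsub : {ω | ¬ IsSeparated R ω} ⊆
      ({ω | M ≤ descCount R ω} ∪ {ω | 1 ≤ A ω}) ∪ {ω | 1 ≤ B ω} := by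
    intro ω hω
    by_contra hc
    simp only [Set.mem_union, Set.mem_ofPred_eq, not_or, not_le] at hc
    obtain ⟨⟨h1, h2⟩, h3⟩ := hc
    refine hω (isSeparated_of_avoids hρ hρR hle (fun u j v hj hv => ?_) fun u i j hij hi hj => ?_)
    · have hone : clashCount R ρ M u ω (ω u j) < 1 :=
        ((ENNReal.le_tsum j).trans (ENNReal.le_tsum (f := fun u =>
          ∑' j, clashCount R ρ M u ω (ω u j)) u)).trans_lt h2
      rw [clashCount, if_pos ⟨hj.1, (knownCount_le_descCount R ω u).trans h1.le⟩] at hone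
      have hone' := (ENNReal.le_tsum v).trans_lt hone
      rw [if_pos hv] at hone'
      by_contra hcon
      rw [not_and_or, not_le, not_le] at hcon
      rcases hcon with h | h
      · rw [if_pos h] at hone'
        exact (le_self_add.trans_lt hone').ne rfl
      · rw [if_pos h] at hone'
        exact (le_add_self.trans_lt hone').ne rfl
    · have hone : (if i ≠ j then siblingClash R ρ u ω (ω u i) (ω u j) else 0) < 1 :=
        ((ENNReal.le_tsum j).trans ((ENNReal.le_tsum (f := fun i => ∑' j,
          if i ≠ j then siblingClash R ρ u ω (ω u i) (ω u j) else 0) i).trans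
          (ENNReal.le_tsum (f := fun u => ∑' i, ∑' j,
          if i ≠ j then siblingClash R ρ u ω (ω u i) (ω u j) else 0) u))).trans_lt h3
      rw [if_pos hij] at hone
      by_contra hcon
      rw [siblingClash, if_pos ⟨hi.1, hi.2.trans_le (rad_le_of_desc hi.1), not_le.1 hcon⟩] at hone
      exact lt_irrefl _ hone
  have hD : μ {ω | M ≤ descCount R ω} ≤ M⁻¹ * ∑' u, μ {ω | Desc R ω u} := by
    refine (meas_ge_le_lintegral_div hDm.aemeasurable hM hM').trans ?_
    rw [hDint, ENNReal.div_eq_inv_mul]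
  have hA' : μ {ω | 1 ≤ A ω} ≤ M * (2 * ε) * ∑' u, μ {ω | Desc R ω u} := by
    refine (meas_ge_le_lintegral_div (Measurable.tsum hAm).aemeasurable one_ne_zero
      ENNReal.one_ne_top).trans ?_
    rwa [div_one]
  have hB' : μ {ω | 1 ≤ B ω} ≤ ε * ν (Metric.ball 0 R) * ∑' u, μ {ω | Desc R ω u} := by
    refine (meas_ge_le_lintegral_div (Measurable.tsum hBm).aemeasurable one_ne_zero
      ENNReal.one_ne_top).trans ?_
    rwa [div_one]
  rw [add_mul, add_mul]
  exact (measure_mono hsub).trans ((measure_union_le _ _).trans (add_le_add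
    ((measure_union_le _ _).trans (add_le_add hD hA')) hB'))

-- The expected number of descending words outside a large finite set is the tail of a convergent
-- series. This allows the exploration to stop after finitely many words.
omit [InnerProductSpace ℝ E] [BorelSpace E] [SecondCountableTopology E] [IsProbabilityMeasure Q] in
theorem exists_measure_desc_beyond_le {R : ℝ}
    (hfin : ∑' u, (Measure.infinitePi fun _ : List ℕ => Q) {ω : List ℕ → ℕ → E | Desc R ω u} ≠ ∞)
    {δ : ℝ≥0∞} (hδ : 0 < δ) :
    ∃ n, (Measure.infinitePi fun _ : List ℕ => Q)
      {ω : List ℕ → ℕ → E | ∃ u, n ≤ Encodable.encode u ∧ Desc R ω u} ≤ δ := by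
  have h := (tendsto_order.1 (ENNReal.tendsto_tsum_compl_atTop_zero hfin)).2 δ hδ
  obtain ⟨s, hs⟩ := h.exists
  obtain ⟨n, hn⟩ : ∃ n, ∀ u ∈ s, Encodable.encode u < n :=
    ⟨s.sup (fun u => Encodable.encode u + 1), fun u hu =>
      Nat.lt_of_succ_le (Finset.le_sup (f := fun u => Encodable.encode u + 1) hu)⟩
  refine ⟨n, le_trans (le_trans (measure_mono ?_) (measure_iUnion_le _)) hs.le⟩
  rintro ω ⟨u, hu, hd⟩
  exact Set.mem_iUnion.2 ⟨⟨u, fun hus => (hn u hus).not_ge hu⟩, hd⟩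

end BadEvents


/-! ### Agreement of the descending paths -/

section WordPaths

variable {E : Type*} [NormedAddCommGroup E] {R : ℝ} {ω : List ℕ → ℕ → E}

/-- `v 0, …, v k` is a path of descending words starting from the empty word. -/
structure IsWordPath (R : ℝ) (ω : List ℕ → ℕ → E) {k : ℕ} (v : Fin (k + 1) → List ℕ) : Prop where
  start : v 0 = []
  child : ∀ i : Fin k, ∃ j, v i.succ = j :: v i.castSucc
  desc : ∀ i, Desc R ω (v i)

theorem norm_pos_cons_sub (ω : List ℕ → ℕ → E) (j : ℕ) (u : List ℕ) :
    ‖pos ω (j :: u) - pos ω u‖ = rad R ω (j :: u) := by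
  rw [pos, add_sub_cancel_left, rad]

theorem IsWordPath.strictAnti_rad {k : ℕ} {v : Fin (k + 1) → List ℕ} (hv : IsWordPath R ω v) :
    StrictAnti fun i => rad R ω (v i) := by
  refine Fin.strictAnti_iff_succ_lt.2 fun i => ?_
  obtain ⟨j, hj⟩ := hv.child i
  have h := hv.desc i.succ
  rw [hj] at h ⊢
  exact h.2

theorem IsWordPath.injective {k : ℕ} {v : Fin (k + 1) → List ℕ} (hv : IsWordPath R ω v) :
    Function.Injective v := fun i j h =>
  hv.strictAnti_rad.injective (by simp only [h])

theorem IsWordPath.rad_succ_lt {k : ℕ} {v : Fin (k + 1) → List ℕ} (hv : IsWordPath R ω v)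
    (i : Fin k) : rad R ω (v i.succ) < R := by
  have h := hv.strictAnti_rad (Fin.succ_pos i)
  simpa only [hv.start, rad] using h

theorem Desc.drop {w : List ℕ} (hw : Desc R ω w) (m : ℕ) : Desc R ω (w.drop m) := by
  induction m generalizing w with
  | zero => exact hw
  | succ m ih =>
    rcases w with _ | ⟨j, u⟩
    · exact hw
    · exact ih hw.1

theorem exists_isWordPath {w : List ℕ} (hw : Desc R ω w) :
    ∃ (k : ℕ) (v : Fin (k + 1) → List ℕ), IsWordPath R ω v ∧ v (Fin.last k) = w := by
  -- The path runs through the ancestors of `w`, which are its suffixes, since new letters are put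
  -- in front.
  refine ⟨w.length, fun i => w.drop (w.length - i), ⟨?_, fun i => ?_, fun i => hw.drop _⟩, ?_⟩
  · simp
  · have hi := i.2
    refine ⟨w[w.length - (i + 1)], ?_⟩
    rw [Fin.val_succ, Fin.val_castSucc, List.drop_eq_getElem_cons (by omega)]
    congr 2
    omega
  · simp

theorem IsWordPath.isDescendingTreePath {f : ℝ → ℝ} (hf : StrictMonoOn f (Set.Ici 0))
    (hR : 0 ≤ R) {t : List ℕ → ℕ → ℝ} (ht : ∀ v j, t v j = f ‖ω v.reverse j‖) {k : ℕ}
    {v : Fin (k + 1) → List ℕ} (hv : IsWordPath R ω v) :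
    IsDescendingTreePath t (f R) (fun i => (v i).reverse) ∧
      ∀ i : Fin k, edgeWeight t (v i.castSucc).reverse (v i.succ).reverse =
        f (rad R ω (v i.succ)) := by
  have hw : ∀ i : Fin k, edgeWeight t (v i.castSucc).reverse (v i.succ).reverse =
      f (rad R ω (v i.succ)) := by
    intro i
    obtain ⟨j, hj⟩ := hv.child i
    rw [hj, List.reverse_cons, edgeWeight_child, ht, List.reverse_reverse, rad]
  have hn : ∀ u : List ℕ, rad R ω u ∈ Set.Ici 0 := fun u => rad_nonneg hR ω u
  refine ⟨⟨by rw [hv.start]; rfl, fun i => ?_, fun i => ?_, fun i i' h => ?_⟩, hw⟩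
  · obtain ⟨j, hj⟩ := hv.child i
    exact ⟨j, by rw [hj, List.reverse_cons]⟩
  · rw [hw]
    exact hf (hn _) hR (hv.rad_succ_lt i)
  · simp only [hw]
    exact hf (hn _) (hn _) (hv.strictAnti_rad (Fin.succ_lt_succ_iff.2 h))

theorem isWordPath_of_isDescendingTreePath {f : ℝ → ℝ} (hf : StrictMonoOn f (Set.Ici 0))
    (hR : 0 ≤ R) {t : List ℕ → ℕ → ℝ} (ht : ∀ v j, t v j = f ‖ω v.reverse j‖) {k : ℕ}
    {v : Fin (k + 1) → List ℕ} (hv : IsDescendingTreePath t (f R) fun i => (v i).reverse) :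
    IsWordPath R ω v := by
  have hstart : v 0 = [] := List.reverse_eq_nil_iff.1 hv.start
  have hchild : ∀ i : Fin k, ∃ j, v i.succ = j :: v i.castSucc := by
    intro i
    obtain ⟨j, hj⟩ := hv.child i
    refine ⟨j, ?_⟩
    rw [← List.reverse_reverse (v i.succ), hj]
    simp
  have hw : ∀ i : Fin k, edgeWeight t (v i.castSucc).reverse (v i.succ).reverse =
      f (rad R ω (v i.succ)) := by
    intro i
    obtain ⟨j, hj⟩ := hchild i
    rw [hj, List.reverse_cons, edgeWeight_child, ht, List.reverse_reverse, rad]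
  have hn : ∀ u : List ℕ, rad R ω u ∈ Set.Ici 0 := fun u => rad_nonneg hR ω u
  refine ⟨hstart, hchild, fun i => ?_⟩
  induction i using Fin.induction with
  | zero => rw [hstart]; trivial
  | succ i ih =>
    have hlt : rad R ω (v i.succ) < rad R ω (v i.castSucc) := by
      rw [← hf.lt_iff_lt (hn _) (hn _), ← hw]
      -- The first edge is compared with `R`, the radius of the root, and a later edge with the
      -- preceding one.
      rcases Fin.eq_zero_or_eq_succ i.castSucc with h | ⟨i', h⟩
      · have h1 := hv.lt i
        rw [h, hstart] at h1 ⊢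
        exact h1
      · have h1 : i' < i := by
          rw [← Fin.castSucc_lt_castSucc_iff, h]
          exact Fin.castSucc_lt_succ
        have h2 := hv.descending h1
        simp only at h2
        rw [hw i'] at h2
        rwa [h] at h2 ⊢
    obtain ⟨j, hj⟩ := hchild i
    rw [hj] at hlt ⊢
    exact ⟨ih, hlt⟩

theorem descendingVertices_eq {f : ℝ → ℝ} (hf : StrictMonoOn f (Set.Ici 0))
    (hR : 0 ≤ R) {t : List ℕ → ℕ → ℝ} (ht : ∀ v j, t v j = f ‖ω v.reverse j‖) :
    descendingVertices t (f R) = List.reverse '' {w | Desc R ω w} := by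
  ext w
  constructor
  · rintro ⟨k, v, hv, i, rfl⟩
    refine ⟨(v i).reverse, ?_, List.reverse_reverse _⟩
    have h : IsWordPath R ω fun i => (v i).reverse :=
      isWordPath_of_isDescendingTreePath hf hR ht (by simpa using hv)
    exact h.desc i
  · rintro ⟨u, hu, rfl⟩
    obtain ⟨k, v, hv, rfl⟩ := exists_isWordPath hu
    exact ⟨k, _, (hv.isDescendingTreePath hf hR ht).1, Fin.last k, rfl⟩

end WordPaths

/-! ### From separated words to agreement of the paths -/

section Agreement

variable {d : ℕ} {R : ℝ} {ω : List ℕ → ℕ → EuclideanSpace ℝ (Fin d)}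
  {S : Set (EuclideanSpace ℝ (Fin d))}

theorem IsSeparated.pos_injOn (hsep : IsSeparated R ω) :
    Set.InjOn (pos ω) {w | Desc R ω w} := fun v hv w hw h => by
  by_contra hne
  exact (hsep v w hv hw hne).1 h

theorem IsWordPath.isDescendingPath (hsep : IsSeparated R ω)
    (hmem : ∀ w, Desc R ω w → pos ω w ∈ S) {k : ℕ} {v : Fin (k + 1) → List ℕ}
    (hv : IsWordPath R ω v) :
    IsDescendingPath S R (fun i => pos ω (v i)) ∧
      ∀ i : Fin k, dist (pos ω (v i.castSucc)) (pos ω (v i.succ)) = rad R ω (v i.succ) := by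
  have hd : ∀ i : Fin k, dist (pos ω (v i.castSucc)) (pos ω (v i.succ)) = rad R ω (v i.succ) := by
    intro i
    obtain ⟨j, hj⟩ := hv.child i
    rw [dist_comm, dist_eq_norm, hj, norm_pos_cons_sub]
  refine ⟨⟨by rw [hv.start, pos], fun i => hmem _ (hv.desc i), fun i j h => ?_, fun i => ?_,
    fun i j h => ?_⟩, hd⟩
  · exact hv.injective (hsep.pos_injOn (hv.desc i) (hv.desc j) h)
  · rw [hd]
    exact hv.rad_succ_lt i
  · simp only [hd]
    exact hv.strictAnti_rad (Fin.succ_lt_succ_iff.2 h)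

/-- The path is lifted step by step: the next point lies in the ball of the current word, so by
`hball` it is the point of a descending word, and by separation that word is a child of the current
one. -/
theorem exists_isWordPath_of_isDescendingPath (hsep : IsSeparated R ω)
    (hball : ∀ v, Desc R ω v → ∀ y ∈ S, ‖y - pos ω v‖ < rad R ω v → ∃ w, Desc R ω w ∧ pos ω w = y)
    {k : ℕ} {y : Fin (k + 1) → EuclideanSpace ℝ (Fin d)} (hy : IsDescendingPath S R y) :
    ∃ v, IsWordPath R ω v ∧ y = fun i => pos ω (v i) := by
  have hstep : ∀ (i : Fin k) (w : List ℕ), Desc R ω w → pos ω w = y i.castSucc →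
      (i.castSucc = 0 → w = []) →
      (∀ i' : Fin k, i'.succ = i.castSucc → rad R ω w = dist (y i'.castSucc) (y i'.succ)) →
      ‖y i.succ - pos ω w‖ < rad R ω w := by
    intro i w hw hpos h0 hrad
    rw [hpos, ← dist_eq_norm, dist_comm]
    rcases Fin.eq_zero_or_eq_succ i.castSucc with h | ⟨i', h⟩
    · rw [h0 h, rad]
      exact hy.lt i
    · rw [hrad i' h.symm]
      refine hy.descending ?_
      rw [← Fin.castSucc_lt_castSucc_iff, h]
      exact Fin.castSucc_lt_succ
  have hchild : ∀ (i : Fin k) (w w' : List ℕ), Desc R ω w → Desc R ω w' → pos ω w = y i.castSucc →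
      pos ω w' = y i.succ → ‖y i.succ - pos ω w‖ < rad R ω w → ∃ j, w' = j :: w := by
    intro i w w' hw hw' hpos hpos' hlt
    rw [← hpos'] at hlt
    refine (hsep w w' hw hw' fun h => ?_).2 hlt
    have h1 : i.castSucc = i.succ := hy.distinct (by rw [← hpos, ← hpos', h])
    exact Fin.castSucc_lt_succ.ne h1
  -- The induction also carries that the radius of the word is the length of the last step (the word
  -- being empty at the start), since this is what turns the decrease of the steps into membership
  -- in the ball.
  have hex : ∀ i, ∃ w, Desc R ω w ∧ pos ω w = y i ∧ (i = 0 → w = []) ∧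
      ∀ i' : Fin k, i'.succ = i → rad R ω w = dist (y i'.castSucc) (y i'.succ) := by
    intro i
    induction i using Fin.induction with
    | zero => exact ⟨[], trivial, hy.start.symm, fun _ => rfl, fun i' h => absurd h (Fin.succ_ne_zero _)⟩
    | succ i ih =>
      obtain ⟨w, hw, hpos, h0, hrad⟩ := ih
      have hlt := hstep i w hw hpos h0 hrad
      obtain ⟨w', hw', hpos'⟩ := hball w hw _ (hy.mem i.succ) hlt
      refine ⟨w', hw', hpos', fun h => absurd h (Fin.succ_ne_zero _), fun i' h => ?_⟩
      obtain rfl := Fin.succ_injective _ h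
      obtain ⟨j, rfl⟩ := hchild i' w w' hw hw' hpos hpos' hlt
      rw [← hpos, ← hpos', dist_comm, dist_eq_norm, norm_pos_cons_sub]
  choose v hv hpos h0 hrad using hex
  refine ⟨v, ⟨h0 0 rfl, fun i => ?_, hv⟩, funext fun i => (hpos i).symm⟩
  exact hchild i _ _ (hv _) (hv _) (hpos _) (hpos _)
    (hstep i _ (hv _) (hpos _) (h0 _) (hrad _))

theorem descendingPoints_eq (hsep : IsSeparated R ω) (hmem : ∀ w, Desc R ω w → pos ω w ∈ S)
    (hball : ∀ v, Desc R ω v → ∀ y ∈ S, ‖y - pos ω v‖ < rad R ω v → ∃ w, Desc R ω w ∧ pos ω w = y) :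
    descendingPoints S R = pos ω '' {w | Desc R ω w} := by
  ext z
  constructor
  · rintro ⟨k, y, hy, i, rfl⟩
    obtain ⟨v, hv, rfl⟩ := exists_isWordPath_of_isDescendingPath hsep hball hy
    exact ⟨v i, hv.desc i, rfl⟩
  · rintro ⟨u, hu, rfl⟩
    obtain ⟨k, v, hv, rfl⟩ := exists_isWordPath hu
    exact ⟨k, _, (hv.isDescendingPath hsep hmem).1, Fin.last k, rfl⟩

theorem exists_isAgreement {κ : Type*} {x : ℕ → EuclideanSpace ℝ (Fin d)} {c : ℕ → κ}
    {t : List ℕ → ℕ → ℝ} {c' : List ℕ → κ} (hf : StrictMonoOn (ballVolume d) (Set.Ici 0))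
    (hR : 0 ≤ R) (ht : ∀ v j, t v j = ballVolume d ‖ω v.reverse j‖)
    (hsep : IsSeparated R ω) (hmem : ∀ w, Desc R ω w → pos ω w ∈ Set.range x)
    (hball : ∀ v, Desc R ω v → ∀ y ∈ Set.range x, ‖y - pos ω v‖ < rad R ω v →
      ∃ w, Desc R ω w ∧ pos ω w = y)
    (hcol : ∀ n w, Desc R ω w → pos ω w = x n → c' w.reverse = c n) :
    ∃ φ, IsAgreement R (ballVolume d R) x c t c' φ := by
  classical
  have hinv : ∀ w, Desc R ω w → Function.invFunOn (pos ω) {w | Desc R ω w} (pos ω w) = w :=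
    fun w hw => hsep.pos_injOn.leftInvOn_invFunOn hw
  have hP := descendingPoints_eq hsep hmem hball
  have hV := descendingVertices_eq hf hR ht
  -- The bijection inverts `pos` on descending words and reverses the word, as children are formed
  -- at the head here but at the end in the tree.
  refine ⟨fun y => (Function.invFunOn (pos ω) {w | Desc R ω w} y).reverse, ?_, ?_, ?_, ?_⟩
  · rw [hP, hV]
    refine ⟨?_, ?_, ?_⟩
    · rintro _ ⟨w, hw, rfl⟩
      exact ⟨w, hw, by simp only [hinv w hw]⟩
    · rintro _ ⟨w, hw, rfl⟩ _ ⟨w', hw', rfl⟩ h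
      simp only [hinv w hw, hinv w' hw', List.reverse_inj] at h
      rw [h]
    · rintro _ ⟨w, hw, rfl⟩
      exact ⟨pos ω w, ⟨w, hw, rfl⟩, by simp only [hinv w hw]⟩
  · intro n hn
    rw [hP] at hn
    obtain ⟨w, hw, hwn⟩ := hn
    rw [← hwn, hinv w hw]
    exact hcol n w hw hwn
  · intro k y hy
    have hy' : ∀ i, ∃ w, Desc R ω w ∧ pos ω w = y i := fun i => by
      have h := hy i
      rw [hP] at h
      exact h
    choose w hw hwy using hy'
    obtain rfl : (fun i => pos ω (w i)) = y := funext hwy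
    simp only [hinv _ (hw _)]
    constructor
    · intro h
      obtain ⟨v, hv, hvy⟩ := exists_isWordPath_of_isDescendingPath hsep hball h
      obtain rfl : w = v := funext fun i =>
        hsep.pos_injOn (hw i) (hv.desc i) (congrFun hvy i)
      exact (hv.isDescendingTreePath hf hR ht).1
    · intro h
      exact ((isWordPath_of_isDescendingTreePath hf hR ht h).isDescendingPath hsep hmem).1
  · intro k y hy i
    obtain ⟨v, hv, rfl⟩ := exists_isWordPath_of_isDescendingPath hsep hball hy
    simp only [hinv _ (hv.desc _)]
    rw [(hv.isDescendingTreePath hf hR ht).2, (hv.isDescendingPath hsep hmem).2]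

end Agreement


/-! ### Colours read off along a random injection -/

section Colours

variable {Ω ι ι' κ Y : Type*} [MeasurableSpace Ω] [MeasurableSpace κ] [MeasurableSpace Y]
  [Countable ι] {P : Measure Ω} [IsProbabilityMeasure P] {p : PMF κ} {σ : Ω → ι' → ι}

theorem measurable_reindex (hσm : ∀ i' i, MeasurableSet {a | σ a i' = i}) :
    Measurable fun q : Ω × (ι → κ) => fun i' => q.2 (σ q.1 i') := by
  let _ : MeasurableSpace ι := ⊤
  refine measurable_pi_lambda _ fun i' => ?_
  have h1 : Measurable fun a => σ a i' := measurable_to_countable' fun i => hσm i' i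
  have h2 : Measurable fun q : ι × (ι → κ) => q.2 q.1 :=
    measurable_from_prod_countable_right fun i => measurable_pi_apply i
  exact h2.comp ((h1.comp measurable_fst).prodMk measurable_snd)

/-- For fixed `a` the labels read along the injection `σ a` are i.i.d., and their law does not
depend on `a`; integrating over `a` therefore gives a product measure. -/
theorem map_reindex_prodMk (hσm : ∀ i' i, MeasurableSet {a | σ a i' = i})
    (hσ : ∀ᵐ a ∂P, Function.Injective (σ a)) {X : Ω → Y} (hX : Measurable X) :
    (P.prod (Measure.infinitePi fun _ : ι => p.toMeasure)).map
      (fun q => ((fun i' => q.2 (σ q.1 i') : ι' → κ), X q.1)) =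
      (Measure.infinitePi fun _ : ι' => p.toMeasure).prod (P.map X) := by
  have hm : Measurable fun q : Ω × (ι → κ) => ((fun i' => q.2 (σ q.1 i') : ι' → κ), X q.1) :=
    (measurable_reindex hσm).prodMk (hX.comp measurable_fst)
  have := Measure.isProbabilityMeasure_map (μ := P) hX.aemeasurable
  ext s hs
  rw [Measure.map_apply hm hs, Measure.prod_apply (hm hs), Measure.prod_apply_symm hs,
    lintegral_map (measurable_measure_prodMk_right hs) hX]
  refine lintegral_congr_ae ?_
  filter_upwards [hσ] with a ha
  rw [← Measure.map_infinitePi_infinitePi_of_inj (P := fun _ : ι => p.toMeasure) ha,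
    Measure.map_apply (by fun_prop) (measurable_prodMk_right hs)]
  rfl

theorem isIID_indepFun_reindex (hσm : ∀ i' i, MeasurableSet {a | σ a i' = i})
    (hσ : ∀ᵐ a ∂P, Function.Injective (σ a)) {X : Ω → Y} (hX : Measurable X) :
    IsIID (P.prod (Measure.infinitePi fun _ : ι => p.toMeasure)) p
        (fun i' q => q.2 (σ q.1 i')) ∧
      IndepFun (fun q i' => q.2 (σ q.1 i')) (fun q => X q.1)
        (P.prod (Measure.infinitePi fun _ : ι => p.toMeasure)) := by
  have hc := measurable_reindex (κ := κ) hσm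
  have hc' : ∀ i', Measurable fun q : Ω × (ι → κ) => q.2 (σ q.1 i') := fun i' =>
    (measurable_pi_apply i').comp hc
  have hX' : Measurable fun q : Ω × (ι → κ) => X q.1 := hX.comp measurable_fst
  have := Measure.isProbabilityMeasure_map (μ := P) hX.aemeasurable
  have hjoint := map_reindex_prodMk (p := p) hσm hσ hX
  have h1 : (P.prod (Measure.infinitePi fun _ : ι => p.toMeasure)).map
      (fun q i' => q.2 (σ q.1 i')) = Measure.infinitePi fun _ : ι' => p.toMeasure := by
    have h := congrArg (Measure.map Prod.fst) hjoint
    rw [Measure.map_map measurable_fst (hc.prodMk hX'), ← Measure.fst, Measure.fst_prod] at h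
    exact h
  have h2 : (P.prod (Measure.infinitePi fun _ : ι => p.toMeasure)).map (fun q => X q.1) =
      P.map X := by
    have h := congrArg (Measure.map Prod.snd) hjoint
    rw [Measure.map_map measurable_snd (hc.prodMk hX'), ← Measure.snd, Measure.snd_prod] at h
    exact h
  have hlaw : ∀ i', (P.prod (Measure.infinitePi fun _ : ι => p.toMeasure)).map
      (fun q => q.2 (σ q.1 i')) = p.toMeasure := by
    intro i'
    have h := congrArg (Measure.map (Function.eval i')) h1
    rw [Measure.map_map (measurable_pi_apply i') hc, Measure.infinitePi_map_eval] at h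
    exact h
  refine ⟨⟨hc', hlaw, ?_⟩, ?_⟩
  · rw [iIndepFun_iff_map_fun_eq_infinitePi_map hc', h1]
    simp_rw [hlaw]
  · rw [indepFun_iff_map_prod_eq_prod_map_map hc.aemeasurable hX'.aemeasurable, h1, h2]
    exact hjoint

end Colours

/-! ### The configuration -/

section Configuration

variable {E : Type*} [NormedAddCommGroup E]

/-- The point of a vertex or of a term of the additional sequence. -/
def place (q : (List ℕ → ℕ → E) × (ℕ → E)) : List ℕ ⊕ ℕ → E :=
  Sum.elim (pos q.1) q.2

/-- The vertex of a candidate point. -/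
def vertexIdx : (List ℕ × ℕ) ⊕ ℕ → List ℕ ⊕ ℕ :=
  Sum.map (fun i => i.2 :: i.1) id

theorem place_vertexIdx (q : (List ℕ → ℕ → E) × (ℕ → E)) (i : (List ℕ × ℕ) ⊕ ℕ) :
    place q (vertexIdx i) = candidate q i := by
  rcases i with i | j <;> rfl

theorem vertexIdx_injective : Function.Injective vertexIdx :=
  Function.Injective.sumMap (fun i j h => by
    obtain ⟨h1, h2⟩ := List.cons.inj h
    exact Prod.ext h2 h1) Function.injective_id

theorem vertexIdx_ne_root (i : (List ℕ × ℕ) ⊕ ℕ) : vertexIdx i ≠ Sum.inl [] := by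
  rcases i with i | j <;> simp [vertexIdx]

/-- The origin followed by the kept candidates. -/
noncomputable def configIdx (R : ℝ) (n : ℕ) (q : (List ℕ → ℕ → E) × (ℕ → E)) : ℕ → List ℕ ⊕ ℕ
  | 0 => Sum.inl []
  | m + 1 => vertexIdx (keptIdx R n q m)

theorem configIdx_injective {R : ℝ} {n : ℕ} {q : (List ℕ → ℕ → E) × (ℕ → E)}
    (hinf : (keptCodes R n q).Infinite) : Function.Injective (configIdx R n q) := by
  rintro (_ | a) (_ | b) h
  · rfl
  · exact absurd h.symm (vertexIdx_ne_root _)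
  · exact absurd h (vertexIdx_ne_root _)
  · rw [keptIdx_injective hinf (vertexIdx_injective h)]

theorem measurableSet_configIdx_eq [MeasurableSpace E] [BorelSpace E]
    [SecondCountableTopology E] (R : ℝ) (n m : ℕ) (i : List ℕ ⊕ ℕ) :
    MeasurableSet {q : (List ℕ → ℕ → E) × (ℕ → E) | configIdx R n q m = i} := by
  rcases m with _ | m
  · exact MeasurableSet.const (Sum.inl [] = i)
  · exact measurable_keptIdx R n m (t := {k | vertexIdx k = i}) trivial

theorem measurable_place_configIdx [MeasurableSpace E] [BorelSpace E]
    [SecondCountableTopology E] (R : ℝ) (n m : ℕ) :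
    Measurable fun q : (List ℕ → ℕ → E) × (ℕ → E) => place q (configIdx R n q m) := by
  rcases m with _ | m
  · exact measurable_const
  · simp only [configIdx, place_vertexIdx]
    exact measurable_keptPoint R n m

variable {R : ℝ} {n : ℕ} {q : (List ℕ → ℕ → E) × (ℕ → E)}

/-- No descending word is discarded: if the point of `j :: u` had been searched on behalf of an
earlier `v`, then by separation `v` would be its parent `u`. -/
theorem exists_configIdx_eq (hinf : (keptCodes R n q).Infinite) (hsep : IsSeparated R q.1)
    (hlt : ∀ u, Desc R q.1 u → Encodable.encode u < n) {w : List ℕ} (hw : Desc R q.1 w) :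
    ∃ m, configIdx R n q m = Sum.inl w := by
  rcases w with _ | ⟨j, u⟩
  · exact ⟨0, rfl⟩
  · have hk : IsKept R n q (Sum.inl (u, j)) := by
      refine ⟨mem_wordsBefore.2 (hlt u hw.1), ⟨hw.1, ?_⟩, ?_⟩
      · rw [norm_pos_cons_sub (R := R)]
        exact hw.2
      · rintro ⟨v, hv, hdv, hlv⟩
        rw [mem_wordsBefore] at hv
        -- Codes increase from `v` to `u` to `j :: u`.
        have hne : v ≠ j :: u := by
          rintro rfl
          exact (hv.trans (encode_lt_encode_cons j u)).ne rfl
        obtain ⟨i, hi⟩ := (hsep v _ hdv hw hne).2 hlv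
        rw [(List.cons.inj hi).2] at hv
        exact hv.ne rfl
    obtain ⟨m, hm⟩ := exists_keptIdx_eq hinf hk
    exact ⟨m + 1, by rw [configIdx, hm]; rfl⟩

/-- A kept child lies in the ball of a descending parent, which is what it means for the child to
descend; the kept terms of the additional sequence lie outside the explored region. -/
theorem configIdx_cases (hinf : (keptCodes R n q).Infinite) (m : ℕ) :
    (∃ w, Desc R q.1 w ∧ configIdx R n q m = Sum.inl w) ∨
      place q (configIdx R n q m) ∉ explBefore R q.1 n := by
  rcases m with _ | m
  · exact Or.inl ⟨[], trivial, rfl⟩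
  · have h := isKept_keptIdx hinf m
    rw [configIdx, place_vertexIdx]
    rcases hk : keptIdx R n q m with ⟨u, j⟩ | j
    · rw [hk] at h
      have h1 : pos q.1 (j :: u) ∈ expl R q.1 u := h.2.1
      refine Or.inl ⟨j :: u, ⟨h1.1, ?_⟩, rfl⟩
      have h2 := h1.2
      rwa [norm_pos_cons_sub (R := R)] at h2
    · rw [hk] at h
      exact Or.inr h

/-- All descending words have been explored, so their balls contain no terms of the additional
sequence. -/
theorem exists_desc_pos_eq_of_norm_sub_lt (hinf : (keptCodes R n q).Infinite)
    (hlt : ∀ u, Desc R q.1 u → Encodable.encode u < n) {v : List ℕ} (hv : Desc R q.1 v) {m : ℕ}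
    (hm : ‖place q (configIdx R n q m) - pos q.1 v‖ < rad R q.1 v) :
    ∃ w, Desc R q.1 w ∧ pos q.1 w = place q (configIdx R n q m) := by
  rcases configIdx_cases hinf m with ⟨w, hw, h⟩ | h
  · exact ⟨w, hw, by rw [h]; rfl⟩
  · exact absurd ⟨v, mem_wordsBefore.2 (hlt v hv), hv, hm⟩ h

theorem pos_mem_explBefore (hR : 0 < R) (hlt : ∀ u, Desc R q.1 u → Encodable.encode u < n)
    {w : List ℕ} (hw : Desc R q.1 w) : pos q.1 w ∈ explBefore R q.1 n := by
  rcases w with _ | ⟨j, u⟩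
  · refine ⟨[], mem_wordsBefore.2 (hlt _ hw), trivial, ?_⟩
    rwa [sub_self, norm_zero, rad]
  · refine ⟨u, mem_wordsBefore.2 (hlt _ hw.1), hw.1, ?_⟩
    rw [norm_pos_cons_sub (R := R)]
    exact hw.2

/-- Colours are attached to indices, so equality of points has to be lifted to equality of indices.
Descending words have distinct points by separation, and additional terms avoid the explored region,
which contains the points of all descending words. -/
theorem configIdx_eq_of_pos_eq (hR : 0 < R) (hinf : (keptCodes R n q).Infinite)
    (hsep : IsSeparated R q.1) (hlt : ∀ u, Desc R q.1 u → Encodable.encode u < n) {w : List ℕ}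
    (hw : Desc R q.1 w) {m : ℕ} (hm : pos q.1 w = place q (configIdx R n q m)) :
    configIdx R n q m = Sum.inl w := by
  rcases configIdx_cases hinf m with ⟨w', hw', h⟩ | h
  · rw [h] at hm ⊢
    by_contra hne
    exact (hsep w w' hw hw' fun e => hne (by rw [e])).1 hm
  · rw [← hm] at h
    exact absurd (pos_mem_explBefore hR hlt hw) h

end Configuration

section EuclideanConfiguration

variable {d : ℕ} {R : ℝ} {n : ℕ}
  {q : (List ℕ → ℕ → EuclideanSpace ℝ (Fin d)) × (ℕ → EuclideanSpace ℝ (Fin d))}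

theorem exists_isAgreement_configuration {κ : Type*}
    (hf : StrictMonoOn (ballVolume d) (Set.Ici 0)) (hR : 0 < R)
    (hinf : (keptCodes R n q).Infinite) (hsep : IsSeparated R q.1)
    (hlt : ∀ u, Desc R q.1 u → Encodable.encode u < n) (col : List ℕ ⊕ ℕ → κ) :
    ∃ φ, IsAgreement R (ballVolume d R) (fun m => place q (configIdx R n q m))
      (fun m => col (configIdx R n q m)) (fun v j => ballVolume d ‖q.1 v.reverse j‖)
      (fun v => col (Sum.inl v.reverse)) φ := by
  refine exists_isAgreement hf hR.le (fun _ _ => rfl) hsep (fun w hw => ?_) ?_ ?_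
  · obtain ⟨m, hm⟩ := exists_configIdx_eq hinf hsep hlt hw
    exact ⟨m, by simp only [hm]; rfl⟩
  · rintro v hv _ ⟨m, rfl⟩ hlt'
    exact exists_desc_pos_eq_of_norm_sub_lt hinf hlt hv hlt'
  · intro m w hw hm
    simp only [List.reverse_reverse]
    rw [configIdx_eq_of_pos_eq hR hinf hsep hlt hw hm]

end EuclideanConfiguration


/-! ### Volumes of balls -/

section BallVolume

variable {d : ℕ} (hd : 0 < d)

theorem unitBallVolume_pos (d : ℕ) : 0 < unitBallVolume d := by
  have := Real.pi_pos
  exact div_pos (by positivity) (Real.Gamma_pos_of_pos (by positivity))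

include hd in
theorem ballVolume_zero : ballVolume d 0 = 0 := by
  rw [ballVolume, zero_pow hd.ne', mul_zero]

include hd in
theorem strictMonoOn_ballVolume : StrictMonoOn (ballVolume d) (Set.Ici 0) := fun _ ha _ _ hab =>
  mul_lt_mul_of_pos_left (pow_lt_pow_left₀ hab ha hd.ne') (unitBallVolume_pos d)

theorem measurable_ballVolume (d : ℕ) : Measurable (ballVolume d) := by
  unfold ballVolume
  fun_prop

include hd in
theorem exists_ballVolume_eq {a : ℝ} (ha : 0 ≤ a) : ∃ r, 0 ≤ r ∧ ballVolume d r = a := by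
  have hpos := unitBallVolume_pos d
  refine ⟨(a / unitBallVolume d) ^ ((d : ℝ)⁻¹), by positivity, ?_⟩
  rw [ballVolume, Real.rpow_inv_natCast_pow (by positivity) hd.ne']
  field_simp

include hd in
theorem volume_ball_eq_ballVolume (x : EuclideanSpace ℝ (Fin d)) {r : ℝ} (hr : 0 ≤ r) :
    volume (Metric.ball x r) = ENNReal.ofReal (ballVolume d r) := by
  have : Nonempty (Fin d) := ⟨⟨0, hd⟩⟩
  rw [EuclideanSpace.volume_ball, Fintype.card_fin, ← ENNReal.ofReal_pow hr,
    ← ENNReal.ofReal_mul (by positivity), ballVolume, unitBallVolume, mul_comm]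
  congr 3
  · rw [Real.sqrt_eq_rpow, ← Real.rpow_mul_natCast Real.pi_pos.le]
    congr 1
    ring
  · rw [add_comm]

-- It suffices to compare half-lines (-∞, a), whose preimage is the ball of volume `a` when a ≥ 0,
-- and empty when a ≤ 0.
include hd in
theorem map_ballVolume_norm :
    (volume : Measure (EuclideanSpace ℝ (Fin d))).map (fun y => ballVolume d ‖y‖) =
      volume.restrict (Set.Ici 0) := by
  have hm : Measurable fun y : EuclideanSpace ℝ (Fin d) => ballVolume d ‖y‖ :=
    (measurable_ballVolume d).comp measurable_norm
  have hf := strictMonoOn_ballVolume hd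
  have hIio : ∀ a : ℝ, (volume : Measure (EuclideanSpace ℝ (Fin d))).map
      (fun y => ballVolume d ‖y‖) (Set.Iio a) = ENNReal.ofReal a := by
    intro a
    rw [Measure.map_apply hm measurableSet_Iio]
    rcases le_total a 0 with ha | ha
    · rw [ENNReal.ofReal_of_nonpos ha]
      convert measure_empty (μ := volume)
      refine Set.eq_empty_of_forall_notMem fun y hy => ?_
      have h1 : ballVolume d ‖y‖ < a := hy
      have h2 : 0 ≤ ballVolume d ‖y‖ :=
        mul_nonneg (unitBallVolume_pos d).le (pow_nonneg (norm_nonneg _) _)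
      linarith
    · obtain ⟨r, hr, rfl⟩ := exists_ballVolume_eq hd ha
      rw [← volume_ball_eq_ballVolume hd 0 hr]
      congr 1
      ext y
      rw [mem_ball_zero_iff]
      exact hf.lt_iff_lt (norm_nonneg y) hr
  refine Measure.ext_of_generateFrom_of_iUnion (Set.range Set.Iio) (fun n : ℕ => Set.Iio (n : ℝ))
    (borel_eq_generateFrom_Iio ℝ ▸ BorelSpace.measurable_eq) isPiSystem_Iio ?_
    (fun n => ⟨_, rfl⟩) (fun n => ?_) ?_
  · exact Set.eq_univ_of_forall fun x => Set.mem_iUnion.2 (exists_nat_gt x)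
  · rw [hIio]
    exact ENNReal.ofReal_ne_top
  · rintro _ ⟨a, rfl⟩
    rw [hIio, Measure.restrict_apply measurableSet_Iio, Set.inter_comm, Set.Ici_inter_Iio,
      Real.volume_Ico, sub_zero]

end BallVolume

/-! ### The coupling -/

section Coupling

variable {d : ℕ} {Q : Measure (ℕ → EuclideanSpace ℝ (Fin d))} [IsProbabilityMeasure Q]
  (hQ : IsSortedPoissonLaw volume (fun y : EuclideanSpace ℝ (Fin d) => ballVolume d ‖y‖) Q)

/-- The law of the displacements of all vertices, of an additional Poisson process, and of
independent colours. -/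
noncomputable def couplingMeasure {κ : Type*} [MeasurableSpace κ]
    (Q : Measure (ℕ → EuclideanSpace ℝ (Fin d))) [IsProbabilityMeasure Q] (p : PMF κ) :
    Measure (((List ℕ → ℕ → EuclideanSpace ℝ (Fin d)) × (ℕ → EuclideanSpace ℝ (Fin d))) ×
      (List ℕ ⊕ ℕ → κ)) :=
  ((Measure.infinitePi fun _ : List ℕ => Q).prod Q).prod
    (Measure.infinitePi fun _ : List ℕ ⊕ ℕ => p.toMeasure)

instance {κ : Type*} [MeasurableSpace κ] (p : PMF κ) :
    IsProbabilityMeasure (couplingMeasure Q p) := by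
  unfold couplingMeasure
  infer_instance

variable {κ : Type*} [MeasurableSpace κ] (p : PMF κ)

-- The assembled configuration and the indices of its points are functions of the displacements and
-- of the additional sequence, so the colours can be read along the indices.
include hQ in
theorem isColouredPalmPoisson_coupling (R : ℝ) (n : ℕ) :
    IsColouredPalmPoisson (couplingMeasure Q p) p (fun m ω => place ω.1 (configIdx R n ω.1 m))
      (fun m ω => ω.2 (configIdx R n ω.1 m)) := by
  have hm : ∀ m, Measurable fun q : (List ℕ → ℕ → EuclideanSpace ℝ (Fin d)) ×
      (ℕ → EuclideanSpace ℝ (Fin d)) => place q (configIdx R n q m) :=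
    measurable_place_configIdx R n
  have h := isIID_indepFun_reindex (p := p) (σ := configIdx R n)
    (P := (Measure.infinitePi fun _ : List ℕ => Q).prod Q) (measurableSet_configIdx_eq R n)
    ((ae_infinite_keptCodes hQ R n).mono fun q hq => configIdx_injective hq)
    (measurable_pi_lambda _ hm)
  refine ⟨fun m => (hm m).comp measurable_fst, fun ω => rfl, ?_, h.1, h.2⟩
  have h1 := (isPoissonProcess_kept hQ R n).comp (measurePreserving_fst
    (μ := (Measure.infinitePi fun _ : List ℕ => Q).prod Q)
    (ν := Measure.infinitePi fun _ : List ℕ ⊕ ℕ => p.toMeasure))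
  simp only [configIdx, place_vertexIdx]
  exact h1

theorem measurePreserving_displacements :
    MeasurePreserving (fun ω => ω.1.1) (couplingMeasure Q p)
      (Measure.infinitePi fun _ : List ℕ => Q) :=
  measurePreserving_fst.comp measurePreserving_fst

-- The weights below a vertex are the images of one sorted Poisson process under f_d(‖·‖). Reversal
-- of words only permutes the independent coordinates.
include hQ in
theorem isColouredPWIT_coupling (hd : 0 < d) :
    IsColouredPWIT (couplingMeasure Q p) p (fun v j ω => ballVolume d ‖ω.1.1 v.reverse j‖)
      (fun v ω => ω.2 (Sum.inl v.reverse)) := by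
  have hf := measurable_ballVolume d
  have hf' : Measurable fun y : EuclideanSpace ℝ (Fin d) => ballVolume d ‖y‖ :=
    hf.comp measurable_norm
  have hp : ∀ v : List ℕ, MeasurePreserving (fun ω => ω.1.1 v.reverse) (couplingMeasure Q p) Q :=
    fun v => (measurePreserving_eval_infinitePi (fun _ : List ℕ => Q) v.reverse).comp
      (measurePreserving_displacements p)
  have hj : ∀ j, Measurable fun η : ℕ → EuclideanSpace ℝ (Fin d) => ballVolume d ‖η j‖ :=
    fun j => hf'.comp (measurable_pi_apply j)
  have h := isIID_indepFun_reindex (p := p) (ι := List ℕ ⊕ ℕ)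
    (σ := fun _ (v : List ℕ) => Sum.inl v.reverse)
    (P := (Measure.infinitePi fun _ : List ℕ => Q).prod Q)
    (X := fun q (v : List ℕ) j => ballVolume d ‖q.1 v.reverse j‖)
    (fun v i => MeasurableSet.const (Sum.inl v.reverse = i))
    (ae_of_all _ fun _ => Sum.inl_injective.comp List.reverse_injective)
    (measurable_pi_lambda _ fun v => measurable_pi_lambda _ fun j =>
      (hj j).comp ((measurable_pi_apply v.reverse).comp measurable_fst))
  refine ⟨fun v j => (hj j).comp (hp v).measurable, fun v => ?_, fun v => ?_, ?_, h.1, h.2⟩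
  · exact (hp v).quasiMeasurePreserving.ae hQ.strictMono
  · rw [← map_ballVolume_norm hd]
    exact (hQ.isPoissonProcess.comp (hp v)).map
      (fun j => (measurable_pi_apply j).comp (hp v).measurable) hf'
  · have h1 : iIndepFun (fun (v : List ℕ) ω => ω.1.1 v.reverse) (couplingMeasure Q p) := by
      rw [iIndepFun_iff_map_fun_eq_infinitePi_map fun v => (hp v).measurable]
      simp_rw [fun v => (hp v).map_eq]
      have h2 := congrArg (Measure.map fun (ω : List ℕ → ℕ → EuclideanSpace ℝ (Fin d)) v =>
        ω (List.reverse v)) (measurePreserving_displacements (Q := Q) p).map_eq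
      rw [Measure.map_infinitePi_infinitePi_of_inj (P := fun _ : List ℕ => Q)
        List.reverse_injective, Measure.map_map (by fun_prop)
        (measurePreserving_displacements (Q := Q) p).measurable] at h2
      exact h2
    exact h1.comp (fun _ η j => ballVolume d ‖η j‖) fun _ => measurable_pi_lambda _ hj

/-- With s^d ≤ e^{-10T} and T ≤ e^T, the four contributions are at most 1, 2, 1 and 1 times e^{-3T},
and 5 ≤ e^{2T}. The cap e^{4T} balances the first two: its inverse must beat the factor e^T, while
the cap itself must be beaten by s^d. -/
theorem failure_bound {T s : ℝ} (hT : 1 ≤ T) (hs : 0 ≤ s) (hs' : s ^ 2 = 4 / 5)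
    (hd : 100 * T < d) :
    (Real.exp (-(4 * T)) + Real.exp (4 * T) * (2 * (T * s ^ d)) + T * s ^ d * T) * Real.exp T +
      Real.exp (-(3 * T)) ≤ Real.exp (-T) := by
  -- Squared, this is 4/5 = 1 - 1/5 ≤ e^{-1/5}.
  have h1 : s ≤ Real.exp (-(1 / 10)) := by
    rw [← pow_le_pow_iff_left₀ hs (Real.exp_pos _).le two_ne_zero, hs', ← Real.exp_nat_mul]
    have := Real.add_one_le_exp (((2 : ℕ) : ℝ) * -(1 / 10))
    norm_num at this ⊢
    linarith
  have h2 : s ^ d ≤ Real.exp (-(10 * T)) := by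
    refine (pow_le_pow_left₀ hs h1 d).trans ?_
    rw [← Real.exp_nat_mul]
    exact Real.exp_le_exp.2 (by linarith)
  have h3 : T ≤ Real.exp T := by linarith [Real.add_one_le_exp T]
  have h0 : 0 < T := by linarith
  have h4 : T * s ^ d ≤ Real.exp (-(9 * T)) := by
    refine (mul_le_mul h3 h2 (by positivity) (Real.exp_pos _).le).trans_eq ?_
    rw [← Real.exp_add]
    ring_nf
  have h5 : Real.exp (-(4 * T)) * Real.exp T = Real.exp (-(3 * T)) := by
    rw [← Real.exp_add]
    ring_nf
  have h6 : Real.exp (4 * T) * (2 * (T * s ^ d)) * Real.exp T ≤ 2 * Real.exp (-(3 * T)) := by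
    calc _ ≤ Real.exp (4 * T) * (2 * Real.exp (-(9 * T))) * Real.exp T := by gcongr
      _ = 2 * Real.exp (4 * T + -(9 * T) + T) := by
        rw [Real.exp_add, Real.exp_add]
        ring
      _ ≤ _ := by
        gcongr
        linarith
  have h7 : T * s ^ d * T * Real.exp T ≤ Real.exp (-(3 * T)) := by
    calc _ ≤ Real.exp (-(9 * T)) * Real.exp T * Real.exp T := by gcongr
      _ = Real.exp (-(9 * T) + T + T) := by rw [Real.exp_add, Real.exp_add]
      _ ≤ _ := by
        gcongr
        linarith
  have h8 : 5 ≤ Real.exp (2 * T) := by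
    have h := Real.exp_one_gt_d9
    calc (5 : ℝ) ≤ Real.exp 1 * Real.exp 1 := by nlinarith
      _ = Real.exp (1 + 1) := (Real.exp_add _ _).symm
      _ ≤ _ := by
        gcongr
        linarith
  calc _ ≤ 5 * Real.exp (-(3 * T)) := by
        rw [add_mul, add_mul, h5]
        linarith
    _ ≤ Real.exp (2 * T) * Real.exp (-(3 * T)) := by gcongr
    _ = _ := by
      rw [← Real.exp_add]
      ring_nf

include hQ in
theorem exists_measure_failure_le {T R : ℝ} (hT : 1 ≤ T) (hdT : 100 * T < d) (hR : 0 ≤ R)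
    (hRT : ballVolume d R = T) :
    ∃ n, couplingMeasure Q p {ω | ¬ ((keptCodes R n ω.1).Infinite ∧ IsSeparated R ω.1.1 ∧
      ∀ u, Desc R ω.1.1 u → Encodable.encode u < n)} ≤ ENNReal.ofReal (Real.exp (-T)) := by
  have hd : 0 < d := by
    have : (0 : ℝ) < d := by linarith
    exact_mod_cast this
  have hR' : 0 < R := by
    refine hR.lt_of_ne fun h => ?_
    rw [← h, ballVolume_zero hd] at hRT
    linarith
  -- The ratio ρ/R, so that a ball of radius ρ has volume T s^d.
  set s : ℝ := √(4 / 5) with hsdef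
  have hs : 0 < s := by positivity
  have hs2 : s ^ 2 = 4 / 5 := Real.sq_sqrt (by norm_num)
  have hs1 : s ≤ 1 := by nlinarith
  have hvol : ∀ x : EuclideanSpace ℝ (Fin d),
      volume (Metric.ball x (s * R)) ≤ ENNReal.ofReal (T * s ^ d) := by
    intro x
    rw [volume_ball_eq_ballVolume hd x (by positivity), ballVolume, mul_pow, ← hRT, ballVolume]
    exact le_of_eq (by congr 1; ring)
  have hK := tsum_measure_desc (strictMonoOn_ballVolume hd) (measurable_ballVolume d)
    (ballVolume_zero hd) (map_ballVolume_norm hd) hQ hR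
  rw [hRT] at hK
  have hsep := measure_not_isSeparated_le hvol hQ (R := R) (by positivity)
    (by rw [mul_pow, hs2]) (by nlinarith) (M := ENNReal.ofReal (Real.exp (4 * T)))
    (by simp [Real.exp_pos]) ENNReal.ofReal_ne_top
  obtain ⟨n, hn⟩ := exists_measure_desc_beyond_le (Q := Q) (R := R)
    (by rw [hK]; exact ENNReal.ofReal_ne_top)
    (δ := ENNReal.ofReal (Real.exp (-(3 * T)))) (by simp [Real.exp_pos])
  refine ⟨n, ?_⟩
  -- Stated for arbitrary sets, as measurability of the separation event is not available.
  have hpull : ∀ B : Set (List ℕ → ℕ → EuclideanSpace ℝ (Fin d)),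
      couplingMeasure Q p {ω | ω.1.1 ∈ B} ≤ (Measure.infinitePi fun _ : List ℕ => Q) B := by
    intro B
    rw [← (measurePreserving_displacements (Q := Q) p).map_eq]
    exact Measure.le_map_apply (measurePreserving_displacements (Q := Q) p).measurable.aemeasurable B
  have hnull : couplingMeasure Q p {ω | ¬ (keptCodes R n ω.1).Infinite} = 0 :=
    (measurePreserving_fst (μ := (Measure.infinitePi fun _ : List ℕ => Q).prod Q)
      (ν := Measure.infinitePi fun _ : List ℕ ⊕ ℕ =>
        p.toMeasure)).quasiMeasurePreserving.ae (ae_infinite_keptCodes hQ R n)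
  have hsub : {ω | ¬ ((keptCodes R n ω.1).Infinite ∧ IsSeparated R ω.1.1 ∧
      ∀ u, Desc R ω.1.1 u → Encodable.encode u < n)} ⊆
      {ω : ((List ℕ → ℕ → EuclideanSpace ℝ (Fin d)) × (ℕ → EuclideanSpace ℝ (Fin d))) ×
        (List ℕ ⊕ ℕ → κ) | ¬ (keptCodes R n ω.1).Infinite} ∪
      ({ω | ω.1.1 ∈ {ω | ¬ IsSeparated R ω}} ∪
        {ω | ω.1.1 ∈ {ω | ∃ u, n ≤ Encodable.encode u ∧ Desc R ω u}}) := by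
    intro ω hω
    by_contra hc
    simp only [Set.mem_union, Set.mem_ofPred_eq, not_or, not_not, not_exists, not_and] at hc
    exact hω ⟨hc.1, hc.2.1, fun u hu => not_le.1 fun h => hc.2.2 u h hu⟩
  have h0 := mul_nonneg (zero_le_one.trans hT) (pow_nonneg hs.le d)
  have htwo : 2 * ENNReal.ofReal (T * s ^ d) = ENNReal.ofReal (2 * (T * s ^ d)) := by
    rw [ENNReal.ofReal_mul zero_le_two, ENNReal.ofReal_ofNat]
  rw [hK, volume_ball_eq_ballVolume hd _ hR, hRT, ← ENNReal.ofReal_inv_of_pos (Real.exp_pos _),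
    ← Real.exp_neg, htwo,
    ← ENNReal.ofReal_mul (Real.exp_pos _).le, ← ENNReal.ofReal_mul h0,
    ← ENNReal.ofReal_add (by positivity) (by positivity),
    ← ENNReal.ofReal_add (by positivity) (by positivity),
    ← ENNReal.ofReal_mul (by positivity)] at hsep
  calc _ ≤ 0 + (_ + _) := (measure_mono hsub).trans ((measure_union_le _ _).trans
        (add_le_add hnull.le ((measure_union_le _ _).trans
          (add_le_add ((hpull _).trans hsep) ((hpull _).trans hn)))))
    _ ≤ _ := by
        rw [zero_add, ← ENNReal.ofReal_add (by positivity) (by positivity)]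
        exact ENNReal.ofReal_le_ofReal (failure_bound hT hs.le hs2 hdT)

end Coupling

end PWITCoupling

theorem proposition4p1 :
    ∃ α : ℝ, 0 < α ∧ ∃ c : ℝ, ∀ (T : ℝ) (d : ℕ) (R : ℝ), 1 ≤ T → c * T < (d : ℝ) →
      0 ≤ R → PWITCoupling.ballVolume d R = T →
      ∀ (k : ℕ) (p : PMF (Fin k)),
        ∃ (Ω : Type) (_ : MeasurableSpace Ω) (P : Measure Ω) (_ : IsProbabilityMeasure P)
          (X : ℕ → Ω → EuclideanSpace ℝ (Fin d)) (C : ℕ → Ω → Fin k)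
          (t : List ℕ → ℕ → Ω → ℝ) (C' : List ℕ → Ω → Fin k),
          PWITCoupling.IsColouredPalmPoisson P p X C ∧
          PWITCoupling.IsColouredPWIT P p t C' ∧
          ∃ A : Set Ω, MeasurableSet A ∧ ENNReal.ofReal (1 - Real.exp (-α * T)) ≤ P A ∧
            ∀ ω ∈ A, ∃ φ : EuclideanSpace ℝ (Fin d) → List ℕ,
              PWITCoupling.IsAgreement R T (fun n => X n ω) (fun n => C n ω)
                (fun v j => t v j ω) (fun v => C' v ω) φ := by
  -- The constants are those of `failure_bound`.
  refine ⟨1, one_pos, 100, fun T d R hT hdT hR hRT k p => ?_⟩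
  have hd : 0 < d := by
    have : (0 : ℝ) < d := by linarith
    exact_mod_cast this
  have hR' : 0 < R := by
    refine hR.lt_of_ne fun h => ?_
    rw [← h, PWITCoupling.ballVolume_zero hd] at hRT
    linarith
  obtain ⟨Q, hQ⟩ := PWITCoupling.exists_isSortedPoissonLaw
    (ν := (volume : Measure (EuclideanSpace ℝ (Fin d))))
    ((PWITCoupling.measurable_ballVolume d).comp measurable_norm)
    (PWITCoupling.map_ballVolume_norm hd)
  have := hQ.isProbabilityMeasure
  obtain ⟨n, hn⟩ := PWITCoupling.exists_measure_failure_le hQ p hT hdT hR hRT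
  refine ⟨_, inferInstance, PWITCoupling.couplingMeasure Q p, inferInstance, _, _, _, _,
    PWITCoupling.isColouredPalmPoisson_coupling hQ p R n,
    PWITCoupling.isColouredPWIT_coupling hQ p hd,
    -- The failure event is only controlled in outer measure; the complement of a measurable hull of
    -- it is a measurable event on which nothing fails.
    (toMeasurable (PWITCoupling.couplingMeasure Q p)
      {ω | ¬ ((PWITCoupling.keptCodes R n ω.1).Infinite ∧ PWITCoupling.IsSeparated R ω.1.1 ∧
        ∀ u, PWITCoupling.Desc R ω.1.1 u → Encodable.encode u < n)})ᶜ,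
    (measurableSet_toMeasurable _ _).compl, ?_, fun ω hω => ?_⟩
  swap
  · have h := not_not.1 fun h => hω (subset_toMeasurable _ _ h)
    rw [← hRT]
    exact PWITCoupling.exists_isAgreement_configuration (PWITCoupling.strictMonoOn_ballVolume hd)
      hR' h.1 h.2.1 h.2.2 ω.2
  · rw [prob_compl_eq_one_sub (measurableSet_toMeasurable _ _), measure_toMeasurable,
      neg_one_mul, ENNReal.ofReal_sub _ (Real.exp_pos _).le, ENNReal.ofReal_one]
    exact tsub_le_tsub_left hn 1
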